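/- Let $\Lambda$ be the infinite wedge space over $\mathbb C$: it has the basis $v_S=\underline{s_1}\wedge\underline{s_2}\wedge\cdots$, where $S=\{s_1>s_2>\cdots\}\subset\mathbb Z+\tfrac12$ contains finitely many positive and misses finitely many negative half-integers. Let $\psi_k$ be the wedge product with $\underline k$, let $\psi_k^*$ be its adjoint for the inner product with orthonormal basis $(v_S)$, and let $E_{ij}$ act as the normally ordered product, namely as $\psi_i\psi_j^*$ if $j>0$ and as $-\psi_j^*\psi_i$ if $j<0$. Put $\varsigma(z)=e^{z/2}-e^{-z/2}$, $\mathcal S(z)=\varsigma(z)/z$, $$\mathcal E_r(z)=\sum_{k\in\mathbb Z+\frac12}e^{z(k-\frac r2)}E_{k-r,k}+\frac{\delta_{r,0}}{\varsigma(z)},\qquad \alpha_1=\mathcal E_1(0),$$ $$\mathsf A(z)=\mathcal S(z)^{tz}\sum_{k\in\mathbb Z}\frac{\varsigma(z)^k}{(tz+1)_k}\,\mathcal E_k(z)=\sum_{n\ge0}t^n\,\mathsf A^n(z),\qquad (a+1)_k=\frac{(a+k)!}{a!},$$ where $\frac1{(a+1)_k}$ means $\frac{1}{(a+1)\cdots(a+k)}$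 for $k\ge0$ and $a(a-1)\cdots(a+k+1)$ for $k\le0$. For variables $x_1,\dots,x_n$ ($n\ge1$) let $\mathsf T(x_1,\dots,x_n)=x_1\cdots x_n\,(x_1+\cdots+x_n)^{n-2}$ and $\mathcal E_0(x_1,\dots,x_n)=\mathsf T(x_1,\dots,x_n)\,\mathcal E_0(x_1+\cdots+x_n)$, and let $$\mathsf A^\vee(x_1,\dots,x_n)=\mathsf T(x_1,\dots,x_n)\Big[x_n\ln\Big(1+\frac{x_1+\cdots+x_{n-1}}{x_n}\Big)\mathsf A^0(x_1+\cdots+x_n)+\frac{x_n}{x_1+\cdots+x_n}\,\mathsf A^1(x_1+\cdots+x_n)\Big].$$ Let $m\ge0$ and let $w_1,\dots,w_m$ be formal variables. For $S\subset\{1,\dots,m\}$ put $$\mathsf E(w_S,s)=\sum_{\pi}s^{|S|-\ell(\pi)}\prod_{p=1}^{\ell(\pi)}\mathcal E_0(w_{\pi_p}),$$ the sum being over all set partitions $\pi=\{\pi_1,\dots,\pi_{\ell(\pi)}\}$ of $S$, where $w_P$ denotes the list of the $w_i$ with $i\in P$, in increasing order of $i$. Let $$\mathsf M(w_1,\dots,w_m)=\sum_{S\subset\{1,\dots,m\}}(-1)^{|S|}\Big(\prod_{i\notin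 S}\mathsf A(w_i)\Big)\,e^{\alpha_1}\,\mathsf E(w_S,-t),$$ where the factors $\mathsf A(w_i)$ are ordered from left to right by increasing index $i$. Everything is a formal power series in $t$ whose coefficients are operators given by their matrices in the basis $(v_S)$; the matrix entries are formal series in $w_1,\dots,w_m$, expanded in the region $|w_1|\ll|w_2|\ll\cdots\ll|w_m|\ll1$, that is, series of monomials $w_1^{e_1}\cdots w_m^{e_m}$, $e\in\mathbb Z^m$, with complex coefficients and with well-ordered support for the lexicographic order in which $e_1$ is compared first. Then all the operator products in $\mathsf M(w_1,\dots,w_m)$ and in the formula below are well defined (every matrix entry is given by a formally summable family), and (i) $[t^k]\,\mathsf M(w_1,\dots,w_m)=0$ for $k<m$; (ii) for $k=m$, $$[t^m]\,\mathsf M(w_1,\dots,w_m)=\sum_{\pi}\Big(\overrightarrow{\prod_{p=1,\dots,\ell(\pi)}}\mathsf A^\vee(w_{\pi_p})\Big)\,e^{\alpha_1},$$ where the sum is over all set partitions $\pi$ of $\{1,\dots,m\}$, and the factors $\mathsf A^\vee(w_{\pi_p})$ are ordered from left to right by increasing maximal element of $\pi_p$. -/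

import Mathlib

noncomputable section

namespace InfWedge

/-! ### The infinite wedge space

A half-integer `k = n + 1/2` is encoded by the integer `n` throughout; thus `k > 0` means `0 ≤ n`
and `k < 0` means `n < 0`. -/

/-- A set `S` of half-integers for which `S₊ = {k ∈ S : k > 0}` and `S₋ = {k ∉ S : k < 0}` are
finite. These sets index the basis `v_S` of the infinite wedge space. -/
@[ext]
structure Config where
  carrier : Set ℤ
  finite_plus : {n | n ∈ carrier ∧ 0 ≤ n}.Finite
  finite_minus : {n | n ∉ carrier ∧ n < 0}.Finite

/-- `S ∪ {k}`. -/
def Config.add (S : Config) (k : ℤ) : Config where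
  carrier := insert k S.carrier
  finite_plus := by
    refine (S.finite_plus.union (Set.finite_singleton k)).subset ?_
    rintro n ⟨hn, h0⟩
    rcases hn with rfl | hn
    · exact Or.inr rfl
    · exact Or.inl ⟨hn, h0⟩
  finite_minus := S.finite_minus.subset fun _ hn =>
    ⟨fun h => hn.1 (Set.mem_insert_of_mem _ h), hn.2⟩

/-- `S \ {k}`. -/
def Config.remove (S : Config) (k : ℤ) : Config where
  carrier := S.carrier \ {k}
  finite_plus := S.finite_plus.subset fun _ hn => ⟨hn.1.1, hn.2⟩
  finite_minus := by
    refine (S.finite_minus.union (Set.finite_singleton k)).subset ?_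
    rintro n ⟨hn, h0⟩
    by_cases h : n = k
    · exact Or.inr h
    · exact Or.inl ⟨fun hS => hn ⟨hS, h⟩, h0⟩

/-- The infinite wedge space: the complex vector space with basis `v_S = Finsupp.single S 1`. -/
abbrev Wedge : Type := Config →₀ ℂ

/-- `(-1)` to the number of elements of `S` that are larger than `k`: the sign that brings
`k ∧ s₁ ∧ s₂ ∧ ⋯` into decreasing order. -/
def wedgeSign (S : Config) (k : ℤ) : ℂ := (-1) ^ {s | s ∈ S.carrier ∧ k < s}.ncard

open Classical in
/-- The fermionic operator `ψ_k`: wedge product with the basis vector `k` from the left. -/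
def psi (k : ℤ) : Wedge →ₗ[ℂ] Wedge :=
  Finsupp.linearCombination ℂ fun S =>
    if k ∈ S.carrier then 0 else Finsupp.single (S.add k) (wedgeSign S k)

open Classical in
/-- The operator `ψ_k^*`, adjoint to `ψ_k` for the inner product with orthonormal basis `v_S`;
see `psiStar_adjoint`. -/
def psiStar (k : ℤ) : Wedge →ₗ[ℂ] Wedge :=
  Finsupp.linearCombination ℂ fun S =>
    if k ∈ S.carrier then Finsupp.single (S.remove k) (wedgeSign S k) else 0

/-- `(ψ_k^* v_S, v_T) = (v_S, ψ_k v_T)`. -/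
theorem psiStar_adjoint (k : ℤ) (S T : Config) :
    psiStar k (Finsupp.single S 1) T = psi k (Finsupp.single T 1) S := by
  classical
  have key : (k ∈ S.carrier ∧ S.remove k = T) ↔ (k ∉ T.carrier ∧ T.add k = S) := by
    constructor
    · rintro ⟨h, rfl⟩
      refine ⟨fun h' => h'.2 rfl, ?_⟩
      ext n
      by_cases hn : n = k <;> simp [Config.add, Config.remove, hn, h]
    · rintro ⟨h, rfl⟩
      refine ⟨Set.mem_insert _ _, ?_⟩
      ext n
      by_cases hn : n = k <;> simp [Config.add, Config.remove, hn, h]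
  have hs : S.remove k = T → wedgeSign S k = wedgeSign T k := by
    rintro rfl
    unfold wedgeSign
    congr 2
    ext n
    simp only [Config.remove, Set.mem_ofPred_eq, Set.mem_sdiff, Set.mem_singleton_iff]
    constructor
    · rintro ⟨h1, h2⟩
      exact ⟨⟨h1, by omega⟩, h2⟩
    · rintro ⟨⟨h1, _⟩, h2⟩
      exact ⟨h1, h2⟩
  simp only [psi, psiStar, Finsupp.linearCombination_single, one_smul]
  by_cases h : k ∈ S.carrier ∧ S.remove k = T
  · have h' := key.1 h
    rw [if_pos h.1, if_neg h'.1, h.2, h'.2, Finsupp.single_eq_same, Finsupp.single_eq_same,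
      hs h.2]
  · have h' : ¬ (k ∉ T.carrier ∧ T.add k = S) := fun h2 => h (key.2 h2)
    have e1 : (if k ∈ S.carrier then Finsupp.single (S.remove k) (wedgeSign S k) else 0 : Wedge) T
        = 0 := by
      split_ifs with h1
      · exact Finsupp.single_eq_of_ne (fun h2 => h ⟨h1, h2.symm⟩)
      · rfl
    have e2 : (if k ∈ T.carrier then 0 else Finsupp.single (T.add k) (wedgeSign T k) : Wedge) S
        = 0 := by
      split_ifs with h1
      · rfl
      · exact Finsupp.single_eq_of_ne (fun h2 => h' ⟨h1, h2.symm⟩)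
    rw [e1, e2]

/-- The action of the matrix unit `E_{ij}` of `gl(∞)`: the normally ordered product
`:ψ_i ψ_j^*:`, equal to `ψ_i ψ_j^*` for `j > 0` and to `-ψ_j^* ψ_i` for `j < 0`. -/
def matrixUnit (i j : ℤ) : Wedge →ₗ[ℂ] Wedge :=
  if 0 ≤ j then psi i ∘ₗ psiStar j else -(psiStar j ∘ₗ psi i)

/-! ### Coefficients

The variables `w_0, …, w_{m-1}` are formal, and all functions of them are expanded in the region
`|w_0| ≪ |w_1| ≪ ⋯ ≪ |w_{m-1}| ≪ 1`. -/

/-- The field of Hahn series in `w_0, …, w_{m-1}` with complex coefficients and exponents in `ℤ^m`,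
ordered lexicographically with the exponent of `w_0` first. So a positive power of `w_i` times any
Laurent monomial in the `w_j` with `j > i` is small: expansions are in the region
`|w_0| ≪ |w_1| ≪ ⋯ ≪ |w_{m-1}| ≪ 1`. -/
abbrev Coef (m : ℕ) : Type := HahnSeries (Lex (Fin m → ℤ)) ℂ

/-- The variable `w_i`. -/
def var {m : ℕ} (i : Fin m) : Coef m := HahnSeries.single (toLex (Pi.single i 1)) 1

/-- `e^z`, for `z` of positive order. -/
def expC {m : ℕ} (z : Coef m) : Coef m := PowerSeries.heval z (PowerSeries.exp ℂ)

/-- `ln (1 + y)`, for `y` of positive order. -/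
def logOnePlus {m : ℕ} (y : Coef m) : Coef m :=
  PowerSeries.heval y (PowerSeries.log ℂ)

/-- `ς(z) = e^{z/2} - e^{-z/2}`. -/
def sigma {m : ℕ} (z : Coef m) : Coef m := expC ((1 / 2 : ℂ) • z) - expC (-((1 / 2 : ℂ) • z))

/-- `𝒮(z) = ς(z) / z`. -/
def calS {m : ℕ} (z : Coef m) : Coef m := sigma z / z

/-! ### Operators

An operator is given by its matrix in the basis `v_S`, with entries in `Coef m`; `A U V` is the
coefficient of `v_U` in `A v_V`. Since some operators raise the energy without bound, the entries of
a composition are infinite sums of formal series. -/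

/-- A family of formal series can be summed when the union of the supports is well-ordered and every
monomial occurs in only finitely many members. -/
def FormallySummable {m : ℕ} {ι : Type} (f : ι → Coef m) : Prop :=
  (⋃ a, (f a).support).IsPWO ∧ ∀ g, {a | (f a).coeff g ≠ 0}.Finite

open Classical in
/-- The sum of a formally summable family (and `0` for other families). -/
def formalSum {m : ℕ} {ι : Type} (f : ι → Coef m) : Coef m :=
  if h : FormallySummable f then HahnSeries.SummableFamily.hsum ⟨f, h.1, h.2⟩ else 0

/-- Matrices of operators on the infinite wedge space. -/
abbrev Op (m : ℕ) : Type := Config → Config → Coef m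

open Classical in
/-- The identity operator. -/
def Op.id (m : ℕ) : Op m := fun U V => if U = V then 1 else 0

/-- The composition `A B` (first `B`, then `A`). -/
def Op.comp {m : ℕ} (A B : Op m) : Op m := fun U V => formalSum fun T => A U T * B T V

/-- All the sums that define the composition `A B` make sense. -/
def Op.Composable {m : ℕ} (A B : Op m) : Prop :=
  ∀ U V, FormallySummable fun T => A U T * B T V

/-- The product `A₁ A₂ ⋯ A_n` of a list of operators, in this order. -/
def Op.prod {m : ℕ} : List (Op m) → Op m
  | [] => Op.id m
  | A :: L => A.comp (Op.prod L)

/-- All the compositions in `A₁ (A₂ (⋯ A_n))` make sense. -/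
def Op.ProdDefined {m : ℕ} : List (Op m) → Prop
  | [] => True
  | A :: L => A.Composable (Op.prod L) ∧ Op.ProdDefined L

/-- Formal power series `∑_{n ≥ 0} t^n A_n` with operators `A_n` as coefficients; the coefficient
`[t^n] A` is `A n`. -/
abbrev TOp (m : ℕ) : Type := ℕ → Op m

/-- An operator as a power series in `t` that does not depend on `t`. -/
def TOp.const {m : ℕ} (A : Op m) : TOp m := fun n => if n = 0 then A else 0

/-- Multiplication of a power series of operators by a scalar power series in `t`. -/
def TOp.scale {m : ℕ} (f : PowerSeries (Coef m)) (A : TOp m) : TOp m := fun n =>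
  ∑ p ∈ Finset.HasAntidiagonal.antidiagonal n, PowerSeries.coeff p.1 f • A p.2

/-- Composition of power series of operators. -/
def TOp.comp {m : ℕ} (A B : TOp m) : TOp m := fun n =>
  ∑ p ∈ Finset.HasAntidiagonal.antidiagonal n, (A p.1).comp (B p.2)

/-- All the sums in the composition of two power series of operators make sense. -/
def TOp.Composable {m : ℕ} (A B : TOp m) : Prop := ∀ i j, (A i).Composable (B j)

/-- The product `A₁ A₂ ⋯ A_n`, in this order. -/
def TOp.prod {m : ℕ} : List (TOp m) → TOp m
  | [] => TOp.const (Op.id m)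
  | A :: L => A.comp (TOp.prod L)

/-- All the compositions in `A₁ (A₂ (⋯ A_n))` make sense. -/
def TOp.ProdDefined {m : ℕ} : List (TOp m) → Prop
  | [] => True
  | A :: L => A.Composable (TOp.prod L) ∧ TOp.ProdDefined L

/-! ### The operators `ℰ_r(z)`, `α_k`, `A(z)` -/

open Classical in
/-- `ℰ_r(z) = ∑_k e^{z(k - r/2)} E_{k-r,k} + δ_{r,0} / ς(z)`, the sum over half-integers
`k = n + 1/2`. Each matrix entry of the sum has finitely many nonzero terms. -/
def calE {m : ℕ} (r : ℤ) (z : Coef m) : Op m := fun U V =>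
  (∑ᶠ n : ℤ, matrixUnit (n - r) n (Finsupp.single V 1) U •
      expC (((n : ℂ) + 1 / 2 - (r : ℂ) / 2) • z))
    + if r = 0 ∧ U = V then (sigma z)⁻¹ else 0

/-- `α_k = ℰ_k(0)`, for `k ≠ 0`. -/
def alpha (m : ℕ) (k : ℤ) : Op m := calE k 0

/-- `e^{α_1} = ∑_n α_1^n / n!`. Each matrix entry has finitely many nonzero terms. -/
def expAlpha1 (m : ℕ) : Op m := fun U V =>
  ∑ᶠ n : ℕ, ((n.factorial : ℂ)⁻¹) • Op.prod (List.replicate n (alpha m 1)) U V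

/-- `1 / (a+1)_k`, which is `1 / ((a+1) ⋯ (a+k))` for `k ≥ 0` and `a (a-1) ⋯ (a+k+1)` for
`k ≤ 0`. -/
def invPochhammer {m : ℕ} (a : PowerSeries (Coef m)) (k : ℤ) : PowerSeries (Coef m) :=
  if 0 ≤ k then (∏ i ∈ Finset.range k.toNat, (a + ((i + 1 : ℕ) : PowerSeries (Coef m))))⁻¹
  else ∏ i ∈ Finset.range (-k).toNat, (a - ((i : ℕ) : PowerSeries (Coef m)))

/-- `𝒮(z)^{tz} = exp (t z ln 𝒮(z))`, as a power series in `t`. -/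
def calSPow {m : ℕ} (z : Coef m) : PowerSeries (Coef m) :=
  PowerSeries.mk fun n => ((n.factorial : ℂ)⁻¹) • (z * logOnePlus (calS z - 1)) ^ n

/-- `A(z) = 𝒮(z)^{tz} ∑_{k ∈ ℤ} ς(z)^k / (tz+1)_k ℰ_k(z)`, as a power series in `t` with operator
coefficients. Each matrix entry of the sum over `k` has finitely many nonzero terms. -/
def opA {m : ℕ} (z : Coef m) : TOp m :=
  TOp.scale (calSPow z) fun n U V =>
    ∑ᶠ k : ℤ, PowerSeries.coeff n (invPochhammer (PowerSeries.C z * PowerSeries.X) k) *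
      (sigma z ^ k * calE k z U V)

/-! ### The operators `E(w_S, s)`, `M` and `A^∨` -/

/-- `w_P = ∑_{i ∈ P} w_i`. -/
def blockSum {m : ℕ} (P : Finset (Fin m)) : Coef m := ∑ i ∈ P, var i

/-- `T(x_1, …, x_k) = x_1 ⋯ x_k (x_1 + ⋯ + x_k)^{k-2}` for the variables `x = w_P`, `k = |P|`. -/
def treeT {m : ℕ} (P : Finset (Fin m)) : Coef m :=
  (∏ i ∈ P, var i) * blockSum P ^ ((P.card : ℤ) - 2)

/-- `ℰ_0(x_1, …, x_k) = T(x_1, …, x_k) ℰ_0(x_1 + ⋯ + x_k)` for the variables `x = w_P`. -/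
def calE0 {m : ℕ} (P : Finset (Fin m)) : Op m := treeT P • calE 0 (blockSum P)

open Classical in
/-- The maximal elements of the blocks of a set partition, in increasing order. -/
def blockMaxima {m : ℕ} {S : Finset (Fin m)} (π : Finpartition S) : List (Fin m) :=
  (List.finRange m).filter fun k => k ∈ S ∧ ∀ j ∈ π.part k, j ≤ k

/-- `E(w_S, s) = ∑_π s^{|S| - ℓ(π)} ∏_p ℰ_0(w_{π_p})`, the sum over set partitions of `S`. The
`ℰ_0` are diagonal, so the order of the product is immaterial. -/
def opE {m : ℕ} (S : Finset (Fin m)) (s : PowerSeries (Coef m)) : TOp m :=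
  ∑ π : Finpartition S, TOp.scale (s ^ (S.card - π.parts.card))
    (TOp.const (Op.prod ((blockMaxima π).map fun k => calE0 (π.part k))))

/-- The factors of `∏_{i ∉ S} A(w_i) e^{α_1} E(w_S, -t)`, the `A(w_i)` ordered by their indices. -/
def factorsM {m : ℕ} (S : Finset (Fin m)) : List (TOp m) :=
  ((List.finRange m).filter fun i => i ∉ S).map (fun i => opA (var i)) ++
    [TOp.const (expAlpha1 m), opE S (-PowerSeries.X)]

/-- `M(w_1, …, w_m) = ∑_S (-1)^{|S|} ∏_{i ∉ S} A(w_i) e^{α_1} E(w_S, -t)`. -/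
def opM (m : ℕ) : TOp m :=
  ∑ S : Finset (Fin m), ((-1 : ℤ) ^ S.card) • TOp.prod (factorsM S)

/-- `A^∨(w_P) = T(w_P) [ w_k ln (1 + (∑_{i ∈ P, i ≠ k} w_i) / w_k) A^0(∑_P w_i)
+ (w_k / ∑_P w_i) A^1(∑_P w_i) ]`, where `w_k` is the last variable, `k = max P`. -/
def opAvee {m : ℕ} (P : Finset (Fin m)) (k : Fin m) : Op m :=
  treeT P •
    ((var k * logOnePlus (blockSum (P.erase k) / var k)) • opA (blockSum P) 0
      + (var k / blockSum P) • opA (blockSum P) 1)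

/-- The factors of `A^∨(w_{π_1}) ⋯ A^∨(w_{π_ℓ}) e^{α_1}`, the blocks of `π` ordered by increasing
maximal elements. -/
def factorsAvee {m : ℕ} (π : Finpartition (Finset.univ : Finset (Fin m))) : List (Op m) :=
  (blockMaxima π).map (fun k => opAvee (π.part k) k) ++ [expAlpha1 m]

end InfWedge

end

/-! Conjugation by e^{α_1} removes the operators ℰ_0. Since [α_1, ℰ_j(z)] = ς(z) ℰ_{j+1}(z), one has
e^{α_1} ℰ_0(z) = A^0(z) e^{α_1} (`expAlpha1_comp_calE`). Hence M = N e^{α_1}, where N is the same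
alternating sum with every block T(w_P) ℰ_0(w_P) replaced by T(w_P) A^0(w_P) (`opM_eq`, `opN`).

The sum N is computed by recursion on the largest index k: N(R ∪ {k}) = ∑_{Q ⊆ R} N(R \ Q) X(k,Q)
(`opN_insert`). In the terms with k ∈ S, the block Q ∪ {k} of k is split off on the right. In the
terms with k ∉ S, the factor A(w_k) is moved to the right past all the A^0(w_P). The commutator
[A^0(x), ·] of an operator 𝒮(u)^{tc} ∑_l ς(u)^l/(tc+1)_l ℰ_l(u) is an operator of the same form,
with u replaced by x + u, the same c, and the scalar factor ς(tcx)(1 + x/u)^{tc}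
(`opAGen_commutator`). It comes from [ℰ_a(z), ℰ_b(w)] = ς(aw - bz) ℰ_{a+b}(z+w) and the binomial
series. So A(w_k) either passes a block or absorbs it, and after absorbing the blocks of a partition
of Q it has become B_k(Q) with a scalar factor; the sum of these factors over the partitions is
F_k(Q) (`opB_comp_opE'`). Therefore X(k,Q) = (-1)^{|Q|} F_k(Q) B_k(Q) - t^{|Q|} T(w_{Q∪k})
A^0(w_{Q∪k}).

Hurwitz's generalization of Abel's identity gives F_k(Q) = (-t)^{|Q|} (T(w_{Q∪k}) + O(t^2))
(`exists_treeF_eq`). As B_k(Q) equals A^0(w_{Q∪k}) at t = 0, the terms of order t^{|Q|} in X(k,Q)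
cancel (`opX_of_le`), and the coefficient of t^{|Q|+1} is T times the linear coefficient of B_k(Q),
which is A^∨ (`opX_succ`). The recursion then gives both claims at once (`opN_of_lt`, `opN_card`):
each block contributes at least as many powers of t as it has elements, and the leading coefficients
multiply to the sum over set partitions.

Convergence is controlled by the energy of configurations. The (U,V) entry of an operator with
leading variable w_k is, up to a bounded shift, of order w_k^{E(V)-E(U)}. In a product whose levels
increase strictly from left to right, the intermediate energies that contribute to a given monomial
are bounded, and only finitely many configurations lie below an energy (`Adm.composable`,
`Adm.comp_assoc`). Operators such as A^0 that do not raise the energy can be assigned any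
sufficiently high level, which allows them to stand on either side of B_k(Q). -/

noncomputable section

namespace InfWedge

open HahnSeries

variable {m : ℕ} {ι κ : Type}

/-! ### Algebraic structure on the coefficients

These restate the instances of Mathlib so that all of them unfold to the same partial order. -/

instance fieldCoef (m : ℕ) : Field (Coef m) :=
  { (HahnSeries.instField : Field (Coef m)), (HahnSeries.instCommRing : CommRing (Coef m)) with }

instance algebraCoef (m : ℕ) : Algebra ℂ (Coef m) :=
  { (HahnSeries.instAlgebra : Algebra ℂ (Coef m)) with }

instance charZeroCoef (m : ℕ) : CharZero (Coef m) :=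
  charZero_of_injective_algebraMap (algebraMap ℂ (Coef m)).injective

/-! ### Formal sums -/

theorem formallySummable_family (s : SummableFamily (Lex (Fin m → ℤ)) ℂ ι) :
    FormallySummable (m := m) s :=
  ⟨s.isPWO_iUnion_support, s.finite_co_support⟩

theorem formalSum_family (s : SummableFamily (Lex (Fin m → ℤ)) ℂ ι) :
    formalSum (m := m) s = s.hsum := by
  rw [formalSum, dif_pos (formallySummable_family s)]
  congr 1

theorem FormallySummable.exists_family {f : ι → Coef m} (hf : FormallySummable f) :
    ∃ s : SummableFamily (Lex (Fin m → ℤ)) ℂ ι, f = s :=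
  ⟨⟨f, hf.1, hf.2⟩, rfl⟩

theorem FormallySummable.coeff_formalSum {f : ι → Coef m} (hf : FormallySummable f)
    (g : Lex (Fin m → ℤ)) : (formalSum f).coeff g = ∑ᶠ a, (f a).coeff g := by
  obtain ⟨s, rfl⟩ := hf.exists_family
  rw [formalSum_family, SummableFamily.coeff_hsum]

theorem FormallySummable.add {f g : ι → Coef m} (hf : FormallySummable f)
    (hg : FormallySummable g) : FormallySummable fun a => f a + g a := by
  obtain ⟨s, rfl⟩ := hf.exists_family
  obtain ⟨t, rfl⟩ := hg.exists_family
  exact formallySummable_family (s + t)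

theorem formalSum_add {f g : ι → Coef m} (hf : FormallySummable f)
    (hg : FormallySummable g) : formalSum (fun a => f a + g a) = formalSum f + formalSum g := by
  obtain ⟨s, rfl⟩ := hf.exists_family
  obtain ⟨t, rfl⟩ := hg.exists_family
  rw [formalSum_family, formalSum_family, ← SummableFamily.hsum_add, ← formalSum_family]
  rfl

theorem FormallySummable.const_mul {f : ι → Coef m} (hf : FormallySummable f) (c : Coef m) :
    FormallySummable fun a => c * f a := by
  obtain ⟨s, rfl⟩ := hf.exists_family
  exact formallySummable_family (c • s)

theorem formalSum_const_mul {f : ι → Coef m} (hf : FormallySummable f) (c : Coef m) :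
    formalSum (fun a => c * f a) = c * formalSum f := by
  obtain ⟨s, rfl⟩ := hf.exists_family
  rw [formalSum_family, ← SummableFamily.hsum_smul, ← formalSum_family]
  rfl

theorem formalSum_mul_const {f : ι → Coef m} (hf : FormallySummable f) (c : Coef m) :
    formalSum (fun a => f a * c) = formalSum f * c := by
  simpa only [mul_comm c] using formalSum_const_mul hf c

theorem FormallySummable.neg {f : ι → Coef m} (hf : FormallySummable f) :
    FormallySummable fun a => - f a := by
  simpa using hf.const_mul (-1)

theorem formalSum_neg {f : ι → Coef m} (hf : FormallySummable f) :
    formalSum (fun a => - f a) = - formalSum f := by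
  simpa using formalSum_const_mul hf (-1)

theorem FormallySummable.sub {f g : ι → Coef m} (hf : FormallySummable f)
    (hg : FormallySummable g) : FormallySummable fun a => f a - g a := by
  simpa only [sub_eq_add_neg] using hf.add hg.neg

theorem formalSum_sub {f g : ι → Coef m} (hf : FormallySummable f)
    (hg : FormallySummable g) : formalSum (fun a => f a - g a) = formalSum f - formalSum g := by
  simpa only [sub_eq_add_neg, formalSum_neg hg] using formalSum_add hf hg.neg

theorem formallySummable_of_finite {f : ι → Coef m} (hf : f.support.Finite) :
    FormallySummable f := by
  classical
  have : f = SummableFamily.ofFinsupp (Finsupp.ofSupportFinite f hf) := rfl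
  rw [this]
  exact formallySummable_family _

theorem formalSum_of_finite {f : ι → Coef m} (hf : f.support.Finite) :
    formalSum f = ∑ᶠ a, f a := by
  classical
  have : f = SummableFamily.ofFinsupp (Finsupp.ofSupportFinite f hf) := rfl
  conv_lhs => rw [this]
  rw [formalSum_family, SummableFamily.hsum_ofFinsupp, Finsupp.sum,
    finsum_eq_sum_of_support_subset (s := (Finsupp.ofSupportFinite f hf).support)]
  · rfl
  · intro a ha
    simpa [Finsupp.ofSupportFinite] using ha

theorem formalSum_zero : formalSum (fun _ : ι => (0 : Coef m)) = 0 := by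
  rw [formalSum_of_finite (by simp [Function.support]), finsum_zero]

theorem formalSum_finset_sum (s : Finset κ) {f : κ → ι → Coef m}
    (hf : ∀ k ∈ s, FormallySummable (f k)) :
    FormallySummable (fun a => ∑ k ∈ s, f k a) ∧
      formalSum (fun a => ∑ k ∈ s, f k a) = ∑ k ∈ s, formalSum (f k) := by
  classical
  induction s using Finset.induction_on with
  | empty =>
    refine ⟨formallySummable_of_finite (by simp [Function.support]), ?_⟩
    simpa using formalSum_zero
  | insert k s hk ih =>
    have h1 := hf k (Finset.mem_insert_self _ _)
    have h2 := ih fun j hj => hf j (Finset.mem_insert_of_mem hj)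
    simp only [Finset.sum_insert hk]
    exact ⟨h1.add h2.1, by rw [formalSum_add h1 h2.1, h2.2]⟩

theorem formalSum_single {f : ι → Coef m} (a : ι) (hf : ∀ b ≠ a, f b = 0) :
    formalSum f = f a := by
  rw [formalSum_of_finite, finsum_eq_single f a hf]
  refine (Set.finite_singleton a).subset fun b hb => ?_
  by_contra h
  exact hb (hf b h)

theorem FormallySummable.comp_injective {f : ι → Coef m} (hf : FormallySummable f) {e : κ → ι}
    (he : e.Injective) : FormallySummable (f ∘ e) :=
  ⟨hf.1.mono (Set.iUnion_subset fun a => Set.subset_iUnion (fun b => (f b).support) (e a)),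
    fun g => (hf.2 g).preimage he.injOn⟩

theorem formallySummable_iff_comp {f : ι → Coef m} {e : κ → ι} (he : e.Injective)
    (h0 : ∀ a ∉ Set.range e, f a = 0) : FormallySummable (f ∘ e) ↔ FormallySummable f := by
  refine ⟨fun h => ⟨h.1.mono ?_, fun g => ?_⟩, fun h => h.comp_injective he⟩
  · refine Set.iUnion_subset fun a => ?_
    by_cases ha : a ∈ Set.range e
    · obtain ⟨b, rfl⟩ := ha
      exact Set.subset_iUnion (fun b => ((f ∘ e) b).support) b
    · simp [h0 a ha]
  · refine ((h.2 g).image e).subset fun a ha => ?_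
    by_cases hr : a ∈ Set.range e
    · obtain ⟨b, rfl⟩ := hr
      exact ⟨b, ha, rfl⟩
    · simp [h0 a hr] at ha

theorem finsum_comp_injective {M : Type*} [AddCommMonoid M] {f : ι → M} {e : κ → ι}
    (he : e.Injective) (h0 : ∀ a ∉ Set.range e, f a = 0) : ∑ᶠ b, f (e b) = ∑ᶠ a, f a := by
  have h1 : Set.univ ∩ Function.support f = Set.range e ∩ Function.support f := by
    ext b
    simp only [Set.mem_inter_iff, Set.mem_univ, true_and, Function.mem_support,
      iff_and_self]
    exact fun h => by_contra fun h' => h (h0 b h')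
  rw [← finsum_mem_range he, ← finsum_mem_univ f, ← finsum_mem_inter_support f Set.univ,
    ← finsum_mem_inter_support f (Set.range e), h1]

theorem formalSum_comp {f : ι → Coef m} {e : κ → ι} (he : e.Injective)
    (h0 : ∀ a ∉ Set.range e, f a = 0) : formalSum (f ∘ e) = formalSum f := by
  by_cases h : FormallySummable f
  · ext g
    rw [h.coeff_formalSum, (h.comp_injective he).coeff_formalSum]
    exact finsum_comp_injective (f := fun a => (f a).coeff g) he fun a ha => by
      rw [h0 a ha, HahnSeries.coeff_zero]
  -- Summability of the two families is equivalent, so if one sum takes the default value 0, so does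
  -- the other.
  · rw [formalSum, formalSum, dif_neg h, dif_neg (mt (formallySummable_iff_comp he h0).1 h)]

/-- Fubini holds coefficient by coefficient, where all sums are finite. Exponents in an inner sum
already occur in one of its terms, so the family of inner sums inherits both summability conditions.
-/
theorem FormallySummable.formalSum_prod {f : ι × κ → Coef m} (hf : FormallySummable f) :
    FormallySummable (fun a => formalSum fun b => f (a, b)) ∧
      formalSum (fun a => formalSum fun b => f (a, b)) = formalSum f := by
  have hin : ∀ a, FormallySummable fun b => f (a, b) := fun a =>
    hf.comp_injective (e := fun b => (a, b)) fun b c h => (Prod.mk.inj h).2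
  have hne : ∀ g a, (formalSum fun b => f (a, b)).coeff g ≠ 0 → ∃ b, (f (a, b)).coeff g ≠ 0 := by
    intro g a h
    rw [(hin a).coeff_formalSum] at h
    by_contra! h'
    exact h (finsum_eq_zero_of_forall_eq_zero h')
  have h1 : FormallySummable (fun a => formalSum fun b => f (a, b)) := by
    refine ⟨hf.1.mono ?_, fun g => ?_⟩
    · refine Set.iUnion_subset fun a g hg => ?_
      obtain ⟨b, hb⟩ := hne g a hg
      exact Set.mem_iUnion.2 ⟨(a, b), hb⟩
    · refine ((hf.2 g).image Prod.fst).subset fun a ha => ?_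
      obtain ⟨b, hb⟩ := hne g a ha
      exact ⟨(a, b), hb, rfl⟩
  refine ⟨h1, ?_⟩
  ext g
  rw [h1.coeff_formalSum, hf.coeff_formalSum, finsum_curry _ (hf.2 g)]
  exact finsum_congr fun a => (hin a).coeff_formalSum g

theorem FormallySummable.swap {f : ι × κ → Coef m} (hf : FormallySummable f) :
    FormallySummable fun p : κ × ι => f p.swap :=
  hf.comp_injective Prod.swap_injective

theorem FormallySummable.formalSum_comm {f : ι × κ → Coef m} (hf : FormallySummable f) :
    formalSum (fun a => formalSum fun b => f (a, b)) =
      formalSum (fun b => formalSum fun a => f (a, b)) := by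
  have h := hf.swap.formalSum_prod.2
  simp only [Prod.swap_prod_mk] at h
  rw [hf.formalSum_prod.2, h]
  exact (formalSum_comp Prod.swap_injective (fun a h => absurd ⟨a.swap, a.swap_swap⟩ h)).symm

/-- Fubini for the family supported on the graph of φ. It serves to sort products of exponential
series by total degree and sums over intermediate configurations by their energy. -/
theorem FormallySummable.formalSum_fiber [DecidableEq κ] {f : ι → Coef m} (hf : FormallySummable f) (φ : ι → κ) :
    FormallySummable (fun k => formalSum fun a => if φ a = k then f a else 0) ∧
    formalSum (fun k => formalSum fun a => if φ a = k then f a else 0) = formalSum f := by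
  set F : κ × ι → Coef m := fun p => if φ p.2 = p.1 then f p.2 else 0
  have he : Function.Injective fun a => (φ a, a) := fun a b h => (Prod.mk.inj h).2
  have h0 : ∀ p ∉ Set.range (fun a => (φ a, a)), F p = 0 := by
    rintro ⟨k, a⟩ h
    refine if_neg fun h' => h ⟨a, ?_⟩
    simpa using h'
  have hFf : F ∘ (fun a => (φ a, a)) = f := by
    ext1 a
    simp [F]
  have hF : FormallySummable F := (formallySummable_iff_comp he h0).1 (hFf ▸ hf)
  refine ⟨hF.formalSum_prod.1, ?_⟩
  rw [hF.formalSum_prod.2, ← formalSum_comp he h0, hFf]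

/-- Positive order identifies the terms of `SummableFamily.powerSeriesFamily` with multiples of
powers of z. The identities for exponentials, logarithms and powers can then be proved by
rearranging formal sums. -/
theorem hasFormalSum_heval {z : Coef m} (hz : 0 < z.orderTop) (f : PowerSeries ℂ) :
    FormallySummable (fun n => PowerSeries.coeff n f • z ^ n) ∧
      formalSum (fun n => PowerSeries.coeff n f • z ^ n) = PowerSeries.heval z f := by
  have h : (fun n => PowerSeries.coeff n f • z ^ n) = SummableFamily.powerSeriesFamily z f := by
    ext1 n
    rw [SummableFamily.powerSeriesFamily_of_orderTop_pos hz]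
  rw [h]
  exact ⟨formallySummable_family _, formalSum_family _⟩

theorem FormallySummable.mul {f : ι → Coef m} {g : κ → Coef m} (hf : FormallySummable f)
    (hg : FormallySummable g) : FormallySummable fun p : ι × κ => f p.1 * g p.2 := by
  obtain ⟨s, rfl⟩ := hf.exists_family
  obtain ⟨t, rfl⟩ := hg.exists_family
  exact formallySummable_family (s.mul t)

theorem formalSum_mul {f : ι → Coef m} {g : κ → Coef m} (hf : FormallySummable f)
    (hg : FormallySummable g) :
    formalSum (fun p : ι × κ => f p.1 * g p.2) = formalSum f * formalSum g := by
  rw [← (hf.mul hg).formalSum_prod.2]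
  simp only [formalSum_const_mul hg, formalSum_mul_const hf]

/-! ### Bounded supports

The expansions used here have their supports in cones on which all the partial sums
`g_0 + ⋯ + g_i` of the exponents are bounded below. -/

/-- The partial sum `g_0 + ⋯ + g_i` of an exponent. -/
def psum (i : Fin m) : Lex (Fin m → ℤ) →+ ℤ where
  toFun g := ∑ j ∈ Finset.Iic i, ofLex g j
  map_zero' := by
    apply Finset.sum_eq_zero
    intro j _
    rfl
  map_add' g h := Finset.sum_add_distrib

theorem psum_apply (i : Fin m) (g : Lex (Fin m → ℤ)) : psum i g = ∑ j ∈ Finset.Iic i, ofLex g j := rfl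

/-- At the first index where two exponents differ, their partial sums differ by exactly the
difference of the entries there. -/
theorem le_of_psum_le {g h : Lex (Fin m → ℤ)} (H : ∀ i, psum i g ≤ psum i h) : g ≤ h := by
  by_contra hlt
  obtain ⟨i, h1, h2⟩ := not_le.1 hlt
  have := H i
  rw [psum_apply, psum_apply, ← Finset.Iio_insert i, Finset.sum_insert (by simp),
    Finset.sum_insert (by simp)] at this
  have h3 : ∑ j ∈ Finset.Iio i, ofLex h j = ∑ j ∈ Finset.Iio i, ofLex g j :=
    Finset.sum_congr rfl fun j hj => h1 j (Finset.mem_Iio.1 hj)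
  have h2' : ofLex h i < ofLex g i := h2
  omega

theorem eq_of_psum_eq {g h : Lex (Fin m → ℤ)} (H : ∀ i, psum i g = psum i h) : g = h :=
  le_antisymm (le_of_psum_le fun i => (H i).le) (le_of_psum_le fun i => (H i).ge)

/-- Dickson's lemma, applied to the partial sums shifted by their lower bounds, yields a comparable
pair in every sequence. Comparison of all partial sums implies the lexicographic one. -/
theorem isPWO_cone (c : Fin m → ℤ) :
    {g : Lex (Fin m → ℤ) | ∀ i, c i ≤ psum i g}.IsPWO := by
  intro f
  have hN : (Set.univ : Set (Fin m → ℕ)).IsPWO := Set.isPWO_of_wellQuasiOrderedLE _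
  obtain ⟨a, b, hab, h⟩ := hN fun n => ⟨fun i => (psum i (f n).1 - c i).toNat, trivial⟩
  refine ⟨a, b, hab, le_of_psum_le fun i => ?_⟩
  have h1 : c i ≤ psum i (f a).1 := (f a).2 i
  have h2 : c i ≤ psum i (f b).1 := (f b).2 i
  have h3 : (psum i (f a).1 - c i).toNat ≤ (psum i (f b).1 - c i).toNat := h i
  omega

/-- The partial sums of the exponents in `f` are bounded below by `c`. -/
def Bdd (c : Fin m → ℤ) (f : Coef m) : Prop := ∀ g, f.coeff g ≠ 0 → ∀ i, c i ≤ psum i g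

theorem Bdd.mono {c d : Fin m → ℤ} {f : Coef m} (hf : Bdd c f) (h : d ≤ c) : Bdd d f :=
  fun g hg i => (h i).trans (hf g hg i)

theorem Bdd.zero (c : Fin m → ℤ) : Bdd c (0 : Coef m) := fun _ hg => absurd rfl hg

theorem Bdd.add {c : Fin m → ℤ} {f g : Coef m} (hf : Bdd c f) (hg : Bdd c g) : Bdd c (f + g) := by
  intro a ha
  by_cases h : f.coeff a = 0
  · refine hg a fun h' => ha ?_
    rw [HahnSeries.coeff_add, h, h', add_zero]
  · exact hf a h

theorem Bdd.mul {c d : Fin m → ℤ} {f g : Coef m} (hf : Bdd c f) (hg : Bdd d g) :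
    Bdd (c + d) (f * g) := by
  intro a ha i
  rw [HahnSeries.coeff_mul] at ha
  obtain ⟨p, hp, -⟩ := Finset.exists_ne_zero_of_sum_ne_zero ha
  rw [Finset.mem_antidiagonal] at hp
  have h1 := hf p.1 hp.1 i
  have h2 := hg p.2 hp.2.1 i
  rw [← hp.2.2, map_add, Pi.add_apply]
  exact add_le_add h1 h2

theorem Bdd.smul {c : Fin m → ℤ} {f : Coef m} (hf : Bdd c f) (r : ℂ) : Bdd c (r • f) := by
  intro a ha
  refine hf a fun h => ha ?_
  rw [HahnSeries.coeff_smul, h, smul_zero]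

theorem Bdd.neg {c : Fin m → ℤ} {f : Coef m} (hf : Bdd c f) : Bdd c (-f) := by
  simpa using hf.smul (-1)

theorem Bdd.sub {c : Fin m → ℤ} {f g : Coef m} (hf : Bdd c f) (hg : Bdd c g) : Bdd c (f - g) := by
  simpa only [sub_eq_add_neg] using hf.add hg.neg

theorem Bdd.sum {c : Fin m → ℤ} {s : Finset κ} {f : κ → Coef m} (hf : ∀ k ∈ s, Bdd c (f k)) :
    Bdd c (∑ k ∈ s, f k) :=
  Finset.sum_induction f (Bdd c) (fun _ _ => Bdd.add) (Bdd.zero c) hf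

theorem Bdd.finsum {c : Fin m → ℤ} {f : κ → Coef m} (hf : ∀ k, Bdd c (f k)) :
    Bdd c (∑ᶠ k, f k) :=
  finsum_induction (Bdd c) (Bdd.zero c) (fun _ _ => Bdd.add) hf

theorem Bdd.formalSum {c : Fin m → ℤ} {f : κ → Coef m} (hf : ∀ k, Bdd c (f k)) :
    Bdd c (formalSum f) := by
  by_cases h : FormallySummable f
  · intro g hg
    rw [h.coeff_formalSum] at hg
    by_contra hne
    exact hg (finsum_eq_zero_of_forall_eq_zero fun k => by_contra fun hk => hne (hf k g hk))
  · rw [InfWedge.formalSum, dif_neg h]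
    exact Bdd.zero c

/-- A common cone contains all supports, so well-ordering is automatic and only the finiteness for
each monomial is left to check. -/
theorem formallySummable_of_bdd {c : Fin m → ℤ} {f : κ → Coef m} (hf : ∀ k, Bdd c (f k))
    (hfin : ∀ g, {a | (f a).coeff g ≠ 0}.Finite) : FormallySummable f :=
  ⟨(isPWO_cone c).mono (Set.iUnion_subset fun k g hg => hf k g hg), hfin⟩

theorem Bdd.one : Bdd 0 (1 : Coef m) := by
  intro g hg i
  rw [HahnSeries.coeff_one] at hg
  rw [show g = 0 from by_contra fun h => hg (if_neg h), map_zero]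
  rfl

theorem Bdd.pow {f : Coef m} (hf : Bdd 0 f) (n : ℕ) : Bdd 0 (f ^ n) := by
  induction n with
  | zero => simpa using Bdd.one
  | succ n ih => simpa [pow_succ] using ih.mul hf

theorem Bdd.mul₀ {f g : Coef m} (hf : Bdd 0 f) (hg : Bdd 0 g) : Bdd 0 (f * g) := by
  simpa using hf.mul hg

/-- Series with nonnegative partial sums of exponents and without constant term. -/
def IsSmall (z : Coef m) : Prop := Bdd 0 z ∧ z.coeff 0 = 0

theorem IsSmall.bdd {z : Coef m} (hz : IsSmall z) : Bdd 0 z := hz.1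

theorem IsSmall.orderTop_pos {z : Coef m} (hz : IsSmall z) : 0 < z.orderTop := by
  by_cases h0 : z = 0
  · simp [h0]
  rw [HahnSeries.orderTop_of_ne_zero h0]
  refine WithTop.coe_pos.2 ?_
  set g := z.isWF_support.min (HahnSeries.support_nonempty_iff.2 h0)
  have hg : g ∈ z.support := z.isWF_support.min_mem _
  refine lt_of_le_of_ne (le_of_psum_le fun i => ?_) ?_
  · rw [map_zero]
    exact hz.1 g hg i
  · intro h
    rw [← h] at hg
    exact hg hz.2

theorem IsSmall.of_orderTop_pos {z : Coef m} (hz : Bdd 0 z) (h : 0 < z.orderTop) : IsSmall z :=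
  ⟨hz, HahnSeries.coeff_eq_zero_of_lt_orderTop h⟩

theorem IsSmall.zero : IsSmall (0 : Coef m) := ⟨Bdd.zero 0, rfl⟩

theorem IsSmall.add {z w : Coef m} (hz : IsSmall z) (hw : IsSmall w) : IsSmall (z + w) :=
  ⟨hz.1.add hw.1, by rw [HahnSeries.coeff_add, hz.2, hw.2, add_zero]⟩

theorem IsSmall.smul {z : Coef m} (hz : IsSmall z) (r : ℂ) : IsSmall (r • z) :=
  ⟨hz.1.smul r, by rw [HahnSeries.coeff_smul, hz.2, smul_zero]⟩

theorem IsSmall.neg {z : Coef m} (hz : IsSmall z) : IsSmall (-z) := by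
  simpa using hz.smul (-1)

theorem IsSmall.sub {z w : Coef m} (hz : IsSmall z) (hw : IsSmall w) : IsSmall (z - w) := by
  simpa only [sub_eq_add_neg] using hz.add hw.neg

/-- If two exponents with nonnegative partial sums add up to 0, both vanish. So the constant term of
a product is the product of the constant terms. -/
theorem IsSmall.mul_bdd {z w : Coef m} (hz : IsSmall z) (hw : Bdd 0 w) : IsSmall (z * w) := by
  refine ⟨hz.1.mul₀ hw, ?_⟩
  rw [HahnSeries.coeff_mul]
  refine Finset.sum_eq_zero fun p hp => ?_
  rw [Finset.mem_antidiagonal] at hp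
  have h1 : p.1 = 0 := eq_of_psum_eq fun i => by
    have h1 := hz.1 p.1 hp.1 i
    have h2 := hw p.2 hp.2.1 i
    have h3 := congrArg (psum i) hp.2.2
    simp only [map_add, map_zero, Pi.zero_apply] at h1 h2 h3 ⊢
    omega
  rw [h1, hz.2, zero_mul]

theorem IsSmall.sum {s : Finset κ} {f : κ → Coef m} (hf : ∀ k ∈ s, IsSmall (f k)) :
    IsSmall (∑ k ∈ s, f k) :=
  Finset.sum_induction f IsSmall (fun _ _ => IsSmall.add) IsSmall.zero hf

theorem IsSmall.bdd_heval {z : Coef m} (hz : IsSmall z) (f : PowerSeries ℂ) :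
    Bdd 0 (PowerSeries.heval z f) := by
  rw [← (hasFormalSum_heval hz.orderTop_pos f).2]
  exact Bdd.formalSum fun n => (hz.1.pow n).smul _

theorem IsSmall.heval {z : Coef m} (hz : IsSmall z) {f : PowerSeries ℂ}
    (hf : PowerSeries.constantCoeff f = 0) : IsSmall (PowerSeries.heval z f) :=
  ⟨hz.bdd_heval f, by rw [PowerSeries.coeff_heval_zero, hf]⟩

theorem IsSmall.one_add_ne_zero {z : Coef m} (hz : IsSmall z) : 1 + z ≠ 0 := by
  intro h
  have := congrArg (fun f => HahnSeries.coeff f 0) h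
  simp [hz.2] at this

/-- Series of the form `1 + small`. -/
def IsOneUnit (u : Coef m) : Prop := IsSmall (u - 1)

theorem IsOneUnit.bdd {u : Coef m} (hu : IsOneUnit u) : Bdd 0 u := by
  simpa using IsSmall.bdd hu |>.add Bdd.one

theorem IsOneUnit.ne_zero {u : Coef m} (hu : IsOneUnit u) : u ≠ 0 := by
  simpa using IsSmall.one_add_ne_zero hu

theorem IsOneUnit.one : IsOneUnit (1 : Coef m) := by
  simpa [IsOneUnit] using IsSmall.zero

theorem IsOneUnit.mul {u v : Coef m} (hu : IsOneUnit u) (hv : IsOneUnit v) :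
    IsOneUnit (u * v) := by
  have h : u * v - 1 = (u - 1) * v + (v - 1) := by ring
  rw [IsOneUnit, h]
  exact (IsSmall.mul_bdd hu hv.bdd).add hv

/-- The inverse is the geometric series in the small part, that is, the value of the power series (1
+ X)⁻¹; its exponents stay in the same cone. -/
theorem IsOneUnit.inv {u : Coef m} (hu : IsOneUnit u) : IsOneUnit u⁻¹ := by
  obtain ⟨z, hz, rfl⟩ : ∃ z, IsSmall z ∧ u = 1 + z := ⟨u - 1, hu, by ring⟩
  have h1 : PowerSeries.heval z (1 + PowerSeries.X : PowerSeries ℂ) = 1 + z := by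
    rw [map_add, map_one, PowerSeries.heval_X z hz.orderTop_pos]
  have h2 : (1 + z)⁻¹ = PowerSeries.heval z (1 + PowerSeries.X : PowerSeries ℂ)⁻¹ := by
    rw [← h1]
    refine inv_eq_of_mul_eq_one_right ?_
    rw [← map_mul, PowerSeries.mul_inv_cancel _ (by simp), map_one]
  refine IsSmall.of_orderTop_pos ?_ ?_
  · rw [h2]
    exact (hz.bdd_heval _).sub Bdd.one
  · have h3 : (1 + z)⁻¹ - 1 = PowerSeries.heval z ((1 + PowerSeries.X : PowerSeries ℂ)⁻¹ - 1) := by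
      rw [h2, map_sub, map_one]
    rw [h3]
    exact (hz.heval (by simp)).orderTop_pos

theorem IsOneUnit.div {u v : Coef m} (hu : IsOneUnit u) (hv : IsOneUnit v) :
    IsOneUnit (u / v) := by
  rw [div_eq_mul_inv]
  exact hu.mul hv.inv

theorem IsOneUnit.pow {u : Coef m} (hu : IsOneUnit u) (n : ℕ) : IsOneUnit (u ^ n) := by
  induction n with
  | zero => simpa using IsOneUnit.one
  | succ n ih => simpa [pow_succ] using ih.mul hu

theorem IsOneUnit.zpow {u : Coef m} (hu : IsOneUnit u) (n : ℤ) : IsOneUnit (u ^ n) := by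
  cases n with
  | ofNat n => simpa using hu.pow n
  | negSucc n =>
    rw [zpow_negSucc]
    exact (hu.pow _).inv

/-! ### Variables -/

theorem var_zpow (k : Fin m) (n : ℤ) :
    (var k : Coef m) ^ n = HahnSeries.single (toLex (Pi.single k n)) 1 := by
  have hpow : ∀ n : ℕ, (var k : Coef m) ^ n = HahnSeries.single (toLex (Pi.single k (n : ℤ))) 1 := by
    intro n
    rw [var, HahnSeries.single_pow, one_pow]
    congr 2
    change toLex (n • (Pi.single k 1 : Fin m → ℤ)) = _
    rw [← Pi.single_smul]
    simp
  cases n with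
  | ofNat n => simpa using hpow n
  | negSucc n =>
    rw [zpow_negSucc, hpow]
    refine inv_eq_of_mul_eq_one_right ?_
    rw [HahnSeries.single_mul_single, ← toLex_add, ← Pi.single_add]
    have h : (((n + 1 : ℕ) : ℤ) + Int.negSucc n) = 0 := by omega
    rw [h, Pi.single_zero, one_mul]
    rfl

theorem psum_single (k i : Fin m) (n : ℤ) :
    psum i (toLex (Pi.single k n)) = if k ≤ i then n else 0 := by
  rw [psum_apply]
  simp [Pi.single_apply]

theorem bdd_var_zpow (k : Fin m) (n : ℤ) :
    Bdd (fun i => if k ≤ i then n else 0) ((var k : Coef m) ^ n) := by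
  intro g hg i
  rw [var_zpow] at hg
  rw [show g = toLex (Pi.single k n) from by_contra fun h => hg (HahnSeries.coeff_single_of_ne h),
    psum_single]

theorem var_ne_zero (k : Fin m) : (var k : Coef m) ≠ 0 := by
  rw [var]
  exact HahnSeries.single_ne_zero one_ne_zero

theorem isSmall_of_ne {g : Lex (Fin m → ℤ)} (hg : ∀ i, 0 ≤ psum i g) (h0 : g ≠ 0) :
    IsSmall (HahnSeries.single g (1 : ℂ) : Coef m) := by
  refine ⟨fun a ha i => ?_, HahnSeries.coeff_single_of_ne h0.symm⟩
  rw [show a = g from by_contra fun h => ha (HahnSeries.coeff_single_of_ne h)]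
  exact hg i

theorem isSmall_var (k : Fin m) : IsSmall (var k : Coef m) := by
  refine isSmall_of_ne (fun i => ?_) fun h => ?_
  · rw [psum_single]
    split_ifs <;> simp
  · have := congrArg (psum k) h
    simp [psum_single] at this

/-- The partial sums of the exponent of w_j / w_k are 1 on the indices i with j ≤ i < k and 0
elsewhere. This is where the expansion region |w_j| ≪ |w_k| enters. -/
theorem isSmall_var_div {j k : Fin m} (h : j < k) : IsSmall (var j / var k : Coef m) := by
  have h1 : (var j / var k : Coef m) =
      HahnSeries.single (toLex (Pi.single j 1 + Pi.single k (-1))) 1 := by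
    rw [div_eq_mul_inv, ← zpow_neg_one, var_zpow, var, HahnSeries.single_mul_single, one_mul]
    rfl
  rw [h1, toLex_add]
  refine isSmall_of_ne (fun i => ?_) fun h0 => ?_
  · rw [map_add, psum_single, psum_single]
    split_ifs with h1 h2 h2
    · simp
    · simp
    · exact absurd (h.le.trans h2) h1
    · simp
  · have := congrArg (psum j) h0
    rw [map_add, psum_single, psum_single, if_pos le_rfl, if_neg (not_le.2 h)] at this
    simp at this

/-- Series with leading term `w_k`, in the sense that the other terms are small relative to it. -/
def IsLead (k : Fin m) (u : Coef m) : Prop := IsOneUnit (u / var k)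

theorem IsLead.ne_zero {k : Fin m} {u : Coef m} (hu : IsLead k u) : u ≠ 0 := by
  rintro rfl
  simpa using IsOneUnit.ne_zero hu

theorem IsLead.eq_mul {k : Fin m} {u : Coef m} (hu : IsLead k u) :
    ∃ v, IsOneUnit v ∧ u = var k * v :=
  ⟨u / var k, hu, by rw [mul_div_cancel₀ _ (var_ne_zero k)]⟩

theorem IsLead.isSmall {k : Fin m} {u : Coef m} (hu : IsLead k u) : IsSmall u := by
  obtain ⟨v, hv, rfl⟩ := hu.eq_mul
  exact (isSmall_var k).mul_bdd hv.bdd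

theorem IsLead.bdd_zpow {k : Fin m} {u : Coef m} (hu : IsLead k u) (n : ℤ) :
    Bdd (fun i => if k ≤ i then n else 0) (u ^ n) := by
  obtain ⟨v, hv, rfl⟩ := hu.eq_mul
  rw [mul_zpow]
  simpa using (bdd_var_zpow k n).mul (hv.zpow n).bdd

theorem IsLead.isSmall_div {j k : Fin m} {x u : Coef m} (hx : IsLead j x) (hu : IsLead k u)
    (h : j < k) : IsSmall (x / u) := by
  obtain ⟨v, hv, rfl⟩ := hu.eq_mul
  obtain ⟨w, hw, rfl⟩ := hx.eq_mul
  rw [mul_div_mul_comm]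
  exact (isSmall_var_div h).mul_bdd (hw.div hv).bdd

theorem IsLead.isOneUnit_div {k : Fin m} {x u : Coef m} (hx : IsLead k x) (hu : IsLead k u) :
    IsOneUnit (x / u) := by
  have h : x / u = (x / var k) / (u / var k) := by
    rw [div_div_div_cancel_right₀ (var_ne_zero k)]
  rw [h]
  exact IsOneUnit.div hx hu

theorem IsLead.add_left {j k : Fin m} {x u : Coef m} (hx : IsLead j x) (hu : IsLead k u)
    (h : j < k) : IsLead k (x + u) := by
  have hk : IsLead k (var k : Coef m) := by
    simpa [IsLead, div_self (var_ne_zero k)] using IsOneUnit.one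
  rw [IsLead, IsOneUnit, add_div, add_sub_assoc]
  exact (hx.isSmall_div hk h).add hu

/-- All other variables of the block are small relative to the one with the largest index. Hence the
maximum of a block determines how negative powers of its sum are expanded. -/
theorem isLead_blockSum {P : Finset (Fin m)} {k : Fin m} (hk : k ∈ P) (hP : ∀ j ∈ P, j ≤ k) :
    IsLead k (blockSum P : Coef m) := by
  classical
  have h : (blockSum P : Coef m) / var k - 1 = ∑ j ∈ P.erase k, var j / var k := by
    rw [blockSum, ← Finset.add_sum_erase P _ hk, add_div, div_self (var_ne_zero k),
      add_sub_cancel_left, Finset.sum_div]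
  rw [IsLead, IsOneUnit, h]
  refine IsSmall.sum fun j hj => isSmall_var_div ?_
  exact lt_of_le_of_ne (hP j (Finset.mem_of_mem_erase hj)) (Finset.ne_of_mem_erase hj)

/-! ### Exponential and logarithm -/

theorem inv_factorial_smul_add_pow (a b : Coef m) (n : ℕ) :
    (n.factorial : ℂ)⁻¹ • (a + b) ^ n = ∑ p ∈ Finset.HasAntidiagonal.antidiagonal n,
      ((p.1.factorial : ℂ)⁻¹ • a ^ p.1) * ((p.2.factorial : ℂ)⁻¹ • b ^ p.2) := by
  rw [Commute.add_pow' (Commute.all a b), Finset.smul_sum]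
  refine Finset.sum_congr rfl fun p hp => ?_
  rw [Finset.HasAntidiagonal.mem_antidiagonal] at hp
  subst hp
  rw [← Nat.cast_smul_eq_nsmul ℂ, smul_smul, smul_mul_smul_comm, Nat.choose_symm_add, Nat.add_choose]
  congr 1
  rw [Nat.cast_div (Nat.factorial_mul_factorial_dvd_factorial_add _ _)
    (by exact_mod_cast (Nat.mul_pos (Nat.factorial_pos _) (Nat.factorial_pos _)).ne')]
  have := (Nat.factorial_pos (p.1 + p.2)).ne'
  push_cast
  field_simp

theorem hasFormalSum_expC {z : Coef m} (hz : IsSmall z) :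
    FormallySummable (fun n : ℕ => (n.factorial : ℂ)⁻¹ • z ^ n) ∧
      formalSum (fun n : ℕ => (n.factorial : ℂ)⁻¹ • z ^ n) = expC z := by
  have := hasFormalSum_heval hz.orderTop_pos (PowerSeries.exp ℂ)
  simpa [PowerSeries.coeff_exp, expC] using this

/-- The double series is regrouped by total degree, and each group is evaluated by the binomial
theorem in its divided-power form. -/
theorem expC_add {z w : Coef m} (hz : IsSmall z) (hw : IsSmall w) :
    expC (z + w) = expC z * expC w := by
  classical
  obtain ⟨h1, e1⟩ := hasFormalSum_expC hz
  obtain ⟨h2, e2⟩ := hasFormalSum_expC hw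
  obtain ⟨-, e3⟩ := hasFormalSum_expC (hz.add hw)
  rw [← e1, ← e2, ← e3, ← formalSum_mul h1 h2,
    ← ((h1.mul h2).formalSum_fiber fun p => p.1 + p.2).2]
  congr 1
  ext1 n
  rw [inv_factorial_smul_add_pow, formalSum_of_finite,
    finsum_eq_sum_of_support_subset (s := Finset.HasAntidiagonal.antidiagonal n)]
  · refine Finset.sum_congr rfl fun p hp => ?_
    rw [if_pos (Finset.HasAntidiagonal.mem_antidiagonal.1 hp)]
  · intro p hp
    by_contra h
    exact hp (if_neg fun h' => h (by simpa using h'))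
  · refine (Finset.finite_toSet (Finset.HasAntidiagonal.antidiagonal n)).subset fun p hp => ?_
    by_contra h
    exact hp (if_neg fun h' => h (by simpa using h'))

theorem expC_zero : expC (0 : Coef m) = 1 := by
  rw [expC, PowerSeries.heval_apply, SummableFamily.powerSeriesFamily_hsum_zero]
  simp

theorem isOneUnit_expC {z : Coef m} (hz : IsSmall z) : IsOneUnit (expC z) := by
  have h : expC z - 1 = PowerSeries.heval z (PowerSeries.exp ℂ - 1) := by
    rw [map_sub, map_one, expC]
  rw [IsOneUnit, h]
  exact hz.heval (by simp)

theorem expC_ne_zero {z : Coef m} (hz : IsSmall z) : expC z ≠ 0 := (isOneUnit_expC hz).ne_zero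

theorem expC_neg {z : Coef m} (hz : IsSmall z) : expC (-z) = (expC z)⁻¹ := by
  refine (inv_eq_of_mul_eq_one_right ?_).symm
  rw [← expC_add hz hz.neg, add_neg_cancel, expC_zero]

theorem expC_sub {z w : Coef m} (hz : IsSmall z) (hw : IsSmall w) :
    expC (z - w) = expC z / expC w := by
  rw [sub_eq_add_neg, expC_add hz hw.neg, expC_neg hw, div_eq_mul_inv]

theorem expC_nat_smul {z : Coef m} (hz : IsSmall z) (n : ℕ) :
    expC ((n : ℂ) • z) = expC z ^ n := by
  induction n with
  | zero => simp [expC_zero]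
  | succ n ih => rw [Nat.cast_succ, add_smul, one_smul, expC_add (hz.smul _) hz, ih, pow_succ]

theorem expC_int_smul {z : Coef m} (hz : IsSmall z) (n : ℤ) :
    expC ((n : ℂ) • z) = expC z ^ n := by
  cases n with
  | ofNat n => simpa using expC_nat_smul hz n
  | negSucc n =>
    rw [zpow_negSucc, ← expC_nat_smul hz, ← expC_neg (hz.smul _), Int.cast_negSucc, neg_smul]

/-- One has e^z - 1 = z f(z) with f(0) = 1, and f(z) is not zero because its constant term is 1. -/
theorem expC_eq_one {z : Coef m} (hz : IsSmall z) (h : expC z = 1) : z = 0 := by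
  obtain ⟨f, hf⟩ : (PowerSeries.X : PowerSeries ℂ) ∣ PowerSeries.exp ℂ - 1 :=
    PowerSeries.X_dvd_iff.2 (by simp)
  have hf0 : PowerSeries.constantCoeff f = 1 := by
    have := congrArg (PowerSeries.coeff 1) hf
    rw [← zero_add 1, PowerSeries.coeff_succ_X_mul] at this
    rw [← PowerSeries.coeff_zero_eq_constantCoeff_apply, ← this]
    simp [PowerSeries.coeff_exp, PowerSeries.coeff_one]
  have h1 := congrArg (PowerSeries.heval z) hf
  rw [map_sub, map_one, map_mul, PowerSeries.heval_X z hz.orderTop_pos] at h1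
  have h2 : PowerSeries.heval z (PowerSeries.exp ℂ) = 1 := h
  rw [h2, sub_self] at h1
  refine (mul_eq_zero.1 h1.symm).resolve_right fun h3 => ?_
  have := congrArg (fun x => HahnSeries.coeff x 0) h3
  simp only [PowerSeries.coeff_heval_zero, hf0, HahnSeries.coeff_zero] at this
  exact one_ne_zero this

theorem expC_injective {z w : Coef m} (hz : IsSmall z) (hw : IsSmall w) (h : expC z = expC w) :
    z = w := by
  refine sub_eq_zero.1 (expC_eq_one (hz.sub hw) ?_)
  rw [expC_sub hz hw, h, div_self (expC_ne_zero hw)]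

theorem isSmall_logOnePlus {y : Coef m} (hy : IsSmall y) : IsSmall (logOnePlus y) :=
  hy.heval (by simp)

/-! ### The binomial series -/

/-- The coefficient of `t^j` in the binomial coefficient `(t + n choose k)`. -/
def binomCoeff (n : ℤ) (j k : ℕ) : ℂ :=
  ((descPochhammer ℂ k).comp (Polynomial.X + Polynomial.C (n : ℂ))).coeff j / k.factorial

/-- The coefficient of `t^j` in `(1 + X)^{t + n}`. -/
def binomSeries (n : ℤ) (j : ℕ) : PowerSeries ℂ := PowerSeries.mk (binomCoeff n j)

/-- Pascal's rule for the binomial coefficients of t + n, read off coefficient by coefficient in t.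
-/
theorem binomSeries_succ (n : ℤ) (j : ℕ) :
    (1 + PowerSeries.X) * binomSeries n j = binomSeries (n + 1) j := by
  ext k
  rw [add_mul, one_mul, map_add]
  cases k with
  | zero => simp [binomSeries, binomCoeff]
  | succ k =>
    rw [PowerSeries.coeff_succ_X_mul]
    simp only [binomSeries, PowerSeries.coeff_mk, binomCoeff]
    have h1 : (descPochhammer ℂ (k + 1)).comp (Polynomial.X + Polynomial.C ((n + 1 : ℤ) : ℂ)) =
        (descPochhammer ℂ (k + 1)).comp (Polynomial.X + Polynomial.C (n : ℂ)) +
        ((k : ℂ) + 1) • (descPochhammer ℂ k).comp (Polynomial.X + Polynomial.C (n : ℂ)) := by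
      -- The backward difference equation of the falling factorial, with X + n + 1 substituted for
      -- X.
      have h := congrArg (fun p => p.comp (Polynomial.X + Polynomial.C ((n + 1 : ℤ) : ℂ)))
        (descPochhammer_succ_comp_X_sub_one (R := ℂ) k)
      have h2 : (Polynomial.X - 1 : Polynomial ℂ).comp
          (Polynomial.X + Polynomial.C ((n + 1 : ℤ) : ℂ)) =
          Polynomial.X + Polynomial.C (n : ℂ) := by
        simp [add_sub_assoc]
      simp only [Polynomial.comp_assoc, Polynomial.sub_comp, smul_eq_mul, Polynomial.mul_comp,
        Polynomial.add_comp, Polynomial.natCast_comp, Polynomial.one_comp] at h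
      rw [Polynomial.sub_comp, Polynomial.one_comp] at h2
      rw [Polynomial.X_comp] at h h2
      rw [h2] at h
      rw [h, Polynomial.smul_eq_C_mul]
      simp
    rw [h1, Polynomial.coeff_add, Polynomial.coeff_smul, Nat.factorial_succ]
    have := (Nat.factorial_pos k).ne'
    have h2 : ((k : ℂ) + 1) ≠ 0 := by exact_mod_cast k.succ_ne_zero
    push_cast
    rw [smul_eq_mul]
    field_simp

theorem one_add_X_mul_deriv_log :
    (1 + PowerSeries.X) * PowerSeries.derivative ℂ (PowerSeries.log ℂ) = 1 := by
  rw [PowerSeries.deriv_log]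
  ext k
  rw [add_mul, one_mul, map_add]
  cases k with
  | zero => simp
  | succ k =>
    rw [PowerSeries.coeff_succ_X_mul]
    simp [PowerSeries.coeff_one, pow_succ]

/-- This is (1 + X)^t = exp(t log(1 + X)) expanded in t. By induction on j, both sides have the same
derivative after multiplication by 1 + X, and the same constant coefficient. -/
theorem binomSeries_zero (j : ℕ) :
    binomSeries 0 j = (j.factorial : ℂ)⁻¹ • PowerSeries.log ℂ ^ j := by
  have hne : (1 + PowerSeries.X : PowerSeries ℂ) ≠ 0 := fun h => by
    have := congrArg PowerSeries.constantCoeff h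
    simp at this
  have hcoeff : ∀ j k, binomCoeff 0 j k = (descPochhammer ℂ k).coeff j / k.factorial := by
    intro j k
    simp [binomCoeff]
  induction j with
  | zero =>
    ext k
    rw [binomSeries, PowerSeries.coeff_mk, hcoeff, Polynomial.coeff_zero_eq_eval_zero,
      descPochhammer_eval_zero]
    simp only [Nat.factorial_zero, Nat.cast_one, inv_one, pow_zero, one_smul,
      PowerSeries.coeff_one]
    split_ifs with h <;> simp [h]
  | succ j ih =>
    refine PowerSeries.derivative.ext (mul_left_cancel₀ hne ?_) ?_
    · rw [Derivation.map_smul, PowerSeries.derivative_pow]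
      -- Coefficientwise this is (k+1) (t choose k+1) + k (t choose k) = t (t choose k), compared at
      -- t^{j+1}.
      have h1 : (1 + PowerSeries.X) * PowerSeries.derivative ℂ (binomSeries 0 (j + 1)) =
          binomSeries 0 j := by
        ext k
        rw [add_mul, one_mul, map_add]
        have hk : (k + 1 : ℂ) ≠ 0 := by exact_mod_cast k.succ_ne_zero
        have h2 : PowerSeries.coeff k (PowerSeries.X *
            PowerSeries.derivative ℂ (binomSeries 0 (j + 1))) = k * binomCoeff 0 (j + 1) k := by
          cases k with
          | zero => simp
          | succ k =>
            rw [PowerSeries.coeff_succ_X_mul, PowerSeries.coeff_derivative, binomSeries,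
              PowerSeries.coeff_mk]
            push_cast
            ring
        rw [h2, PowerSeries.coeff_derivative, binomSeries, binomSeries, PowerSeries.coeff_mk,
          PowerSeries.coeff_mk, hcoeff, hcoeff, hcoeff, descPochhammer_succ_right, mul_sub,
          Polynomial.coeff_sub, Polynomial.coeff_mul_X, mul_comm _ (k : Polynomial ℂ),
          ← Polynomial.C_eq_natCast, Polynomial.coeff_C_mul, Nat.factorial_succ]
        have := (Nat.factorial_pos k).ne'
        push_cast
        field_simp
        ring
      rw [h1, ih, mul_smul_comm]
      have h3 : (1 + PowerSeries.X) * (((j + 1 : ℕ) : PowerSeries ℂ) * PowerSeries.log ℂ ^ j *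
          PowerSeries.derivative ℂ (PowerSeries.log ℂ)) =
          ((j + 1 : ℕ) : PowerSeries ℂ) * PowerSeries.log ℂ ^ j := by
        linear_combination (((j + 1 : ℕ) : PowerSeries ℂ) * PowerSeries.log ℂ ^ j) *
          one_add_X_mul_deriv_log
      rw [Nat.add_sub_cancel, h3, ← nsmul_eq_mul, ← Nat.cast_smul_eq_nsmul ℂ, smul_smul]
      congr 1
      rw [Nat.factorial_succ]
      have := (Nat.factorial_pos j).ne'
      have hj : (j + 1 : ℂ) ≠ 0 := by exact_mod_cast j.succ_ne_zero
      push_cast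
      field_simp
    · simp [binomSeries, hcoeff, Polynomial.coeff_one]

/-- The case n = 0 is the exponential form of the binomial series. Multiplication or division by 1 +
q carries it to every integer n. -/
theorem heval_binomSeries {q : Coef m} (hq : IsSmall q) (n : ℤ) (j : ℕ) :
    PowerSeries.heval q (binomSeries n j) =
      (1 + q) ^ n * ((j.factorial : ℂ)⁻¹ • logOnePlus q ^ j) := by
  have hne := hq.one_add_ne_zero
  have hs : ∀ n, PowerSeries.heval q (binomSeries (n + 1) j) =
      (1 + q) * PowerSeries.heval q (binomSeries n j) := by
    intro n
    rw [← binomSeries_succ, map_mul, map_add, map_one, PowerSeries.heval_X q hq.orderTop_pos]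
  induction n using Int.induction_on with
  | zero =>
    rw [binomSeries_zero, map_smul, map_pow, zpow_zero, one_mul]
    rfl
  | succ n ih => rw [hs, ih, zpow_add_one₀ hne]; ring
  | pred n ih =>
    have h := hs (-n - 1)
    rw [sub_add_cancel, ih] at h
    refine mul_left_cancel₀ hne ?_
    rw [← h, zpow_sub_one₀ hne]
    field_simp

/-- Adding up the coefficients in t amounts to setting t = 1 in the binomial coefficient (t choose
k). -/
theorem sum_binomCoeff (k : ℕ) :
    ∑ j ∈ Finset.range (k + 1), binomCoeff 0 j k =
      PowerSeries.coeff k (1 + PowerSeries.X : PowerSeries ℂ) := by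
  simp only [binomCoeff, Int.cast_zero, Polynomial.C_0, add_zero, Polynomial.comp_X]
  rw [← Finset.sum_div]
  have h := Polynomial.eval_eq_sum_range' (p := descPochhammer ℂ k) (n := k + 1)
    (by rw [descPochhammer_natDegree]; omega) (1 : ℂ)
  simp only [one_pow, mul_one] at h
  rw [← h]
  have h1 := descPochhammer_eval_eq_descFactorial ℂ 1 k
  rw [Nat.cast_one] at h1
  rw [h1]
  rcases k with _ | _ | k
  · simp
  · simp [PowerSeries.coeff_one]
  · simp [PowerSeries.coeff_one, PowerSeries.coeff_X]

theorem finite_pow_coeff {y : Coef m} (hy : IsSmall y) (g : Lex (Fin m → ℤ)) :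
    {k : ℕ | (y ^ k).coeff g ≠ 0}.Finite :=
  SummableFamily.pow_finite_co_support hy.orderTop_pos g

/-- The double series of the coefficients of (1 + y)^t is summed in two orders. Over k first it
gives the powers log(1 + y)^j / j!; over j first it gives the binomial expansion at t = 1. -/
theorem expC_logOnePlus {y : Coef m} (hy : IsSmall y) : expC (logOnePlus y) = 1 + y := by
  have hF : FormallySummable fun p : ℕ × ℕ => binomCoeff 0 p.1 p.2 • y ^ p.2 := by
    refine formallySummable_of_bdd (c := 0) (fun p => (hy.1.pow _).smul _) fun g => ?_
    -- Only finitely many powers of y contain a given monomial, and for each k only the indices j ≤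
    -- k contribute, since (t choose k) has degree k in t.
    refine ((finite_pow_coeff hy g).biUnion fun k _ =>
      (Finset.finite_toSet (Finset.range (k + 1))).image fun j => (j, k)).subset ?_
    rintro ⟨j, k⟩ h
    simp only [Set.mem_ofPred_eq, HahnSeries.coeff_smul, smul_eq_mul, ne_eq, mul_eq_zero,
      not_or] at h
    simp only [Set.mem_iUnion]
    refine ⟨k, h.2, j, ?_, rfl⟩
    rw [Finset.mem_coe, Finset.mem_range]
    by_contra hjk
    refine h.1 ?_
    rw [binomCoeff, Polynomial.coeff_eq_zero_of_natDegree_lt, zero_div]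
    simp only [Int.cast_zero, Polynomial.C_0, add_zero, Polynomial.comp_X]
    rw [descPochhammer_natDegree]
    omega
  have h1 : ∀ j : ℕ, (formalSum fun k => binomCoeff 0 j k • y ^ k) =
      (j.factorial : ℂ)⁻¹ • logOnePlus y ^ j := by
    intro j
    have h := heval_binomSeries hy 0 j
    rw [← (hasFormalSum_heval hy.orderTop_pos _).2, zpow_zero, one_mul] at h
    simpa [binomSeries] using h
  have h2 : ∀ k : ℕ, (formalSum fun j => binomCoeff 0 j k • y ^ k) =
      PowerSeries.coeff k (1 + PowerSeries.X : PowerSeries ℂ) • y ^ k := by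
    intro k
    have hz : ∀ j ∉ Finset.range (k + 1), binomCoeff 0 j k • y ^ k = 0 := by
      intro j hj
      rw [binomCoeff, Polynomial.coeff_eq_zero_of_natDegree_lt, zero_div, zero_smul]
      simp only [Int.cast_zero, Polynomial.C_0, add_zero, Polynomial.comp_X]
      rw [descPochhammer_natDegree]
      simpa using hj
    rw [formalSum_of_finite, finsum_eq_sum_of_support_subset (s := Finset.range (k + 1)),
      ← Finset.sum_smul, sum_binomCoeff]
    · exact fun j hj => by_contra fun h => hj (hz j h)
    · exact (Finset.finite_toSet (Finset.range (k + 1))).subset fun j hj =>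
        by_contra fun h => hj (hz j h)
  have h3 := hF.formalSum_comm
  simp only [h1, h2] at h3
  rw [(hasFormalSum_expC (isSmall_logOnePlus hy)).2,
    (hasFormalSum_heval hy.orderTop_pos _).2, map_add, map_one,
    PowerSeries.heval_X y hy.orderTop_pos] at h3
  exact h3

/-- Both sides are small and have the same exponential, and the exponential is injective on small
series. -/
theorem logOnePlus_mul {u v : Coef m} (hu : IsOneUnit u) (hv : IsOneUnit v) :
    logOnePlus (u * v - 1) = logOnePlus (u - 1) + logOnePlus (v - 1) := by
  have h1 := isSmall_logOnePlus hu
  have h2 := isSmall_logOnePlus hv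
  refine expC_injective (isSmall_logOnePlus (hu.mul hv)) (h1.add h2) ?_
  rw [expC_add h1 h2, expC_logOnePlus (hu.mul hv), expC_logOnePlus hu, expC_logOnePlus hv]
  ring

theorem logOnePlus_expC {z : Coef m} (hz : IsSmall z) : logOnePlus (expC z - 1) = z := by
  refine expC_injective (isSmall_logOnePlus (isOneUnit_expC hz)) hz ?_
  rw [expC_logOnePlus (isOneUnit_expC hz)]
  ring

/-! ### The function `ς` -/

theorem heval_rescale {z : Coef m} (hz : IsSmall z) (c : ℂ) (f : PowerSeries ℂ) :
    PowerSeries.heval (c • z) f = PowerSeries.heval z (PowerSeries.rescale c f) := by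
  rw [← (hasFormalSum_heval hz.orderTop_pos _).2,
    ← (hasFormalSum_heval (hz.smul c).orderTop_pos _).2]
  congr 1
  ext1 n
  rw [PowerSeries.coeff_rescale, smul_pow, smul_smul, mul_comm]

/-- The power series of ς is divisible by X with quotient of constant term 1, so the division by z
can be done before substitution. -/
theorem isOneUnit_calS {z : Coef m} (hz : IsSmall z) (h0 : z ≠ 0) : IsOneUnit (calS z) := by
  set f : PowerSeries ℂ := PowerSeries.rescale (1 / 2) (PowerSeries.exp ℂ) -
    PowerSeries.rescale (-(1 / 2)) (PowerSeries.exp ℂ)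
  have hf : sigma z = PowerSeries.heval z f := by
    rw [map_sub, ← heval_rescale hz, ← heval_rescale hz, sigma, neg_smul]
    rfl
  obtain ⟨g, hg⟩ : (PowerSeries.X : PowerSeries ℂ) ∣ f := PowerSeries.X_dvd_iff.2 (by
    simp only [f, ← PowerSeries.coeff_zero_eq_constantCoeff_apply, map_sub, PowerSeries.coeff_rescale]
    simp)
  have hg0 : PowerSeries.constantCoeff g = 1 := by
    have := congrArg (PowerSeries.coeff 1) hg
    rw [← zero_add 1, PowerSeries.coeff_succ_X_mul] at this
    rw [← PowerSeries.coeff_zero_eq_constantCoeff_apply, ← this]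
    simp only [f, map_sub, PowerSeries.coeff_rescale, PowerSeries.coeff_exp]
    norm_num
  have h1 : calS z = PowerSeries.heval z g := by
    rw [calS, hf, hg, map_mul, PowerSeries.heval_X z hz.orderTop_pos, mul_div_cancel_left₀ _ h0]
  have h2 : calS z - 1 = PowerSeries.heval z (g - 1) := by rw [h1, map_sub, map_one]
  rw [IsOneUnit, h2]
  exact hz.heval (by simp [hg0])

theorem sigma_eq_mul {z : Coef m} (h0 : z ≠ 0) : sigma z = z * calS z := by
  rw [calS, mul_div_cancel₀ _ h0]

theorem sigma_zero : sigma (0 : Coef m) = 0 := by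
  simp [sigma]

theorem isSmall_sigma {z : Coef m} (hz : IsSmall z) : IsSmall (sigma z) := by
  by_cases h0 : z = 0
  · rw [h0, sigma_zero]
    exact IsSmall.zero
  · rw [sigma_eq_mul h0]
    exact hz.mul_bdd (isOneUnit_calS hz h0).bdd

theorem sigma_ne_zero {z : Coef m} (hz : IsSmall z) (h0 : z ≠ 0) : sigma z ≠ 0 := by
  rw [sigma_eq_mul h0]
  exact mul_ne_zero h0 (isOneUnit_calS hz h0).ne_zero

theorem IsLead.sigma {k : Fin m} {u : Coef m} (hu : IsLead k u) : IsLead k (sigma u) := by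
  rw [IsLead, sigma_eq_mul hu.ne_zero, mul_div_right_comm]
  exact IsOneUnit.mul hu (isOneUnit_calS hu.isSmall hu.ne_zero)

/-! ### Powers with exponents proportional to `t` -/

/-- `e^{ta}`. -/
def expT (a : Coef m) : PowerSeries (Coef m) :=
  PowerSeries.mk fun n => (n.factorial : ℂ)⁻¹ • a ^ n

/-- `(1 + y)^{tc}`. -/
def powT (c y : Coef m) : PowerSeries (Coef m) := expT (c * logOnePlus y)

/-- `e^{ta/2} - e^{-ta/2}`. -/
def sigmaT (a : Coef m) : PowerSeries (Coef m) := expT ((1 / 2 : ℂ) • a) - expT (-((1 / 2 : ℂ) • a))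

theorem expT_add (a b : Coef m) : expT (a + b) = expT a * expT b := by
  ext1 n
  rw [PowerSeries.coeff_mul, expT, PowerSeries.coeff_mk, inv_factorial_smul_add_pow]
  simp only [expT, PowerSeries.coeff_mk]

theorem calSPow_eq (z : Coef m) : calSPow z = powT z (calS z - 1) := rfl

theorem powT_mul (c : Coef m) {u v : Coef m} (hu : IsOneUnit u) (hv : IsOneUnit v) :
    powT c (u * v - 1) = powT c (u - 1) * powT c (v - 1) := by
  rw [powT, logOnePlus_mul hu hv, mul_add, expT_add]
  rfl

theorem powT_zero (c : Coef m) : powT c 0 = 1 := by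
  have h : logOnePlus (0 : Coef m) = 0 := by
    rw [logOnePlus, PowerSeries.heval_apply, SummableFamily.powerSeriesFamily_hsum_zero]
    simp
  ext1 n
  rw [powT, expT, PowerSeries.coeff_mk, h, PowerSeries.coeff_one, mul_zero]
  split_ifs with h
  · simp [h]
  · simp [h]

theorem powT_expC (c : Coef m) {z : Coef m} (hz : IsSmall z) : powT c (expC z - 1) = expT (c * z) := by
  rw [powT, logOnePlus_expC hz]

theorem bdd_coeff_expT {a : Coef m} (ha : Bdd 0 a) (n : ℕ) : Bdd 0 (PowerSeries.coeff n (expT a)) := by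
  rw [expT, PowerSeries.coeff_mk]
  exact (ha.pow n).smul _

theorem bdd_coeff_powT {c y : Coef m} (hc : Bdd 0 c) (hy : IsSmall y) (n : ℕ) :
    Bdd 0 (PowerSeries.coeff n (powT c y)) :=
  bdd_coeff_expT (hc.mul₀ (isSmall_logOnePlus hy).1) n

/-! ### Pochhammer symbols -/

/-- One recursion covers both branches of the definition. For n > 0 it cancels the factor a + n,
which is invertible because a has no constant term and the characteristic is 0. -/
theorem invPochhammer_sub_one {a : PowerSeries (Coef m)} (ha : PowerSeries.constantCoeff a = 0)
    (n : ℤ) : invPochhammer a (n - 1) = invPochhammer a n * (a + (n : PowerSeries (Coef m))) := by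
  rcases lt_or_ge 0 n with hn | hn
  · obtain ⟨k, rfl⟩ : ∃ k : ℕ, n = k + 1 := ⟨(n - 1).toNat, by omega⟩
    have h1 : (((k : ℤ) + 1 - 1)).toNat = k := by omega
    have h2 : (((k : ℤ) + 1)).toNat = k + 1 := by omega
    rw [invPochhammer, if_pos (by omega), invPochhammer, if_pos (by omega), h1, h2,
      Finset.prod_range_succ, PowerSeries.mul_inv_rev, mul_comm, ← mul_assoc]
    have hk : PowerSeries.constantCoeff (a + ((k + 1 : ℕ) : PowerSeries (Coef m))) ≠ 0 := by
      rw [map_add, ha, zero_add, map_natCast]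
      exact_mod_cast k.succ_ne_zero
    have h3 : (((k : ℤ) + 1 : ℤ) : PowerSeries (Coef m)) = ((k + 1 : ℕ) : PowerSeries (Coef m)) := by
      push_cast
      rfl
    rw [h3, PowerSeries.mul_inv_cancel _ hk, one_mul]
  · obtain ⟨k, rfl⟩ : ∃ k : ℕ, n = -k := ⟨(-n).toNat, by omega⟩
    have h1 : (-(-(k : ℤ) - 1)).toNat = k + 1 := by omega
    rw [invPochhammer, if_neg (by omega), h1, Finset.prod_range_succ, invPochhammer]
    have h2 : a - ((k : ℕ) : PowerSeries (Coef m)) = a + ((-(k : ℤ) : ℤ) : PowerSeries (Coef m)) := by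
      push_cast
      ring
    rw [h2]
    congr 1
    rcases Nat.eq_zero_or_pos k with rfl | hk
    · simp
    · rw [if_neg (by omega)]
      simp

/-- The polynomial `(X + n) (X + n - 1) ⋯ (X + n - k + 1)`. -/
def shiftedPoch (n : ℤ) (k : ℕ) : Polynomial ℂ :=
  (descPochhammer ℂ k).comp (Polynomial.X + Polynomial.C (n : ℂ))

theorem invPochhammer_sub_nat {a : PowerSeries (Coef m)} (ha : PowerSeries.constantCoeff a = 0)
    (n : ℤ) (k : ℕ) :
    invPochhammer a (n - k) = invPochhammer a n *
      (shiftedPoch n k).eval₂ ((PowerSeries.C : Coef m →+* _).comp (algebraMap ℂ (Coef m))) a := by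
  induction k with
  | zero => simp [shiftedPoch]
  | succ k ih =>
    have h1 : n - ((k + 1 : ℕ) : ℤ) = n - k - 1 := by push_cast; ring
    rw [h1, invPochhammer_sub_one ha, ih, shiftedPoch, shiftedPoch, descPochhammer_succ_right,
      Polynomial.mul_comp, Polynomial.eval₂_mul, mul_assoc]
    congr 2
    simp only [Polynomial.sub_comp, Polynomial.X_comp, Polynomial.natCast_comp,
      Polynomial.eval₂_sub, Polynomial.eval₂_add, Polynomial.eval₂_X, Polynomial.eval₂_C,
      Polynomial.eval₂_natCast]
    rw [map_intCast]
    push_cast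
    ring

theorem coeff_eval₂_C_mul_X (p : Polynomial ℂ) (c : Coef m) (r : ℕ) :
    PowerSeries.coeff r (p.eval₂ ((PowerSeries.C : Coef m →+* _).comp (algebraMap ℂ (Coef m)))
      (PowerSeries.C c * PowerSeries.X)) = p.coeff r • c ^ r := by
  induction p using Polynomial.induction_on' with
  | add p q hp hq => rw [Polynomial.eval₂_add, map_add, hp, hq, Polynomial.coeff_add, add_smul]
  | monomial n a =>
    rw [Polynomial.eval₂_monomial, mul_pow, ← map_pow, RingHom.comp_apply, ← mul_assoc, ← map_mul,
      PowerSeries.coeff_C_mul, PowerSeries.coeff_X_pow, Polynomial.coeff_monomial]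
    by_cases h : r = n
    · subst h
      simp [Algebra.smul_def]
    · rw [if_neg h, if_neg (Ne.symm h), zero_smul, mul_zero]

theorem constantCoeff_C_mul_X (c : Coef m) :
    PowerSeries.constantCoeff (PowerSeries.C c * PowerSeries.X) = 0 := by
  simp

/-- `(k!)⁻¹` times the coefficient of `t^l` in `1 / (tc+1)_{n-k}`. -/
theorem inv_factorial_smul_coeff_invPochhammer (c : Coef m) (n : ℤ) (k l : ℕ) :
    (k.factorial : ℂ)⁻¹ •
      PowerSeries.coeff l (invPochhammer (PowerSeries.C c * PowerSeries.X) (n - k)) =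
    ∑ p ∈ Finset.HasAntidiagonal.antidiagonal l,
      PowerSeries.coeff p.1 (invPochhammer (PowerSeries.C c * PowerSeries.X) n) *
        (binomCoeff n p.2 k • c ^ p.2) := by
  rw [invPochhammer_sub_nat (constantCoeff_C_mul_X c), PowerSeries.coeff_mul, Finset.smul_sum]
  refine Finset.sum_congr rfl fun p _ => ?_
  rw [coeff_eval₂_C_mul_X, ← mul_smul_comm, smul_smul, binomCoeff, div_eq_inv_mul]
  rfl

/-- This is the coefficient of t^r in the binomial series of (1 + q)^{tc+n}; the variable t of the
scalar binomial coefficients is rescaled to tc, which accounts for c^r. -/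
theorem hasFormalSum_binom {q : Coef m} (hq : IsSmall q) (n : ℤ) (r : ℕ) (c : Coef m) :
    FormallySummable (fun k : ℕ => (binomCoeff n r k • c ^ r) * q ^ k) ∧
      formalSum (fun k : ℕ => (binomCoeff n r k • c ^ r) * q ^ k) =
        (1 + q) ^ n * PowerSeries.coeff r (powT c q) := by
  obtain ⟨h1, h2⟩ := hasFormalSum_heval hq.orderTop_pos (binomSeries n r)
  simp only [binomSeries, PowerSeries.coeff_mk] at h1 h2
  have h3 : (fun k : ℕ => (binomCoeff n r k • c ^ r) * q ^ k) =
      fun k => c ^ r * (binomCoeff n r k • q ^ k) := by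
    ext1 k
    rw [smul_mul_assoc, mul_smul_comm]
  rw [h3]
  refine ⟨h1.const_mul _, ?_⟩
  rw [formalSum_const_mul h1, h2]
  have := heval_binomSeries hq n r
  rw [binomSeries] at this
  rw [this, powT, expT, PowerSeries.coeff_mk, mul_pow, mul_left_comm, ← mul_smul_comm]

/-- Because ku - (n-k)x = k(x+u) - nx, the index k enters each exponential only through a k-th
power. This turns the sum over k into two binomial series. -/
theorem sigma_int_smul_add {u x : Coef m} (hu : IsSmall u) (hx : IsSmall x) (k : ℕ) (n : ℤ) :
    sigma ((k : ℂ) • u - ((n - k : ℤ) : ℂ) • x) =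
      expC (-((n : ℂ) • ((1 / 2 : ℂ) • x))) * expC ((1 / 2 : ℂ) • (x + u)) ^ k -
      expC ((n : ℂ) • ((1 / 2 : ℂ) • x)) * expC (-((1 / 2 : ℂ) • (x + u))) ^ k := by
  have h1 := (hx.add hu).smul (1 / 2)
  have h2 := (hx.smul (1 / 2)).smul (n : ℂ)
  rw [← expC_nat_smul h1, ← expC_nat_smul h1.neg, ← expC_add h2.neg (h1.smul _),
    ← expC_add h2 (h1.neg.smul _), sigma]
  congr 2
  · push_cast
    module
  · push_cast
    module

/-- Expansion of the coefficients of the commutator of `A^0(x)` with `A(u)`. -/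
theorem hasFormalSum_commutator {j k₀ : Fin m} {x u : Coef m} (hx : IsLead j x) (hu : IsLead k₀ u)
    (hjk : j < k₀) (c : Coef m) (n : ℤ) (l : ℕ) :
    FormallySummable (fun k : ℕ => ((k.factorial : ℂ)⁻¹ • sigma x ^ k) *
      (PowerSeries.coeff l (invPochhammer (PowerSeries.C c * PowerSeries.X) (n - k)) *
        sigma u ^ (n - k)) * sigma ((k : ℂ) • u - ((n - k : ℤ) : ℂ) • x)) ∧
    formalSum (fun k : ℕ => ((k.factorial : ℂ)⁻¹ • sigma x ^ k) *
      (PowerSeries.coeff l (invPochhammer (PowerSeries.C c * PowerSeries.X) (n - k)) *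
        sigma u ^ (n - k)) * sigma ((k : ℂ) • u - ((n - k : ℤ) : ℂ) • x)) =
      PowerSeries.coeff l (sigmaT (c * x) * powT c (sigma (x + u) / sigma u - 1) *
        invPochhammer (PowerSeries.C c * PowerSeries.X) n) * sigma (x + u) ^ n := by
  have hxs := hx.isSmall
  have hus := hu.isSmall
  have hxu := hx.add_left hu hjk
  have hsu : sigma u ≠ 0 := sigma_ne_zero hus hu.ne_zero
  -- Here j < k₀ is used: the binomial series below converge because ς(x)/ς(u) is small.
  have hZ : IsSmall (sigma x / sigma u) := hx.sigma.isSmall_div hu.sigma hjk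
  have hV : IsOneUnit (sigma (x + u) / sigma u) := hxu.sigma.isOneUnit_div hu.sigma
  have hh := (hxs.add hus).smul (1 / 2)
  have hx2 := hxs.smul (1 / 2)
  set Ep := expC ((1 / 2 : ℂ) • (x + u))
  set Em := expC (-((1 / 2 : ℂ) • (x + u)))
  set W := expC ((1 / 2 : ℂ) • x) with hW
  set I := invPochhammer (PowerSeries.C c * PowerSeries.X) n with hI
  have hEp : IsSmall (sigma x / sigma u * Ep) := hZ.mul_bdd (isOneUnit_expC hh).bdd
  have hEm : IsSmall (sigma x / sigma u * Em) := hZ.mul_bdd (isOneUnit_expC hh.neg).bdd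
  have hW0 : W ≠ 0 := expC_ne_zero hx2
  have hWm : expC (-((1 / 2 : ℂ) • x)) = W⁻¹ := expC_neg hx2
  have hu2 := hus.smul (1 / 2)
  set D := expC ((1 / 2 : ℂ) • u) with hD
  have hD0 : D ≠ 0 := expC_ne_zero hu2
  have hDm : expC (-((1 / 2 : ℂ) • u)) = D⁻¹ := expC_neg hu2
  have hEpE : Ep = W * D := by
    simp only [Ep]
    rw [smul_add, expC_add hx2 hu2]
  have hEmE : Em = W⁻¹ * D⁻¹ := by
    simp only [Em]
    rw [expC_neg hh, ← mul_inv, ← hEpE]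
  have hsx : sigma x = W - W⁻¹ := by rw [sigma, hWm]
  have hsu' : sigma u = D - D⁻¹ := by rw [sigma, hDm]
  have hsxu : sigma (x + u) = W * D - W⁻¹ * D⁻¹ := by
    rw [sigma]
    exact congrArg₂ _ hEpE hEmE
  -- With W = e^{x/2} and D = e^{u/2} this is the identity D - D⁻¹ + (W - W⁻¹)WD = W(WD - (WD)⁻¹).
  -- The two binomial bases thus become W and W⁻¹ times the same quotient ς(x+u)/ς(u), and the
  -- difference of the two series produces e^{tcx/2} - e^{-tcx/2}.
  have hp : 1 + sigma x / sigma u * Ep = W * (sigma (x + u) / sigma u) := by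
    have h : sigma u + sigma x * Ep = W * sigma (x + u) := by
      rw [hsx, hsu', hsxu, hEpE]
      field_simp
      ring
    field_simp
    linear_combination h
  have hm : 1 + sigma x / sigma u * Em = W⁻¹ * (sigma (x + u) / sigma u) := by
    have h : sigma u + sigma x * Em = W⁻¹ * sigma (x + u) := by
      rw [hsx, hsu', hsxu, hEmE]
      field_simp
      ring
    have h1 : sigma u * (1 + sigma x / sigma u * Em) = sigma u + sigma x * Em := by
      field_simp
    refine mul_left_cancel₀ hsu ?_
    rw [h1, h]
    field_simp
  have hpowp : powT c (sigma x / sigma u * Ep) =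
      expT (c * ((1 / 2 : ℂ) • x)) * powT c (sigma (x + u) / sigma u - 1) := by
    rw [← powT_expC c hx2, ← powT_mul c (isOneUnit_expC hx2) hV, ← hW, ← hp, add_sub_cancel_left]
  have hpowm : powT c (sigma x / sigma u * Em) =
      expT (c * -((1 / 2 : ℂ) • x)) * powT c (sigma (x + u) / sigma u - 1) := by
    rw [← powT_expC c hx2.neg, ← powT_mul c (isOneUnit_expC hx2.neg) hV, hWm, ← hm,
      add_sub_cancel_left]
  have hWn : expC ((n : ℂ) • ((1 / 2 : ℂ) • x)) = W ^ n := expC_int_smul hx2 n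
  have hWn' : expC (-((n : ℂ) • ((1 / 2 : ℂ) • x))) = (W ^ n)⁻¹ := by
    rw [expC_neg (hx2.smul _), hWn]
  have hterm : (fun k : ℕ => ((k.factorial : ℂ)⁻¹ • sigma x ^ k) *
      (PowerSeries.coeff l (invPochhammer (PowerSeries.C c * PowerSeries.X) (n - k)) *
        sigma u ^ (n - k)) * sigma ((k : ℂ) • u - ((n - k : ℤ) : ℂ) • x)) =
      fun k : ℕ => ∑ p ∈ Finset.HasAntidiagonal.antidiagonal l,
        (PowerSeries.coeff p.1 I * sigma u ^ n * (W ^ n)⁻¹ *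
          ((binomCoeff n p.2 k • c ^ p.2) * (sigma x / sigma u * Ep) ^ k) -
        PowerSeries.coeff p.1 I * sigma u ^ n * W ^ n *
          ((binomCoeff n p.2 k • c ^ p.2) * (sigma x / sigma u * Em) ^ k)) := by
    ext1 k
    rw [smul_mul_assoc, ← mul_smul_comm, ← smul_mul_assoc, inv_factorial_smul_coeff_invPochhammer,
      sigma_int_smul_add hus hxs, hWn, hWn', Finset.sum_mul, Finset.mul_sum, Finset.sum_mul]
    refine Finset.sum_congr rfl fun p _ => ?_
    rw [zpow_sub₀ hsu, zpow_natCast, mul_pow, mul_pow, div_pow]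
    ring
  have hS : ∀ p ∈ Finset.HasAntidiagonal.antidiagonal l, FormallySummable fun k : ℕ =>
        (PowerSeries.coeff p.1 I * sigma u ^ n * (W ^ n)⁻¹ *
          ((binomCoeff n p.2 k • c ^ p.2) * (sigma x / sigma u * Ep) ^ k) -
        PowerSeries.coeff p.1 I * sigma u ^ n * W ^ n *
          ((binomCoeff n p.2 k • c ^ p.2) * (sigma x / sigma u * Em) ^ k)) := fun p _ =>
    ((hasFormalSum_binom hEp n p.2 c).1.const_mul _).sub
      ((hasFormalSum_binom hEm n p.2 c).1.const_mul _)
  rw [hterm]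
  obtain ⟨h1, h2⟩ := formalSum_finset_sum _ hS
  refine ⟨h1, ?_⟩
  rw [h2, mul_comm (sigmaT _ * _), PowerSeries.coeff_mul, Finset.sum_mul]
  refine Finset.sum_congr rfl fun p _ => ?_
  rw [formalSum_sub ((hasFormalSum_binom hEp n p.2 c).1.const_mul _)
    ((hasFormalSum_binom hEm n p.2 c).1.const_mul _),
    formalSum_const_mul (hasFormalSum_binom hEp n p.2 c).1,
    formalSum_const_mul (hasFormalSum_binom hEm n p.2 c).1,
    (hasFormalSum_binom hEp n p.2 c).2, (hasFormalSum_binom hEm n p.2 c).2, hp, hm, hpowp, hpowm,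
    sigmaT, sub_mul, map_sub, mul_smul_comm, mul_neg, mul_smul_comm, mul_zpow, mul_zpow, div_zpow,
    inv_zpow]
  -- The integer powers of W coming from the bases cancel the factors W^{∓n} in front, and ς(u)^n
  -- cancels the denominator of (ς(x+u)/ς(u))^n.
  have hWn0 : W ^ n ≠ 0 := zpow_ne_zero n hW0
  have hun0 : sigma u ^ n ≠ 0 := zpow_ne_zero n hsu
  field_simp

/-! ### Energy -/

/-- The energy of a configuration, shifted by a multiple of the charge so that it is an integer. -/
def energy (S : Config) : ℤ :=
  ∑ n ∈ S.finite_plus.toFinset, n + ∑ n ∈ S.finite_minus.toFinset, -n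

theorem energy_nonneg (S : Config) : 0 ≤ energy S := by
  refine add_nonneg (Finset.sum_nonneg fun n hn => ?_) (Finset.sum_nonneg fun n hn => ?_)
  · exact ((Set.Finite.mem_toFinset _).1 hn).2
  · have := ((Set.Finite.mem_toFinset _).1 hn).2
    omega

/-- A configuration is determined by its particles and holes, whose positions are bounded by the
energy. The charge need not be fixed; only the position 0 has weight zero. -/
theorem finite_energy_le (N : ℤ) : {S : Config | energy S ≤ N}.Finite := by
  refine Set.Finite.of_finite_image (f := fun S : Config =>
    (S.finite_plus.toFinset, S.finite_minus.toFinset)) ?_ ?_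
  · refine (Finset.finite_toSet ((Finset.Icc 0 N).powerset ×ˢ (Finset.Icc (-N) 0).powerset)).subset ?_
    rintro _ ⟨S, hS, rfl⟩
    have h1 : ∀ n ∈ S.finite_plus.toFinset, 0 ≤ n := fun n hn =>
      ((Set.Finite.mem_toFinset _).1 hn).2
    have h2 : ∀ n ∈ S.finite_minus.toFinset, 0 ≤ -n := fun n hn => by
      have := ((Set.Finite.mem_toFinset _).1 hn).2
      omega
    have hS' : energy S ≤ N := hS
    rw [energy] at hS'
    have h3 := Finset.sum_nonneg h1
    have h4 := Finset.sum_nonneg h2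
    simp only [Finset.coe_product, Set.mem_prod, Finset.mem_coe, Finset.mem_powerset]
    constructor
    · intro n hn
      have h5 := Finset.single_le_sum h1 hn
      rw [Finset.mem_Icc]
      exact ⟨h1 n hn, by linarith⟩
    · intro n hn
      have h5 := Finset.single_le_sum h2 hn
      have h6 := h2 n hn
      rw [Finset.mem_Icc]
      constructor <;> linarith
  · intro S _ T _ h
    ext n
    have h1 := congrArg (fun p => n ∈ p.1) h
    have h2 := congrArg (fun p => n ∈ p.2) h
    simp only [Set.Finite.mem_toFinset, Set.mem_ofPred_eq, eq_iff_iff] at h1 h2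
    by_cases hn : 0 ≤ n
    · simpa [hn] using h1
    · have hn' : n < 0 := not_le.1 hn
      simpa [hn', not_iff_not] using h2

theorem energy_add {S : Config} {k : ℤ} (hk : k ∉ S.carrier) :
    energy (S.add k) = energy S + k := by
  classical
  rcases le_or_gt 0 k with h0 | h0
  · have h1 : (S.add k).finite_plus.toFinset = insert k S.finite_plus.toFinset := by
      ext n
      simp only [Set.Finite.mem_toFinset, Finset.mem_insert, Config.add, Set.mem_insert_iff,
        Set.mem_ofPred_eq]
      grind
    have h2 : (S.add k).finite_minus.toFinset = S.finite_minus.toFinset := by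
      ext n
      simp only [Set.Finite.mem_toFinset, Config.add, Set.mem_insert_iff, Set.mem_ofPred_eq]
      grind
    rw [energy, h1, h2, Finset.sum_insert (by simp [hk]), energy]
    ring
  · have h1 : (S.add k).finite_plus.toFinset = S.finite_plus.toFinset := by
      ext n
      simp only [Set.Finite.mem_toFinset, Config.add, Set.mem_insert_iff, Set.mem_ofPred_eq]
      grind
    have h2 : S.finite_minus.toFinset = insert k (S.add k).finite_minus.toFinset := by
      ext n
      simp only [Set.Finite.mem_toFinset, Finset.mem_insert, Config.add, Set.mem_insert_iff,
        Set.mem_ofPred_eq]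
      grind
    rw [energy, energy, h1, h2, Finset.sum_insert (by simp [Config.add])]
    ring

theorem energy_remove {S : Config} {k : ℤ} (hk : k ∈ S.carrier) :
    energy (S.remove k) = energy S - k := by
  have h : (S.remove k).add k = S := by
    ext n
    simp only [Config.add, Config.remove, Set.mem_insert_iff, Set.mem_sdiff, Set.mem_singleton_iff]
    grind
  have h1 := energy_add (S := S.remove k) (k := k) (by simp [Config.remove])
  rw [h] at h1
  linarith

/-! ### Admissible operators -/

/-- `1` if `a ≤ i + 1` and `0` otherwise. -/
def stepFun (a : ℕ) (i : Fin m) : ℤ := if a ≤ i + 1 then 1 else 0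

/-- An estimate for the matrix entry `f` at `(U, V)` of an operator. The levels `a` and `b` stand
for the rows and the columns: `i + 1` is the level of the variable `w_i`, the level `0` that of
operators of bounded energy, and those above `m` are the levels of operators that do not depend on
the variables and do not raise the energy. -/
def EntryBdd (a b : ℕ) (C : ℤ) (U V : Config) (f : Coef m) : Prop :=
  Bdd (fun i => -C - stepFun a i * energy U + stepFun b i * energy V) f ∧
    (f ≠ 0 → ((a - m : ℕ) : ℤ) * energy U ≤ C + ((b - m : ℕ) : ℤ) * energy V ∧
      ((1 - b : ℕ) : ℤ) * energy V ≤ C + ((1 - a : ℕ) : ℤ) * energy U)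

/-- Operators whose matrix entries satisfy estimates that depend only on the energies. Products of
operators of this kind are defined when the levels increase from left to right. -/
def Adm (a b : ℕ) (X : Op m) : Prop := ∃ C, ∀ U V, EntryBdd a b C U V (X U V)

theorem stepFun_antitone {a b : ℕ} (h : a ≤ b) (i : Fin m) : stepFun b i ≤ stepFun a i := by
  unfold stepFun
  split_ifs <;> omega

theorem EntryBdd.zero (a b : ℕ) (C : ℤ) (U V : Config) : EntryBdd a b C U V (0 : Coef m) :=
  ⟨Bdd.zero _, fun h => absurd rfl h⟩

theorem EntryBdd.mono {a b a' b' : ℕ} {C C' : ℤ} {U V : Config} {f : Coef m}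
    (h : EntryBdd a b C U V f) (ha : a' ≤ a) (hb : b ≤ b') (hC : C ≤ C') :
    EntryBdd a' b' C' U V f := by
  refine ⟨h.1.mono fun i => ?_, fun h0 => ?_⟩
  · have h1 := mul_le_mul_of_nonneg_right (stepFun_antitone ha i) (energy_nonneg U)
    have h2 := mul_le_mul_of_nonneg_right (stepFun_antitone hb i) (energy_nonneg V)
    simp only
    linarith
  · obtain ⟨h1, h1'⟩ := h.2 h0
    have h2 : ((a' - m : ℕ) : ℤ) * energy U ≤ ((a - m : ℕ) : ℤ) * energy U :=
      mul_le_mul_of_nonneg_right (by omega) (energy_nonneg U)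
    have h3 : ((b - m : ℕ) : ℤ) * energy V ≤ ((b' - m : ℕ) : ℤ) * energy V :=
      mul_le_mul_of_nonneg_right (by omega) (energy_nonneg V)
    have h4 : ((1 - a : ℕ) : ℤ) * energy U ≤ ((1 - a' : ℕ) : ℤ) * energy U :=
      mul_le_mul_of_nonneg_right (by omega) (energy_nonneg U)
    have h5 : ((1 - b' : ℕ) : ℤ) * energy V ≤ ((1 - b : ℕ) : ℤ) * energy V :=
      mul_le_mul_of_nonneg_right (by omega) (energy_nonneg V)
    constructor <;> linarith

/-- The contributions of the intermediate energy have total coefficient `stepFun b i - stepFun a'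
i`, which is nonnegative when b ≤ a', and may be dropped as energies are nonnegative. The two
support inequalities chain in the same way. -/
theorem EntryBdd.mul {a b a' b' : ℕ} {C C' : ℤ} {U T V : Config} {f g : Coef m}
    (hf : EntryBdd a b C U T f) (hg : EntryBdd a' b' C' T V g) (h : b ≤ a') :
    EntryBdd a b' (C + C') U V (f * g) := by
  have hT := energy_nonneg T
  refine ⟨(hf.1.mul hg.1).mono fun i => ?_, fun h0 => ?_⟩
  · have h1 := mul_le_mul_of_nonneg_right (stepFun_antitone h i) hT
    simp only [Pi.add_apply]
    linarith
  · obtain ⟨h1, h1'⟩ := hf.2 (left_ne_zero_of_mul h0)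
    obtain ⟨h2, h2'⟩ := hg.2 (right_ne_zero_of_mul h0)
    have h3 : ((b - m : ℕ) : ℤ) * energy T ≤ ((a' - m : ℕ) : ℤ) * energy T :=
      mul_le_mul_of_nonneg_right (by omega) hT
    have h4 : ((1 - a' : ℕ) : ℤ) * energy T ≤ ((1 - b : ℕ) : ℤ) * energy T :=
      mul_le_mul_of_nonneg_right (by omega) hT
    constructor <;> linarith

/-- A strict increase of level at the junction makes some estimate grow with the intermediate
energy. Which estimate does so depends on whether b is 0, is the level of a variable, or exceeds m.
-/
theorem EntryBdd.exists_energy_le {a b a' b' : ℕ} (h : b < a') (C C' : ℤ) (U V : Config)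
    (γ : Lex (Fin m → ℤ)) : ∃ N : ℤ, ∀ (T : Config) (f g : Coef m), EntryBdd a b C U T f →
      EntryBdd a' b' C' T V g → (f * g).coeff γ ≠ 0 → energy T ≤ N := by
  rcases Nat.eq_zero_or_pos b with hb0 | hb0
  · refine ⟨C + ((1 - a : ℕ) : ℤ) * energy U, fun T f g hf hg h0 => ?_⟩
    have h1 : f * g ≠ 0 := fun h' => h0 (by rw [h', HahnSeries.coeff_zero])
    refine le_trans ?_ (hf.2 (left_ne_zero_of_mul h1)).2
    simp [hb0]
  rcases le_or_gt b m with hb | hb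
  -- At the variable of level b the left factor gains the full intermediate energy while the right
  -- factor loses none of it, so the exponent γ bounds the energy of T.
  · set i : Fin m := ⟨b - 1, by omega⟩ with hi
    refine ⟨psum i γ + C + C' + energy U, fun T f g hf hg h0 => ?_⟩
    have h1 := (hf.1.mul hg.1) γ h0 i
    have h2 : stepFun b i = 1 := if_pos (by simp only [hi]; omega)
    have h3 : stepFun a' i = 0 := if_neg (by simp only [hi]; omega)
    have h4 : stepFun a i * energy U ≤ energy U := by
      have := energy_nonneg U
      unfold stepFun
      split_ifs <;> linarith
    have h5 : 0 ≤ stepFun b' i * energy V := by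
      have := energy_nonneg V
      unfold stepFun
      split_ifs <;> linarith
    simp only [Pi.add_apply, h2, h3] at h1
    linarith
  -- Here a' > m + 1, so the right factor limits by how much the energy can be raised; no exponent
  -- is needed.
  · refine ⟨C' + ((b' - m : ℕ) : ℤ) * energy V, fun T f g hf hg h0 => ?_⟩
    have h1 : f * g ≠ 0 := fun h' => h0 (by rw [h', HahnSeries.coeff_zero])
    refine le_trans ?_ (hg.2 (right_ne_zero_of_mul h1)).1
    have h2 := energy_nonneg T
    have h3 : (1 : ℤ) ≤ ((a' - m : ℕ) : ℤ) := by omega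
    nlinarith

theorem EntryBdd.formalSum {a b : ℕ} {C : ℤ} {U V : Config} {f : κ → Coef m}
    (h : ∀ k, EntryBdd a b C U V (f k)) : EntryBdd a b C U V (formalSum f) := by
  refine ⟨Bdd.formalSum fun k => (h k).1, fun h0 => ?_⟩
  by_contra hne
  refine h0 ?_
  have : f = fun _ => 0 := by
    ext1 k
    by_contra hk
    exact hne ((h k).2 hk)
  rw [this, formalSum_zero]

theorem EntryBdd.add {a b : ℕ} {C : ℤ} {U V : Config} {f g : Coef m}
    (hf : EntryBdd a b C U V f) (hg : EntryBdd a b C U V g) : EntryBdd a b C U V (f + g) := by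
  refine ⟨hf.1.add hg.1, fun h0 => ?_⟩
  by_cases h : f = 0
  · exact hg.2 fun h' => h0 (by rw [h, h', add_zero])
  · exact hf.2 h

theorem Adm.mono {a b a' b' : ℕ} {X : Op m} (h : Adm a b X) (ha : a' ≤ a) (hb : b ≤ b') :
    Adm a' b' X := by
  obtain ⟨C, hC⟩ := h
  exact ⟨C, fun U V => (hC U V).mono ha hb le_rfl⟩

theorem Adm.zero (a b : ℕ) : Adm a b (0 : Op m) := ⟨0, fun U V => EntryBdd.zero a b 0 U V⟩

theorem Adm.add {a b : ℕ} {X Y : Op m} (hX : Adm a b X) (hY : Adm a b Y) : Adm a b (X + Y) := by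
  obtain ⟨C, hC⟩ := hX
  obtain ⟨D, hD⟩ := hY
  exact ⟨max C D, fun U V => ((hC U V).mono le_rfl le_rfl (le_max_left _ _)).add
    ((hD U V).mono le_rfl le_rfl (le_max_right _ _))⟩

theorem Adm.sum {a b : ℕ} {s : Finset κ} {X : κ → Op m} (h : ∀ k ∈ s, Adm a b (X k)) :
    Adm a b (∑ k ∈ s, X k) :=
  Finset.sum_induction X (Adm a b) (fun _ _ => Adm.add) (Adm.zero a b) h

theorem Adm.smul {a b : ℕ} {X : Op m} (h : Adm a b X) {C : ℤ} {f : Coef m}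
    (hf : Bdd (fun _ => -C) f) : Adm a b (f • X) := by
  obtain ⟨D, hD⟩ := h
  -- The scalar changes only the exponents. The support inequalities need the old constant D, and C
  -- may be negative, hence the maximum.
  refine ⟨max (C + D) D, fun U V => ⟨?_, fun h0 => ?_⟩⟩
  · refine (hf.mul (hD U V).1).mono fun i => ?_
    have := le_max_left (C + D) D
    simp only [Pi.add_apply]
    linarith
  · have h1 := (hD U V).2 (right_ne_zero_of_mul h0)
    have h2 := le_max_right (C + D) D
    constructor <;> linarith [h1.1, h1.2]

theorem Bdd.const {c : Fin m → ℤ} {f : Coef m} (hf : Bdd c f) :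
    ∃ C : ℤ, Bdd (fun _ => -C) f := by
  refine ⟨∑ i, |c i|, hf.mono fun i => ?_⟩
  have h1 := Finset.single_le_sum (f := fun i => |c i|) (fun i _ => abs_nonneg (c i))
    (Finset.mem_univ i)
  have h2 := neg_abs_le (c i)
  simp only at h1 ⊢
  linarith

theorem Adm.smul_bdd {a b : ℕ} {X : Op m} (h : Adm a b X) {c : Fin m → ℤ} {f : Coef m}
    (hf : Bdd c f) : Adm a b (f • X) := by
  obtain ⟨C, hC⟩ := hf.const
  exact h.smul hC

/-- The common cone comes from the product estimate. For each monomial the intermediate energy is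
bounded, which leaves finitely many intermediate configurations. -/
theorem Adm.composable {a b a' b' : ℕ} {X Y : Op m} (hX : Adm a b X) (hY : Adm a' b' Y)
    (h : b < a') : X.Composable Y := by
  obtain ⟨C, hC⟩ := hX
  obtain ⟨D, hD⟩ := hY
  intro U V
  refine formallySummable_of_bdd (fun T => ((hC U T).mul (hD T V) h.le).1) fun γ => ?_
  obtain ⟨N, hN⟩ := EntryBdd.exists_energy_le (a := a) (b' := b') h C D U V γ
  exact (finite_energy_le N).subset fun T hT => hN T _ _ (hC U T) (hD T V) hT

theorem Adm.comp {a b a' b' : ℕ} {X Y : Op m} (hX : Adm a b X) (hY : Adm a' b' Y)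
    (h : b ≤ a') : Adm a b' (X.comp Y) := by
  obtain ⟨C, hC⟩ := hX
  obtain ⟨D, hD⟩ := hY
  exact ⟨C + D, fun U V => EntryBdd.formalSum fun T => (hC U T).mul (hD T V) h⟩

/-- Associativity is Fubini for the double family over both intermediate configurations; summability
of the two simple compositions alone would not justify the exchange. -/
theorem Op.comp_assoc_of_summable {X Y Z : Op m} (hXY : X.Composable Y) (hYZ : Y.Composable Z)
    (hF : ∀ U V, FormallySummable fun p : Config × Config => X U p.1 * Y p.1 p.2 * Z p.2 V) :
    (X.comp Y).comp Z = X.comp (Y.comp Z) := by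
  ext1 U
  ext1 V
  calc formalSum (fun T => formalSum (fun S => X U S * Y S T) * Z T V)
      = formalSum fun T => formalSum fun S => X U S * Y S T * Z T V := by
        simp only [formalSum_mul_const (hXY U _)]
    _ = formalSum fun S => formalSum fun T => X U S * Y S T * Z T V :=
        (hF U V).formalSum_comm.symm
    _ = formalSum fun S => X U S * formalSum fun T => Y S T * Z T V := by
        simp only [mul_assoc, formalSum_const_mul (hYZ _ V)]

theorem Adm.comp_assoc {a b a' b' a'' b'' : ℕ} {X Y Z : Op m} (hX : Adm a b X)
    (hY : Adm a' b' Y) (hZ : Adm a'' b'' Z) (h : b < a') (h' : b' < a'') :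
    (X.comp Y).comp Z = X.comp (Y.comp Z) := by
  have hXY := hX.composable hY h
  have hYZ := hY.composable hZ h'
  obtain ⟨C, hC⟩ := hX
  obtain ⟨D, hD⟩ := hY
  obtain ⟨E, hE⟩ := hZ
  refine Op.comp_assoc_of_summable hXY hYZ fun U V => ?_
  refine formallySummable_of_bdd
    (fun p => (((hC U p.1).mul (hD p.1 p.2) h.le).mul (hE p.2 V) h'.le).1) fun γ => ?_
  obtain ⟨N, hN⟩ := EntryBdd.exists_energy_le (a := a) (b' := b'') h C (D + E) U V γ
  obtain ⟨M, hM⟩ := EntryBdd.exists_energy_le (a := a) (b' := b'') h' (C + D) E U V γ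
  refine ((finite_energy_le N).prod (finite_energy_le M)).subset fun p hp => ⟨?_, ?_⟩
  · refine hN p.1 _ _ (hC U p.1) ((hD p.1 p.2).mul (hE p.2 V) h'.le) ?_
    rw [← mul_assoc]
    exact hp
  · exact hM p.2 _ _ ((hC U p.1).mul (hD p.1 p.2) h.le) (hE p.2 V) hp

/-! ### Units and bilinearity of the composition -/

theorem Op.comp_id (X : Op m) : X.comp (Op.id m) = X := by
  ext1 U
  ext1 V
  rw [Op.comp, formalSum_single V]
  · simp [Op.id]
  · intro T hT
    simp [Op.id, hT]

theorem Op.id_comp (X : Op m) : (Op.id m).comp X = X := by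
  ext1 U
  ext1 V
  rw [Op.comp, formalSum_single U]
  · simp [Op.id]
  · intro T hT
    simp [Op.id, Ne.symm hT]

theorem Op.Composable.add_right {X Y Z : Op m} (h : X.Composable Y) (h' : X.Composable Z) :
    X.Composable (Y + Z) := fun U V => by
  simpa only [Pi.add_apply, mul_add] using (h U V).add (h' U V)

theorem Op.comp_add {X Y Z : Op m} (h : X.Composable Y) (h' : X.Composable Z) :
    X.comp (Y + Z) = X.comp Y + X.comp Z := by
  ext1 U
  ext1 V
  simp only [Op.comp, Pi.add_apply, mul_add]
  exact formalSum_add (h U V) (h' U V)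

theorem Op.add_comp {X Y Z : Op m} (h : X.Composable Z) (h' : Y.Composable Z) :
    (X + Y).comp Z = X.comp Z + Y.comp Z := by
  ext1 U
  ext1 V
  simp only [Op.comp, Pi.add_apply, add_mul]
  exact formalSum_add (h U V) (h' U V)

theorem Op.comp_smul {X Y : Op m} (h : X.Composable Y) (c : Coef m) :
    X.comp (c • Y) = c • X.comp Y := by
  ext1 U
  ext1 V
  simp only [Op.comp, Pi.smul_apply, smul_eq_mul, mul_left_comm _ c]
  exact formalSum_const_mul (h U V) c

theorem Op.smul_comp {X Y : Op m} (h : X.Composable Y) (c : Coef m) :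
    (c • X).comp Y = c • X.comp Y := by
  ext1 U
  ext1 V
  simp only [Op.comp, Pi.smul_apply, smul_eq_mul, mul_assoc]
  exact formalSum_const_mul (h U V) c

theorem Op.comp_zero (X : Op m) : X.comp 0 = 0 := by
  ext1 U
  ext1 V
  simpa [Op.comp] using formalSum_zero

theorem Op.zero_comp (X : Op m) : (0 : Op m).comp X = 0 := by
  ext1 U
  ext1 V
  simpa [Op.comp] using formalSum_zero

theorem Op.comp_sum {X : Op m} {s : Finset κ} {Y : κ → Op m}
    (h : ∀ k ∈ s, X.Composable (Y k)) : X.comp (∑ k ∈ s, Y k) = ∑ k ∈ s, X.comp (Y k) := by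
  ext1 U
  ext1 V
  simp only [Op.comp, Finset.sum_apply, Finset.mul_sum]
  exact (formalSum_finset_sum s fun k hk => h k hk U V).2

theorem Op.sum_comp {X : Op m} {s : Finset κ} {Y : κ → Op m}
    (h : ∀ k ∈ s, (Y k).Composable X) : (∑ k ∈ s, Y k).comp X = ∑ k ∈ s, (Y k).comp X := by
  ext1 U
  ext1 V
  simp only [Op.comp, Finset.sum_apply, Finset.sum_mul]
  exact (formalSum_finset_sum s fun k hk => h k hk U V).2

/-! ### Criteria for admissibility -/

theorem adm_of_level {k : ℕ} (h0 : 0 < k) (hk : k ≤ m) {C : ℤ} {X : Op m}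
    (h : ∀ U V, Bdd (fun i => -C + stepFun k i * (energy V - energy U)) (X U V)) : Adm k k X := by
  refine ⟨max C 0, fun U V => ⟨(h U V).mono fun i => ?_, fun _ => ?_⟩⟩
  · have := le_max_left C 0
    simp only
    linarith
  · have h1 : k - m = 0 := by omega
    have h2 : 1 - k = 0 := by omega
    simp [h1, h2]

/-- Where an entry is nonzero, E(V) - E(U) is nonnegative, so raising the level only weakens the
estimate. Operators that do not raise the energy can therefore be placed at any level from k on. -/
theorem adm_of_triangular {k k' : ℕ} (h0 : 0 < k) (hk : k ≤ k') {C : ℤ} {X : Op m}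
    (h : ∀ U V, Bdd (fun i => -C + stepFun k i * (energy V - energy U)) (X U V))
    (h' : ∀ U V, X U V ≠ 0 → energy U ≤ energy V) : Adm k' k' X := by
  refine ⟨max C 0, fun U V => ?_⟩
  by_cases hX : X U V = 0
  · rw [hX]
    exact EntryBdd.zero _ _ _ _ _
  have h1 := h' U V hX
  refine ⟨(h U V).mono fun i => ?_, fun _ => ⟨?_, ?_⟩⟩
  · have h2 := le_max_left C 0
    have h3 := mul_le_mul_of_nonneg_right (stepFun_antitone hk i) (sub_nonneg.2 h1)
    simp only
    linarith
  · have h2 := le_max_right C 0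
    have h3 := mul_le_mul_of_nonneg_left h1 (Int.natCast_nonneg (k' - m))
    linarith
  · have h4 : 1 - k' = 0 := by omega
    simp [h4]

theorem adm_id (k : ℕ) : Adm k k (Op.id m) := by
  classical
  refine ⟨0, fun U V => ?_⟩
  unfold Op.id
  split_ifs with h
  · subst h
    refine ⟨Bdd.one.mono fun i => ?_, fun _ => ⟨?_, ?_⟩⟩ <;> simp
  · exact EntryBdd.zero _ _ _ _ _

/-! ### Anticommutation relations -/

theorem finite_above (S : Config) (k : ℤ) : {s | s ∈ S.carrier ∧ k < s}.Finite := by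
  refine (S.finite_plus.union (Set.finite_Ioo k 0)).subset fun s hs => ?_
  rcases le_or_gt 0 s with h | h
  · exact Or.inl ⟨hs.1, h⟩
  · exact Or.inr ⟨hs.2, h⟩

/-- The new element k counts among those larger than n precisely when n < k, and then flips the
sign. -/
theorem wedgeSign_add {S : Config} {k : ℤ} (hk : k ∉ S.carrier) (n : ℤ) :
    wedgeSign (S.add k) n = wedgeSign S n * if n < k then -1 else 1 := by
  unfold wedgeSign
  split_ifs with h
  · have h1 : {s | s ∈ (S.add k).carrier ∧ n < s} = insert k {s | s ∈ S.carrier ∧ n < s} := by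
      ext s
      simp only [Config.add, Set.mem_insert_iff, Set.mem_ofPred_eq]
      grind
    rw [h1, Set.ncard_insert_of_notMem (fun h' => hk h'.1) (finite_above S n), pow_succ]
  · have h1 : {s | s ∈ (S.add k).carrier ∧ n < s} = {s | s ∈ S.carrier ∧ n < s} := by
      ext s
      simp only [Config.add, Set.mem_insert_iff, Set.mem_ofPred_eq]
      grind
    rw [h1, mul_one]

theorem Config.add_remove {S : Config} {k : ℤ} (hk : k ∉ S.carrier) : (S.add k).remove k = S := by
  ext n
  simp only [Config.add, Config.remove, Set.mem_insert_iff, Set.mem_sdiff, Set.mem_singleton_iff]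
  grind

theorem Config.remove_add {S : Config} {k : ℤ} (hk : k ∈ S.carrier) : (S.remove k).add k = S := by
  ext n
  simp only [Config.add, Config.remove, Set.mem_insert_iff, Set.mem_sdiff, Set.mem_singleton_iff]
  grind

theorem wedgeSign_remove {S : Config} {k : ℤ} (hk : k ∈ S.carrier) (n : ℤ) :
    wedgeSign (S.remove k) n = wedgeSign S n * if n < k then -1 else 1 := by
  have h := wedgeSign_add (S := S.remove k) (k := k) (by simp [Config.remove]) n
  rw [Config.remove_add hk] at h
  rw [h]
  split_ifs <;> ring

theorem wedgeSign_mul_self (S : Config) (k : ℤ) : wedgeSign S k * wedgeSign S k = 1 := by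
  unfold wedgeSign
  rw [← mul_pow]
  norm_num

open Classical in
theorem psi_single (k : ℤ) (S : Config) : psi k (Finsupp.single S 1) =
    if k ∈ S.carrier then 0 else wedgeSign S k • Finsupp.single (S.add k) 1 := by
  rw [psi, Finsupp.linearCombination_single, one_smul]
  split_ifs
  · rfl
  · rw [Finsupp.smul_single, smul_eq_mul, mul_one]

open Classical in
theorem psiStar_single (k : ℤ) (S : Config) : psiStar k (Finsupp.single S 1) =
    if k ∈ S.carrier then wedgeSign S k • Finsupp.single (S.remove k) 1 else 0 := by
  rw [psiStar, Finsupp.linearCombination_single, one_smul]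
  split_ifs
  · rw [Finsupp.smul_single, smul_eq_mul, mul_one]
  · rfl

theorem psi_psi_single (i j : ℤ) (S : Config) :
    psi i (psi j (Finsupp.single S 1)) = -psi j (psi i (Finsupp.single S 1)) := by
  classical
  rw [psi_single, psi_single]
  by_cases hij : i = j
  · subst hij
    split_ifs with h
    · simp
    · rw [map_smul, psi_single, if_pos (show i ∈ (S.add i).carrier from Set.mem_insert _ _),
        smul_zero, neg_zero]
  by_cases hi : i ∈ S.carrier <;> by_cases hj : j ∈ S.carrier
  · simp [hi, hj]
  · rw [if_pos hi, if_neg hj, map_zero, neg_zero, map_smul, psi_single,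
      if_pos (show i ∈ (S.add j).carrier from Set.mem_insert_of_mem _ hi), smul_zero]
  · rw [if_neg hi, if_pos hj, map_zero, map_smul, psi_single,
      if_pos (show j ∈ (S.add i).carrier from Set.mem_insert_of_mem _ hj), smul_zero, neg_zero]
  · have h1 : i ∉ (S.add j).carrier := by simp [Config.add, hij, hi]
    have h2 : j ∉ (S.add i).carrier := by simp [Config.add, Ne.symm hij, hj]
    have h3 : (S.add j).add i = (S.add i).add j := by
      ext n
      simp only [Config.add, Set.mem_insert_iff]
      tauto
    rw [if_neg hi, if_neg hj, map_smul, map_smul, psi_single, psi_single, if_neg h1, if_neg h2,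
      wedgeSign_add hj, wedgeSign_add hi, smul_smul, smul_smul, h3, ← neg_smul]
    congr 1
    rcases lt_or_gt_of_ne hij with h | h
    · rw [if_pos h, if_neg (not_lt.2 h.le)]
      ring
    · rw [if_pos h, if_neg (not_lt.2 h.le)]
      ring

theorem psiStar_psiStar_single (i j : ℤ) (S : Config) :
    psiStar i (psiStar j (Finsupp.single S 1)) = -psiStar j (psiStar i (Finsupp.single S 1)) := by
  classical
  rw [psiStar_single, psiStar_single]
  by_cases hij : i = j
  · subst hij
    split_ifs with h
    · rw [map_smul, psiStar_single, if_neg (show i ∉ (S.remove i).carrier from fun h => h.2 rfl),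
        smul_zero, neg_zero]
    · simp
  by_cases hi : i ∈ S.carrier <;> by_cases hj : j ∈ S.carrier
  · have h1 : i ∈ (S.remove j).carrier := ⟨hi, hij⟩
    have h2 : j ∈ (S.remove i).carrier := ⟨hj, Ne.symm hij⟩
    have h3 : (S.remove j).remove i = (S.remove i).remove j := by
      ext n
      simp only [Config.remove, Set.mem_sdiff, Set.mem_singleton_iff]
      tauto
    rw [if_pos hi, if_pos hj, map_smul, map_smul, psiStar_single, psiStar_single, if_pos h1,
      if_pos h2, wedgeSign_remove hj, wedgeSign_remove hi, smul_smul, smul_smul, h3, ← neg_smul]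
    congr 1
    rcases lt_or_gt_of_ne hij with h | h
    · rw [if_pos h, if_neg (not_lt.2 h.le)]
      ring
    · rw [if_pos h, if_neg (not_lt.2 h.le)]
      ring
  · rw [if_pos hi, if_neg hj, map_zero, map_smul, psiStar_single,
      if_neg (show j ∉ (S.remove i).carrier from fun h => hj h.1), smul_zero, neg_zero]
  · rw [if_neg hi, if_pos hj, map_zero, neg_zero, map_smul, psiStar_single,
      if_neg (show i ∉ (S.remove j).carrier from fun h => hi h.1), smul_zero]
  · simp [hi, hj]

theorem psiStar_psi_single (j k : ℤ) (S : Config) :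
    psiStar j (psi k (Finsupp.single S 1)) = (if j = k then Finsupp.single S 1 else 0) -
      psi k (psiStar j (Finsupp.single S 1)) := by
  classical
  rw [psi_single, psiStar_single]
  by_cases hjk : j = k
  · subst hjk
    rw [if_pos rfl]
    by_cases hj : j ∈ S.carrier
    · have h1 : j ∉ (S.remove j).carrier := by simp [Config.remove]
      rw [if_pos hj, if_pos hj, map_zero, map_smul, psi_single, if_neg h1, wedgeSign_remove hj,
        Config.remove_add hj, smul_smul, if_neg (lt_irrefl j), mul_one, wedgeSign_mul_self,
        one_smul, sub_self]
    · have h1 : j ∈ (S.add j).carrier := Set.mem_insert _ _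
      rw [if_neg hj, if_neg hj, map_zero, map_smul, psiStar_single, if_pos h1, wedgeSign_add hj,
        Config.add_remove hj, smul_smul, if_neg (lt_irrefl j), mul_one, wedgeSign_mul_self,
        one_smul, sub_zero]
  · rw [if_neg hjk, zero_sub]
    by_cases hj : j ∈ S.carrier <;> by_cases hk : k ∈ S.carrier
    · have h1 : k ∈ (S.remove j).carrier := ⟨hk, Ne.symm hjk⟩
      rw [if_pos hj, if_pos hk, map_zero, map_smul, psi_single, if_pos h1, smul_zero, neg_zero]
    · have h1 : k ∉ (S.remove j).carrier := fun h => hk h.1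
      have h2 : j ∈ (S.add k).carrier := Set.mem_insert_of_mem _ hj
      have h3 : (S.add k).remove j = (S.remove j).add k := by
        ext n
        simp only [Config.add, Config.remove, Set.mem_insert_iff, Set.mem_sdiff,
          Set.mem_singleton_iff]
        grind
      rw [if_pos hj, if_neg hk, map_smul, map_smul, psi_single, psiStar_single, if_neg h1,
        if_pos h2, wedgeSign_add hk, wedgeSign_remove hj, smul_smul, smul_smul, h3, ← neg_smul]
      congr 1
      rcases lt_or_gt_of_ne hjk with h | h
      · rw [if_pos h, if_neg (not_lt.2 h.le)]
        ring
      · rw [if_pos h, if_neg (not_lt.2 h.le)]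
        ring
    · simp [hj, hk]
    · have h1 : j ∉ (S.add k).carrier := by simp [Config.add, hjk, hj]
      rw [if_neg hj, if_neg hk, map_zero, map_smul, psiStar_single, if_neg h1, smul_zero, neg_zero]

/-- The commutation relations of `gl(∞)`, with the central term produced by normal ordering, as a
consequence of the anticommutation relations. -/
theorem commutator_of_anticommutation {R : Type*} [Ring R] {p s : ℤ → R}
    (hp : ∀ i j, p i * p j = -(p j * p i)) (hs : ∀ i j, s i * s j = -(s j * s i))
    (hsp : ∀ j k, s j * p k = (if j = k then 1 else 0) - p k * s j) (i j k l : ℤ) :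
    (p i * s j - if i = j ∧ j < 0 then 1 else 0) * (p k * s l - if k = l ∧ l < 0 then 1 else 0) -
      (p k * s l - if k = l ∧ l < 0 then 1 else 0) * (p i * s j - if i = j ∧ j < 0 then 1 else 0) =
    (if j = k then p i * s l - (if i = l ∧ l < 0 then 1 else 0) else 0) -
      (if l = i then p k * s j - (if k = j ∧ j < 0 then 1 else 0) else 0) +
      if j = k ∧ l = i then (if l < 0 then 1 else 0) - (if j < 0 then 1 else 0) else 0 := by
  have h1 : (p i * s j) * (p k * s l) =
      (if j = k then p i * s l else 0) - (p i * p k) * (s j * s l) := by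
    rw [mul_assoc, ← mul_assoc (s j), hsp]
    split_ifs <;> noncomm_ring
  have h2 : (p k * s l) * (p i * s j) =
      (if l = i then p k * s j else 0) - (p k * p i) * (s l * s j) := by
    rw [mul_assoc, ← mul_assoc (s l), hsp]
    split_ifs <;> noncomm_ring
  -- The normal-ordering constants are scalars and drop out of the commutator. They reappear in the
  -- central term when p i * s l and p k * s j are again written in normal order.
  have h3 : (p i * s j - if i = j ∧ j < 0 then 1 else 0) *
      (p k * s l - if k = l ∧ l < 0 then 1 else 0) -
      (p k * s l - if k = l ∧ l < 0 then 1 else 0) *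
      (p i * s j - if i = j ∧ j < 0 then 1 else 0) =
      (p i * s j) * (p k * s l) - (p k * s l) * (p i * s j) := by
    split_ifs <;> noncomm_ring
  have h4 : (p i * p k) * (s j * s l) = (p k * p i) * (s l * s j) := by
    rw [hp i k, hs j l, neg_mul_neg]
  rw [h3, h1, h2, h4]
  by_cases hjk : j = k <;> by_cases hli : l = i
  · subst hjk hli
    simp only [true_and, if_true, and_self]
    abel
  · simp [hli, hjk, Ne.symm hli]
  · simp only [hli, hjk, Ne.symm hjk, if_false, false_and, if_true]
    abel
  · simp [hli, hjk]

theorem wedge_ext {A B : Wedge →ₗ[ℂ] Wedge}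
    (h : ∀ S, A (Finsupp.single S 1) = B (Finsupp.single S 1)) : A = B :=
  Finsupp.lhom_ext' fun S => LinearMap.ext_ring (h S)

/-- The anticommutation relation turns both cases of the normal ordering into ψ_i ψ_j^* minus a
constant, a form in which commutators can be computed without distinguishing signs. -/
theorem matrixUnit_eq (i j : ℤ) : matrixUnit i j =
    ((psi i : Module.End ℂ Wedge) * psiStar j - if i = j ∧ j < 0 then 1 else 0 :
      Module.End ℂ Wedge) := by
  refine wedge_ext fun S => ?_
  have h := psiStar_psi_single j i S
  unfold matrixUnit
  by_cases hj : 0 ≤ j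
  · rw [if_pos hj, if_neg (fun h => absurd h.2 (not_lt.2 hj))]
    exact (sub_zero (psi i (psiStar j (Finsupp.single S 1)))).symm
  · rw [if_neg hj]
    change -psiStar j (psi i (Finsupp.single S 1)) = _
    rw [h, neg_sub]
    by_cases hij : i = j
    · rw [if_pos hij.symm, if_pos ⟨hij, not_le.1 hj⟩]
      rfl
    · rw [if_neg (Ne.symm hij), if_neg (fun h => hij h.1)]
      rfl

/-- The commutation relations of the operators `E_{ij}`. -/
theorem commutator_matrixUnit (i j k l : ℤ) (V U : Config) :
    matrixUnit i j (matrixUnit k l (Finsupp.single V 1)) U -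
      matrixUnit k l (matrixUnit i j (Finsupp.single V 1)) U =
    (if j = k then matrixUnit i l (Finsupp.single V 1) U else 0) -
      (if l = i then matrixUnit k j (Finsupp.single V 1) U else 0) +
      if j = k ∧ l = i then ((if l < 0 then 1 else 0) - if j < 0 then 1 else 0) *
        Finsupp.single V (1 : ℂ) U else 0 := by
  have h := commutator_of_anticommutation (R := Module.End ℂ Wedge)
    (p := fun i => psi i) (s := fun i => psiStar i)
    (fun i j => wedge_ext fun S => psi_psi_single i j S)
    (fun i j => wedge_ext fun S => psiStar_psiStar_single i j S)
    (fun j k => wedge_ext fun S => by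
      refine (psiStar_psi_single j k S).trans ?_
      split_ifs <;> rfl) i j k l
  simp only [← matrixUnit_eq] at h
  have h2 := congrArg (fun A : Module.End ℂ Wedge => A (Finsupp.single V 1) U) h
  refine Eq.trans h2 ?_
  by_cases hjk : j = k <;> by_cases hli : l = i
  · simp only [hjk, hli, and_self, if_true]
    split_ifs <;> simp
  · simp [hli, hjk]
  · simp [hli, hjk]
  · simp [hli, hjk]

/-! ### Commutators of the operators `ℰ_r(z)` -/

/-- Families of operators of which only finitely many act nontrivially on each basis vector. -/
def LocallyFinite (L : ℤ → Wedge →ₗ[ℂ] Wedge) : Prop :=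
  ∀ V, {n | L n (Finsupp.single V 1) ≠ 0}.Finite

/-- The matrix of `∑_n e_n L_n`. -/
def modeSum (L : ℤ → Wedge →ₗ[ℂ] Wedge) (e : ℤ → Coef m) : Op m := fun U V =>
  ∑ᶠ n, L n (Finsupp.single V 1) U • e n

theorem modeSum_eq_sum {L : ℤ → Wedge →ₗ[ℂ] Wedge} (e : ℤ → Coef m) {V : Config} {F : Finset ℤ}
    (hF : ∀ n, L n (Finsupp.single V 1) ≠ 0 → n ∈ F) (U : Config) :
    modeSum L e U V = ∑ n ∈ F, L n (Finsupp.single V 1) U • e n := by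
  refine finsum_eq_sum_of_support_subset _ fun n hn => hF n fun h => hn ?_
  simp only [h, Finsupp.coe_zero, Pi.zero_apply, zero_smul]

/-- Only finitely many modes act on v_V, their images involve finitely many basis vectors, and only
finitely many modes act on those. So the formal composition reduces to a finite double sum over
modes. -/
theorem modeSum_comp {L L' : ℤ → Wedge →ₗ[ℂ] Wedge} (hL : LocallyFinite L)
    (hL' : LocallyFinite L') (e e' : ℤ → Coef m) (U V : Config) :
    {p : ℤ × ℤ | L p.1 (L' p.2 (Finsupp.single V 1)) ≠ 0}.Finite ∧
    (Function.support fun T => modeSum L e U T * modeSum L' e' T V).Finite ∧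
    (modeSum L e).comp (modeSum L' e') U V =
      ∑ᶠ p : ℤ × ℤ, L p.1 (L' p.2 (Finsupp.single V 1)) U • (e p.1 * e' p.2) := by
  classical
  set F := (hL' V).toFinset
  have hF : ∀ n, L' n (Finsupp.single V 1) ≠ 0 → n ∈ F := fun n hn => by simpa [F] using hn
  set τ := F.biUnion fun n => (L' n (Finsupp.single V 1)).support with hτ
  set N := τ.biUnion fun T => (hL T).toFinset with hN
  have hNT : ∀ T ∈ τ, ∀ n, L n (Finsupp.single T 1) ≠ 0 → n ∈ N := fun T hT n hn => by
    rw [hN, Finset.mem_biUnion]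
    exact ⟨T, hT, by simpa using hn⟩
  have hexp : ∀ n n', L n (L' n' (Finsupp.single V 1)) =
      ∑ T ∈ τ, L' n' (Finsupp.single V 1) T • L n (Finsupp.single T 1) := by
    intro n n'
    by_cases h0 : L' n' (Finsupp.single V 1) = 0
    · simp [h0]
    have hsub : (L' n' (Finsupp.single V 1)).support ⊆ τ := by
      rw [hτ]
      exact Finset.subset_biUnion_of_mem (fun n => (L' n (Finsupp.single V 1)).support) (hF n' h0)
    conv_lhs => rw [← Finsupp.sum_single (L' n' (Finsupp.single V 1)),
      Finsupp.sum_of_support_subset _ hsub _ (by simp), map_sum]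
    refine Finset.sum_congr rfl fun T _ => ?_
    rw [← map_smul, Finsupp.smul_single, smul_eq_mul, mul_one]
  have hzero : ∀ T ∉ τ, modeSum L' e' T V = 0 := by
    intro T hT
    rw [modeSum_eq_sum e' hF]
    refine Finset.sum_eq_zero fun n hn => ?_
    rw [show L' n (Finsupp.single V 1) T = 0 from ?_, zero_smul]
    by_contra h
    refine hT ?_
    rw [hτ, Finset.mem_biUnion]
    exact ⟨n, hn, Finsupp.mem_support_iff.2 h⟩
  have hsupp : ∀ p : ℤ × ℤ, L p.1 (L' p.2 (Finsupp.single V 1)) ≠ 0 → p ∈ N ×ˢ F := by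
    intro p hp
    rw [Finset.mem_product]
    refine ⟨?_, hF p.2 fun h => hp (by rw [h, map_zero])⟩
    rw [hexp] at hp
    obtain ⟨T, hT, h⟩ := Finset.exists_ne_zero_of_sum_ne_zero hp
    exact hNT T hT p.1 fun h' => h (by rw [h', smul_zero])
  have hfin : (Function.support fun T => modeSum L e U T * modeSum L' e' T V) ⊆ τ :=
    fun T hT => by
      by_contra h
      refine hT ?_
      simp only [hzero T h, mul_zero]
  refine ⟨(Finset.finite_toSet (N ×ˢ F)).subset hsupp, (Finset.finite_toSet τ).subset hfin, ?_⟩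
  rw [Op.comp, formalSum_of_finite ((Finset.finite_toSet τ).subset hfin),
    finsum_eq_sum_of_support_subset _ hfin,
    finsum_eq_sum_of_support_subset (s := N ×ˢ F) _ fun p hp => ?_, Finset.sum_product]
  · have h1 : ∀ T ∈ τ, modeSum L e U T * modeSum L' e' T V = ∑ n ∈ N, ∑ n' ∈ F,
        (L' n' (Finsupp.single V 1) T * L n (Finsupp.single T 1) U) • (e n * e' n') := by
      intro T hT
      rw [modeSum_eq_sum e (hNT T hT), modeSum_eq_sum e' hF, Finset.sum_mul_sum]
      refine Finset.sum_congr rfl fun n _ => Finset.sum_congr rfl fun n' _ => ?_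
      rw [smul_mul_smul_comm, mul_comm (L n _ _)]
    rw [Finset.sum_congr rfl h1, Finset.sum_comm]
    refine Finset.sum_congr rfl fun n _ => ?_
    rw [Finset.sum_comm]
    refine Finset.sum_congr rfl fun n' _ => ?_
    rw [hexp, Finsupp.finsetSum_apply, Finset.sum_smul]
    rfl
  · refine hsupp p fun h => hp ?_
    simp only [h, Finsupp.coe_zero, Pi.zero_apply, zero_smul]

/-- A mode with n ≥ 0 must remove a particle at n, and one with n < 0 must fill a vacancy at n - r.
Finitely many such positions exist, apart from r ≤ n < 0, which is a finite range as well. -/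
theorem locallyFinite_matrixUnit (r : ℤ) : LocallyFinite fun n => matrixUnit (n - r) n := by
  classical
  intro V
  refine ((V.finite_plus.union (V.finite_minus.image fun n => n + r)).union
    (Set.finite_Ico r 0)).subset fun n hn => ?_
  simp only [Set.mem_ofPred_eq, matrixUnit] at hn
  by_cases h0 : 0 ≤ n
  · rw [if_pos h0, LinearMap.comp_apply, psiStar_single] at hn
    refine Or.inl (Or.inl ⟨by_contra fun h => hn ?_, h0⟩)
    rw [if_neg h, map_zero]
  · rw [if_neg h0, LinearMap.neg_apply, LinearMap.comp_apply, psi_single] at hn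
    have h1 : n - r ∉ V.carrier := fun h => hn (by rw [if_pos h, map_zero, neg_zero])
    by_cases h2 : n - r < 0
    · exact Or.inl (Or.inr ⟨n - r, ⟨h1, h2⟩, by simp⟩)
    · exact Or.inr ⟨by omega, by omega⟩

theorem energy_of_matrixUnit {i j : ℤ} {U V : Config}
    (h : matrixUnit i j (Finsupp.single V 1) U ≠ 0) : energy U = energy V + i - j := by
  classical
  have key : ∀ {i j : ℤ} {U V : Config}, i ≠ j → psi i (psiStar j (Finsupp.single V 1)) U ≠ 0 →
      energy U = energy V + i - j := by
    intro i j U V _ h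
    rw [psiStar_single] at h
    split_ifs at h with hj
    · rw [map_smul, psi_single] at h
      split_ifs at h with hi
      · simp at h
      · have : (V.remove j).add i = U := by
          by_contra hne
          refine h ?_
          rw [Finsupp.smul_apply, Finsupp.smul_apply, Finsupp.single_eq_of_ne (Ne.symm hne)]
          simp
        rw [← this, energy_add hi, energy_remove hj]
        ring
    · simp at h
  by_cases hij : i = j
  · subst hij
    suffices h' : U = V by rw [h']; ring
    by_contra hne
    refine h ?_
    rw [matrixUnit_eq]
    change psi i (psiStar i (Finsupp.single V 1)) U -
      ((if i = i ∧ i < 0 then 1 else 0 : Module.End ℂ Wedge) (Finsupp.single V 1)) U = 0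
    have h1 : ((if i = i ∧ i < 0 then 1 else 0 : Module.End ℂ Wedge) (Finsupp.single V 1)) U = 0 := by
      split_ifs
      · exact Finsupp.single_eq_of_ne hne
      · rfl
    rw [h1, psiStar_single]
    split_ifs with hj
    · rw [map_smul, psi_single, if_neg (fun h : i ∈ (V.remove i).carrier => h.2 rfl),
        Config.remove_add hj, Finsupp.smul_apply, Finsupp.smul_apply, Finsupp.single_eq_of_ne hne]
      simp
    · simp
  · refine key hij fun h0 => h ?_
    rw [matrixUnit_eq, if_neg (fun h => hij h.1)]
    exact (sub_zero _).trans h0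

/-- The coefficients of `ℰ_r(z)`. -/
def modeCoeff (r : ℤ) (z : Coef m) (n : ℤ) : Coef m :=
  expC (((n : ℂ) + 1 / 2 - (r : ℂ) / 2) • z)

/-- The part of `ℰ_r(z)` without the constant term. -/
def calE' (r : ℤ) (z : Coef m) : Op m :=
  modeSum (fun n => matrixUnit (n - r) n) (modeCoeff r z)

theorem calE_eq (r : ℤ) (z : Coef m) :
    calE r z = calE' r z + (if r = 0 then (sigma z)⁻¹ else 0) • Op.id m := by
  ext1 U
  ext1 V
  rw [calE, Pi.add_apply, Pi.add_apply, calE', modeSum, Pi.smul_apply, Pi.smul_apply, Op.id]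
  congr 1
  by_cases hr : r = 0 <;> by_cases hUV : U = V <;> simp [hr, hUV]

theorem energy_of_calE {r : ℤ} {z : Coef m} {U V : Config} (h : calE r z U V ≠ 0) :
    energy V - energy U = r := by
  rw [calE] at h
  by_cases h0 : r = 0 ∧ U = V
  · rw [h0.1, h0.2, sub_self]
  · rw [if_neg h0, add_zero] at h
    by_contra hne
    refine h (finsum_eq_zero_of_forall_eq_zero fun n => ?_)
    rw [show matrixUnit (n - r) n (Finsupp.single V 1) U = 0 from ?_, zero_smul]
    by_contra h1
    have := energy_of_matrixUnit h1
    omega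

theorem finite_calE_column (r : ℤ) (z : Coef m) (V : Config) : {T | calE r z T V ≠ 0}.Finite := by
  refine (finite_energy_le (energy V - r)).subset fun T hT => ?_
  have := energy_of_calE hT
  simp only [Set.mem_ofPred_eq]
  omega

theorem composable_calE (X : Op m) (r : ℤ) (z : Coef m) : X.Composable (calE r z) := fun _ V =>
  formallySummable_of_finite ((finite_calE_column r z V).subset fun _ hT =>
    right_ne_zero_of_mul hT)

/-- The exponents satisfy z(k - b - a/2) + w(k - b/2) = (aw - bz)/2 + (z + w)(k - (a+b)/2), so the
dependence on the mode is that of ℰ_{a+b}(z+w). -/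
theorem modeCoeff_mul {a b : ℤ} {z w : Coef m} (hz : IsSmall z) (hw : IsSmall w) (n : ℤ) :
    modeCoeff a z (n - b) * modeCoeff b w n = expC ((1 / 2 : ℂ) • ((a : ℂ) • w - (b : ℂ) • z)) *
      modeCoeff (a + b) (z + w) n := by
  rw [modeCoeff, modeCoeff, modeCoeff, ← expC_add (hz.smul _) (hw.smul _),
    ← expC_add (((hw.smul _).sub (hz.smul _)).smul _) ((hz.add hw).smul _)]
  congr 1
  push_cast
  module

/-- Multiplication by ς(v) makes the geometric sum telescope. It evaluates the central term of the
commutator. -/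
theorem sum_modeCoeff (a : ℕ) {v : Coef m} (hv : IsSmall v) :
    sigma v * ∑ n ∈ Finset.range a, modeCoeff (0 : ℤ) v ((n : ℤ)) *
      expC (-(((a : ℂ) / 2) • v)) = sigma ((a : ℂ) • v) := by
  have h : ∀ n : ℕ, sigma v * (modeCoeff (0 : ℤ) v (n : ℤ) * expC (-(((a : ℂ) / 2) • v))) =
      expC (((n + 1 : ℕ) : ℂ) • v - ((a : ℂ) / 2) • v) - expC ((n : ℂ) • v - ((a : ℂ) / 2) • v) := by
    intro n
    have h2 := hv.smul (1 / 2)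
    rw [modeCoeff, sigma, sub_mul, ← expC_add (hv.smul _) (hv.smul _).neg,
      ← expC_add h2 ((hv.smul _).add (hv.smul _).neg),
      ← expC_add h2.neg ((hv.smul _).add (hv.smul _).neg)]
    congr 2
    · push_cast
      module
    · push_cast
      module
  rw [Finset.mul_sum, Finset.sum_congr rfl fun n _ => h n, Finset.sum_range_sub
    (f := fun n : ℕ => expC ((n : ℂ) • v - ((a : ℂ) / 2) • v)), sigma]
  congr 2
  · module
  · push_cast
    module

theorem finsum_graph {M : Type*} [AddCommMonoid M] (φ : ℤ → ℤ) (g : ℤ → M) :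
    (∑ᶠ p : ℤ × ℤ, if p.1 = φ p.2 then g p.2 else 0) = ∑ᶠ n, g n := by
  have he : Function.Injective fun n => (φ n, n) := fun a b h => (Prod.mk.inj h).2
  rw [← finsum_comp_injective he]
  · simp
  · rintro ⟨a, b⟩ h
    refine if_neg fun h' => h ⟨b, ?_⟩
    simpa using h'.symm

theorem finite_graph {M : Type*} [AddCommMonoid M] (φ : ℤ → ℤ) {g : ℤ → M}
    (hg : g.support.Finite) :
    (Function.support fun p : ℤ × ℤ => if p.1 = φ p.2 then g p.2 else 0).Finite := by
  refine (hg.image fun n => (φ n, n)).subset ?_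
  rintro ⟨a, b⟩ h
  simp only [Function.mem_support, ne_eq, ite_eq_right_iff, Classical.not_imp] at h
  exact ⟨b, h.2, by simp [h.1]⟩

theorem finite_mode_support {L : ℤ → Wedge →ₗ[ℂ] Wedge} (hL : LocallyFinite L) (e : ℤ → Coef m)
    (U V : Config) : (Function.support fun n => L n (Finsupp.single V 1) U • e n).Finite :=
  (hL V).subset fun n hn h => hn (by simp only [h, Finsupp.coe_zero, Pi.zero_apply, zero_smul])

/-- The commutators of matrix units live on graphs of shifts. The two noncentral ones give ℰ' with
prefactors e^{±(aw-bz)/2}, whose difference is ς(aw-bz). The central one supplies the constant term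
1/ς(z+w) of ℰ_0 when a + b = 0. -/
theorem calE'_commutator {a b : ℤ} (ha : 0 ≤ a) {z w : Coef m} (hz : IsSmall z) (hw : IsSmall w)
    (h0 : z + w ≠ 0) :
    (calE' a z).comp (calE' b w) - (calE' b w).comp (calE' a z) =
      sigma ((a : ℂ) • w - (b : ℂ) • z) • calE (a + b) (z + w) := by
  classical
  have hv := hz.add hw
  ext1 U
  ext1 V
  have hA := locallyFinite_matrixUnit a
  have hB := locallyFinite_matrixUnit b
  have hAB := locallyFinite_matrixUnit (a + b)
  obtain ⟨f1, -, e1⟩ := modeSum_comp hA hB (modeCoeff a z) (modeCoeff b w) U V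
  obtain ⟨f2, -, e2⟩ := modeSum_comp hB hA (modeCoeff b w) (modeCoeff a z) U V
  set c : ℤ × ℤ → Coef m := fun p => modeCoeff a z p.1 * modeCoeff b w p.2 with hc
  set s1 : ℤ → Coef m := fun n => matrixUnit (n - (a + b)) n (Finsupp.single V 1) U •
    (expC ((1 / 2 : ℂ) • ((a : ℂ) • w - (b : ℂ) • z)) * modeCoeff (a + b) (z + w) n) with hs1
  set s2 : ℤ → Coef m := fun n => matrixUnit (n - (a + b)) n (Finsupp.single V 1) U •
    (expC (-((1 / 2 : ℂ) • ((a : ℂ) • w - (b : ℂ) • z))) * modeCoeff (a + b) (z + w) n) with hs2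
  set s3 : ℤ → Coef m := fun n => if a + b = 0 then
    (((if n < 0 then 1 else 0) - if n + a < 0 then 1 else 0) * Finsupp.single V (1 : ℂ) U) •
      (modeCoeff (0 : ℤ) (z + w) (n + a) * expC (-(((a : ℂ) / 2) • (z + w)))) else 0 with hs3
  have fs1 : s1.support.Finite := finite_mode_support hAB _ U V
  have fs2 : s2.support.Finite := finite_mode_support hAB _ U V
  -- The central term counts modes that change the sign of their index under the shift by a. As a ≥
  -- 0, these are the indices in [-a, 0).
  have fs3 : s3.support ⊆ ((Finset.Ico (-a) 0 : Finset ℤ) : Set ℤ) := by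
    intro n hn
    rw [Finset.mem_coe, Finset.mem_Ico]
    by_contra h
    refine hn ?_
    have h3 : ((if n < 0 then 1 else 0) - if n + a < 0 then 1 else 0 : ℂ) = 0 := by
      split_ifs
      · simp
      · omega
      · omega
      · simp
    simp only [hs3, h3, zero_mul, zero_smul, ite_self]
  have hterm : ∀ p : ℤ × ℤ,
      matrixUnit (p.1 - a) p.1 (matrixUnit (p.2 - b) p.2 (Finsupp.single V 1)) U • c p -
        matrixUnit (p.2 - b) p.2 (matrixUnit (p.1 - a) p.1 (Finsupp.single V 1)) U • c p =
      (if p.1 = (fun n => n - b) p.2 then s1 p.2 else 0) -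
        (if p.2 = (fun n => n - a) p.1 then s2 p.1 else 0) +
        if p.1 = (fun n => n + a) p.2 then s3 p.2 else 0 := by
    rintro ⟨n, n'⟩
    rw [← sub_smul, commutator_matrixUnit, add_smul, sub_smul]
    congr 1
    · congr 1
      · simp only
        split_ifs with h
        · subst h
          simp only [hs1, hc, ← modeCoeff_mul hz hw]
          congr 4
          ring
        · rw [zero_smul]
      · simp only
        split_ifs with h
        · subst h
          have h4 := modeCoeff_mul (a := b) (b := a) hw hz n
          simp only [hs2, hc]
          rw [mul_comm (modeCoeff a z n), h4, add_comm b a, add_comm w z]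
          congr 3
          · congr 1
            ring
          · module
        · rw [zero_smul]
    · simp only
      by_cases h : n = n' - b ∧ n' = n - a
      · have hab : a + b = 0 := by omega
        have hn : n = n' + a := by omega
        have hb : b = -a := by omega
        rw [if_pos h, if_pos hn]
        simp only [hs3, if_pos hab, hn, hc]
        congr 1
        rw [modeCoeff, modeCoeff, modeCoeff, ← expC_add (hz.smul _) (hw.smul _),
          ← expC_add (hv.smul _) (hv.smul _).neg, hb]
        congr 1
        push_cast
        module
      · rw [if_neg h, zero_smul]
        split_ifs with hn
        · rw [hs3]
          simp only
          rw [if_neg]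
          intro hab
          exact h ⟨by omega, by omega⟩
        · rfl
  have g1 := finite_graph (fun n => n - b) fs1
  have g2 : (Function.support fun p : ℤ × ℤ =>
      if p.2 = (fun n => n - a) p.1 then s2 p.1 else 0).Finite := by
    refine ((finite_graph (fun n => n - a) fs2).image Prod.swap).subset fun p hp => ?_
    exact ⟨p.swap, hp, p.swap_swap⟩
  have g3 := finite_graph (fun n => n + a) ((Finset.finite_toSet _).subset fs3)
  have t2 : (∑ᶠ p : ℤ × ℤ, if p.2 = (fun n => n - a) p.1 then s2 p.1 else 0) = ∑ᶠ n, s2 n := by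
    rw [← finsum_graph (fun n => n - a) s2,
      ← finsum_comp_equiv (Equiv.prodComm ℤ ℤ)]
    rfl
  have t1 : (∑ᶠ p : ℤ × ℤ, if p.1 = p.2 - b then s1 p.2 else 0) = ∑ᶠ n, s1 n :=
    finsum_graph (fun n => n - b) s1
  have t3 : (∑ᶠ p : ℤ × ℤ, if p.1 = p.2 + a then s3 p.2 else 0) = ∑ᶠ n, s3 n :=
    finsum_graph (fun n => n + a) s3
  have hsupp : ∀ {A : ℤ × ℤ → Wedge}, {p | A p ≠ 0}.Finite →
      (Function.support fun p => A p U • c p).Finite := fun h =>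
    h.subset fun p hp h0 => hp (by simp only [h0, Finsupp.coe_zero, Pi.zero_apply, zero_smul])
  have e2' : (calE' b w).comp (calE' a z) U V = ∑ᶠ p : ℤ × ℤ,
      matrixUnit (p.2 - b) p.2 (matrixUnit (p.1 - a) p.1 (Finsupp.single V 1)) U • c p := by
    rw [calE', calE', e2, ← finsum_comp_equiv (Equiv.prodComm ℤ ℤ)]
    refine finsum_congr fun p => ?_
    simp only [Equiv.prodComm_apply, Prod.fst_swap, Prod.snd_swap, hc]
    rw [mul_comm (modeCoeff b w _)]
  have f2' : {p : ℤ × ℤ | matrixUnit (p.2 - b) p.2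
      (matrixUnit (p.1 - a) p.1 (Finsupp.single V 1)) ≠ 0}.Finite :=
    (f2.image Prod.swap).subset fun p hp => ⟨p.swap, hp, p.swap_swap⟩
  have h1 : ∑ᶠ n, s1 n = expC ((1 / 2 : ℂ) • ((a : ℂ) • w - (b : ℂ) • z)) *
      calE' (a + b) (z + w) U V := by
    rw [calE', modeSum, mul_finsum]
    exact finsum_congr fun n => by rw [mul_smul_comm]
  have h2 : ∑ᶠ n, s2 n = expC (-((1 / 2 : ℂ) • ((a : ℂ) • w - (b : ℂ) • z))) *
      calE' (a + b) (z + w) U V := by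
    rw [calE', modeSum, mul_finsum]
    exact finsum_congr fun n => by rw [mul_smul_comm]
  -- When b = -a the geometric sum over the a central modes is ς(a(z+w))/ς(z+w), and aw - bz =
  -- a(z+w).
  have h3 : ∑ᶠ n, s3 n = sigma ((a : ℂ) • w - (b : ℂ) • z) *
      ((if a + b = 0 then (sigma (z + w))⁻¹ else 0) * Op.id m U V) := by
    by_cases hab : a + b = 0
    · obtain ⟨k, rfl⟩ : ∃ k : ℕ, a = k := ⟨a.toNat, by omega⟩
      have hb : b = -(k : ℤ) := by omega
      have hsv := sigma_ne_zero hv h0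
      rw [finsum_eq_sum_of_support_subset _ fs3, if_pos hab]
      have hIco : (Finset.Ico (-(k : ℤ)) 0) =
          (Finset.range k).image fun i : ℕ => (i : ℤ) - k := by
        ext n
        simp only [Finset.mem_Ico, Finset.mem_image, Finset.mem_range]
        constructor
        · rintro ⟨h5, h6⟩
          exact ⟨(n + k).toNat, by omega, by omega⟩
        · rintro ⟨i, h5, rfl⟩
          omega
      rw [hIco, Finset.sum_image (fun i _ j _ h => by simpa using h)]
      have h4 : ((k : ℤ) : ℂ) • w - (b : ℂ) • z = (k : ℂ) • (z + w) := by
        rw [hb]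
        push_cast
        module
      rw [h4, ← sum_modeCoeff k hv]
      have h5 : ∀ i ∈ Finset.range k, s3 ((i : ℤ) - k) = (Op.id m U V) *
          (modeCoeff (0 : ℤ) (z + w) (i : ℤ) * expC (-(((k : ℂ) / 2) • (z + w)))) := by
        intro i hi
        rw [Finset.mem_range] at hi
        simp only [hs3, if_pos hab]
        rw [if_pos (show (i : ℤ) - k < 0 by omega), sub_add_cancel,
          if_neg (show ¬ (i : ℤ) < 0 by omega), sub_zero, one_mul, Int.cast_natCast, Op.id]
        by_cases hUV : U = V
        · rw [if_pos hUV, hUV, Finsupp.single_eq_same, one_smul, one_mul]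
        · rw [if_neg hUV, Finsupp.single_eq_of_ne hUV, zero_smul, zero_mul]
      rw [Finset.sum_congr rfl h5, ← Finset.mul_sum]
      field_simp
      exact congrArg _ (Finset.sum_congr rfl fun _ _ => mul_comm _ _)
    · rw [if_neg hab, zero_mul, mul_zero]
      exact finsum_eq_zero_of_forall_eq_zero fun n => if_neg hab
  rw [Pi.sub_apply, Pi.sub_apply, e2', calE', calE', e1,
    ← finsum_sub_distrib (hsupp f1) (hsupp f2'), finsum_congr hterm,
    finsum_add_distrib ((g1.union g2).subset (Function.support_sub _ _)) g3,
    finsum_sub_distrib g1 g2, t1, t2, t3, h1, h2, h3, ← sub_mul, calE_eq]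
  exact (mul_add _ _ _).symm

/-- `[ℰ_a(z), ℰ_b(w)] = ς(a w - b z) ℰ_{a+b}(z + w)`. -/
theorem calE_commutator {a b : ℤ} (ha : 0 ≤ a) {z w : Coef m} (hz : IsSmall z) (hw : IsSmall w)
    (h0 : z + w ≠ 0) :
    (calE a z).comp (calE b w) - (calE b w).comp (calE a z) =
      sigma ((a : ℂ) • w - (b : ℂ) • z) • calE (a + b) (z + w) := by
  rw [← calE'_commutator ha hz hw h0, calE_eq a z, calE_eq b w]
  have hf : ∀ (r : ℤ) (x : Coef m) (V : Config), {T | calE' r x T V ≠ 0}.Finite := by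
    intro r x V
    have h := finite_calE_column r x V
    refine (h.union (Set.finite_singleton V)).subset fun T hT => ?_
    by_cases hTV : T = V
    · exact Or.inr hTV
    · refine Or.inl ?_
      rw [Set.mem_ofPred_eq, calE_eq, Pi.add_apply, Pi.add_apply, Pi.smul_apply, Pi.smul_apply,
        Op.id, if_neg hTV, smul_zero, add_zero]
      exact hT
  have hcE : ∀ (X : Op m) (r : ℤ) (x : Coef m), X.Composable (calE' r x) := fun X r x _ V =>
    formallySummable_of_finite ((hf r x V).subset fun _ hT => right_ne_zero_of_mul hT)
  have hcI : ∀ (X : Op m), X.Composable (Op.id m) := fun X U V =>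
    formallySummable_of_finite ((Set.finite_singleton V).subset fun T hT => by
      by_contra h
      exact right_ne_zero_of_mul hT (if_neg h))
  have hcS : ∀ (X : Op m) (c : Coef m), X.Composable (c • Op.id m) := fun X c U V => by
    simpa only [Pi.smul_apply, smul_eq_mul, mul_left_comm] using ((hcI X) U V).const_mul c
  set p := (if a = 0 then (sigma z)⁻¹ else 0)
  set q := (if b = 0 then (sigma w)⁻¹ else 0)
  -- The constant terms are multiples of the identity, so they contribute symmetrically to the two
  -- orders and cancel.
  have key : ∀ (X Y : Op m) (p q : Coef m), (∀ Z : Op m, Z.Composable X) →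
      (∀ Z : Op m, Z.Composable Y) →
      (X + p • Op.id m).comp (Y + q • Op.id m) =
        X.comp Y + q • X + p • Y + (p * q) • Op.id m := by
    intro X Y p q hX hY
    rw [Op.comp_add (hY _) (hcS _ _), Op.add_comp (hY _) (hY _), Op.add_comp (hcS _ _) (hcS _ _),
      Op.comp_smul (hcI _), Op.comp_id, Op.smul_comp (hY _), Op.id_comp, Op.smul_comp (hcS _ _),
      Op.id_comp, smul_smul]
    abel
  rw [key _ _ _ _ (fun Z => hcE Z _ _) (fun Z => hcE Z _ _),
    key _ _ _ _ (fun Z => hcE Z _ _) (fun Z => hcE Z _ _), mul_comm q p]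
  abel

/-! ### Power series of operators -/

theorem sum_antidiagonal_assoc {M : Type*} [AddCommMonoid M] (n : ℕ) (f : ℕ → ℕ → ℕ → M) :
    (∑ p ∈ Finset.HasAntidiagonal.antidiagonal n,
      ∑ q ∈ Finset.HasAntidiagonal.antidiagonal p.1, f q.1 q.2 p.2) =
    ∑ p ∈ Finset.HasAntidiagonal.antidiagonal n,
      ∑ q ∈ Finset.HasAntidiagonal.antidiagonal p.2, f p.1 q.1 q.2 := by
  rw [Finset.sum_sigma', Finset.sum_sigma']
  refine Finset.sum_nbij' (fun x => ⟨(x.2.1, x.2.2 + x.1.2), (x.2.2, x.1.2)⟩)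
    (fun x => ⟨(x.1.1 + x.2.1, x.2.2), (x.1.1, x.2.1)⟩) ?_ ?_ ?_ ?_ ?_
  · rintro ⟨⟨a, b⟩, ⟨c, d⟩⟩ h
    simp only [Finset.mem_sigma, Finset.HasAntidiagonal.mem_antidiagonal] at h ⊢
    exact ⟨by omega, trivial⟩
  · rintro ⟨⟨a, b⟩, ⟨c, d⟩⟩ h
    simp only [Finset.mem_sigma, Finset.HasAntidiagonal.mem_antidiagonal] at h ⊢
    exact ⟨by omega, trivial⟩
  · rintro ⟨⟨a, b⟩, ⟨c, d⟩⟩ h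
    simp only [Finset.mem_sigma, Finset.HasAntidiagonal.mem_antidiagonal] at h
    obtain ⟨h1, rfl⟩ := h
    rfl
  · rintro ⟨⟨a, b⟩, ⟨c, d⟩⟩ h
    simp only [Finset.mem_sigma, Finset.HasAntidiagonal.mem_antidiagonal] at h
    obtain ⟨h1, rfl⟩ := h
    rfl
  · rintro ⟨⟨a, b⟩, ⟨c, d⟩⟩ _
    rfl

theorem TOp.scale_scale (f g : PowerSeries (Coef m)) (A : TOp m) :
    TOp.scale (f * g) A = TOp.scale f (TOp.scale g A) := by
  ext1 n
  simp only [TOp.scale, PowerSeries.coeff_mul, Finset.sum_smul, Finset.smul_sum, smul_smul]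
  exact sum_antidiagonal_assoc n fun i j k =>
    (PowerSeries.coeff i f * PowerSeries.coeff j g) • A k

/-- Sums over an antidiagonal of which only the first term survives. -/
theorem sum_antidiagonal_zero_left {M : Type*} [AddCommMonoid M] (n : ℕ) (f : ℕ → ℕ → M)
    (h : ∀ i j, i ≠ 0 → f i j = 0) :
    (∑ p ∈ Finset.HasAntidiagonal.antidiagonal n, f p.1 p.2) = f 0 n := by
  rw [Finset.sum_eq_single (0, n)]
  · rintro ⟨i, j⟩ hp hne
    rw [Finset.HasAntidiagonal.mem_antidiagonal] at hp
    refine h _ _ fun h0 => hne ?_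
    simp only at h0 hp
    rw [Prod.mk.injEq]
    omega
  · intro h'
    exact absurd (Finset.HasAntidiagonal.mem_antidiagonal.2 (zero_add n)) h'

theorem sum_antidiagonal_zero_right {M : Type*} [AddCommMonoid M] (n : ℕ) (f : ℕ → ℕ → M)
    (h : ∀ i j, j ≠ 0 → f i j = 0) :
    (∑ p ∈ Finset.HasAntidiagonal.antidiagonal n, f p.1 p.2) = f n 0 := by
  rw [Finset.sum_eq_single (n, 0)]
  · rintro ⟨i, j⟩ hp hne
    rw [Finset.HasAntidiagonal.mem_antidiagonal] at hp
    refine h _ _ fun h0 => hne ?_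
    simp only at h0 hp
    rw [Prod.mk.injEq]
    omega
  · intro h'
    exact absurd (Finset.HasAntidiagonal.mem_antidiagonal.2 (add_zero n)) h'

theorem TOp.scale_C (c : Coef m) (A : TOp m) (n : ℕ) :
    TOp.scale (PowerSeries.C c) A n = c • A n := by
  rw [TOp.scale, sum_antidiagonal_zero_left n fun i j => PowerSeries.coeff i (PowerSeries.C c) • A j]
  · rw [PowerSeries.coeff_zero_C]
  · intro i j hi
    rw [PowerSeries.coeff_C, if_neg hi, zero_smul]

/-- Scaling by series in t is made a module structure so that the general rules for scalar
multiplication apply to power series of operators. -/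
instance moduleTOp (m : ℕ) : Module (PowerSeries (Coef m)) (TOp m) where
  smul := TOp.scale
  one_smul A := by
    ext1 n
    change TOp.scale 1 A n = A n
    rw [← map_one PowerSeries.C, TOp.scale_C, one_smul]
  mul_smul := TOp.scale_scale
  smul_zero f := by
    ext1 n
    change TOp.scale f 0 n = 0
    exact Finset.sum_eq_zero fun p _ => smul_zero _
  smul_add f A B := by
    ext1 n
    change TOp.scale f (A + B) n = TOp.scale f A n + TOp.scale f B n
    simp only [TOp.scale, Pi.add_apply A B, smul_add, Finset.sum_add_distrib]
  add_smul f g A := by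
    ext1 n
    change TOp.scale (f + g) A n = TOp.scale f A n + TOp.scale g A n
    simp only [TOp.scale, map_add, add_smul, Finset.sum_add_distrib]
  zero_smul A := by
    ext1 n
    change TOp.scale 0 A n = 0
    refine Finset.sum_eq_zero fun p _ => ?_
    rw [map_zero, zero_smul]

theorem TOp.scale_eq_smul (f : PowerSeries (Coef m)) (A : TOp m) : TOp.scale f A = f • A := rfl

theorem TOp.smul_apply (f : PowerSeries (Coef m)) (A : TOp m) (n : ℕ) :
    (f • A) n = ∑ p ∈ Finset.HasAntidiagonal.antidiagonal n, PowerSeries.coeff p.1 f • A p.2 := rfl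

theorem TOp.C_smul (c : Coef m) (A : TOp m) (n : ℕ) : (PowerSeries.C c • A) n = c • A n :=
  TOp.scale_C c A n

theorem TOp.X_pow_smul (k : ℕ) (A : TOp m) (n : ℕ) :
    ((PowerSeries.X ^ k : PowerSeries (Coef m)) • A) n = if k ≤ n then A (n - k) else 0 := by
  rw [TOp.smul_apply]
  split_ifs with h
  · rw [Finset.sum_eq_single (k, n - k)]
    · rw [PowerSeries.coeff_X_pow, if_pos rfl, one_smul]
    · rintro ⟨i, j⟩ hp hne
      rw [Finset.HasAntidiagonal.mem_antidiagonal] at hp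
      rw [PowerSeries.coeff_X_pow, if_neg, zero_smul]
      intro h0
      refine hne ?_
      simp only at h0 hp
      rw [Prod.mk.injEq]
      omega
    · intro h'
      exact absurd (Finset.HasAntidiagonal.mem_antidiagonal.2 (Nat.add_sub_cancel' h)) h'
  · refine Finset.sum_eq_zero fun p hp => ?_
    rw [Finset.HasAntidiagonal.mem_antidiagonal] at hp
    rw [PowerSeries.coeff_X_pow, if_neg (by omega), zero_smul]

/-- The scalar power series in `t` whose coefficients are bounded series. -/
def bddPowerSeries (m : ℕ) : Subring (PowerSeries (Coef m)) where
  carrier := {f | ∀ n, ∃ c, Bdd c (PowerSeries.coeff n f)}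
  zero_mem' n := ⟨0, by simpa using Bdd.zero 0⟩
  one_mem' n := ⟨0, by
    rw [PowerSeries.coeff_one]
    split_ifs
    · exact Bdd.one
    · exact Bdd.zero 0⟩
  add_mem' {f g} hf hg n := by
    obtain ⟨c, hc⟩ := hf n
    obtain ⟨d, hd⟩ := hg n
    refine ⟨c ⊓ d, ?_⟩
    rw [map_add]
    exact (hc.mono inf_le_left).add (hd.mono inf_le_right)
  neg_mem' {f} hf n := by
    obtain ⟨c, hc⟩ := hf n
    refine ⟨c, ?_⟩
    rw [map_neg]
    exact hc.neg
  mul_mem' {f g} hf hg n := by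
    choose c hc using hf
    choose d hd using hg
    -- Minus the sum of the absolute values is a common lower bound for the finitely many shifts in
    -- the Cauchy product.
    set e : Fin m → ℤ := fun i =>
      -∑ p ∈ Finset.HasAntidiagonal.antidiagonal n, |c p.1 i + d p.2 i|
    refine ⟨e, ?_⟩
    rw [PowerSeries.coeff_mul]
    refine Bdd.sum fun p hp => ((hc p.1).mul (hd p.2)).mono fun i => ?_
    have h1 := Finset.single_le_sum (f := fun p : ℕ × ℕ => |c p.1 i + d p.2 i|)
      (fun _ _ => abs_nonneg _) hp
    have h2 := neg_abs_le (c p.1 i + d p.2 i)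
    simp only [Pi.add_apply, e] at h1 h2 ⊢
    linarith

theorem X_mem_bddPowerSeries : PowerSeries.X ∈ bddPowerSeries m := fun n => by
  refine ⟨0, ?_⟩
  rw [PowerSeries.coeff_X]
  split_ifs
  · exact Bdd.one
  · exact Bdd.zero 0

/-- Power series of admissible operators. -/
def TAdm (a b : ℕ) (A : TOp m) : Prop := ∀ n, Adm a b (A n)

theorem TAdm.mono {a b a' b' : ℕ} {A : TOp m} (h : TAdm a b A) (ha : a' ≤ a) (hb : b ≤ b') :
    TAdm a' b' A := fun n => (h n).mono ha hb

theorem TAdm.add {a b : ℕ} {A B : TOp m} (hA : TAdm a b A) (hB : TAdm a b B) :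
    TAdm a b (A + B) := fun n => (hA n).add (hB n)

theorem TAdm.sum {a b : ℕ} {s : Finset κ} {A : κ → TOp m} (h : ∀ k ∈ s, TAdm a b (A k)) :
    TAdm a b (∑ k ∈ s, A k) :=
  Finset.sum_induction A (TAdm a b) (fun _ _ => TAdm.add) (fun _ => Adm.zero a b) h

theorem TAdm.smul {a b : ℕ} {A : TOp m} (h : TAdm a b A) {f : PowerSeries (Coef m)}
    (hf : f ∈ bddPowerSeries m) : TAdm a b (f • A) := fun _ =>
  Adm.sum fun p _ => (h p.2).smul_bdd (hf p.1).choose_spec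

theorem TAdm.const {a b : ℕ} {X : Op m} (h : Adm a b X) : TAdm a b (TOp.const X) := fun _ => by
  rw [TOp.const]
  split_ifs
  · exact h
  · exact Adm.zero a b

theorem TAdm.comp {a b a' b' : ℕ} {A B : TOp m} (hA : TAdm a b A) (hB : TAdm a' b' B)
    (h : b ≤ a') : TAdm a b' (A.comp B) := fun _ => Adm.sum fun p _ => (hA p.1).comp (hB p.2) h

theorem TAdm.composable {a b a' b' : ℕ} {A B : TOp m} (hA : TAdm a b A) (hB : TAdm a' b' B)
    (h : b < a') : A.Composable B := fun i j => (hA i).composable (hB j) h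

theorem Op.Composable.smul_right {X Y : Op m} (h : X.Composable Y) (c : Coef m) :
    X.Composable (c • Y) := fun U V => by
  have h1 : (fun T => X U T * (c • Y) T V) = fun T => c * (X U T * Y T V) := by
    ext1 T
    exact mul_left_comm _ c _
  rw [h1]
  exact (h U V).const_mul c

theorem Op.Composable.smul_left {X Y : Op m} (h : X.Composable Y) (c : Coef m) :
    (c • X).Composable Y := fun U V => by
  have h1 : (fun T => (c • X) U T * Y T V) = fun T => c * (X U T * Y T V) := by
    ext1 T
    exact mul_assoc c _ _
  rw [h1]
  exact (h U V).const_mul c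

theorem TOp.comp_assoc_of_forall {A B D : TOp m}
    (hl : ∀ i j k, ((A i).comp (B j)).Composable (D k))
    (hr : ∀ i j k, (A i).Composable ((B j).comp (D k)))
    (h : ∀ i j k, ((A i).comp (B j)).comp (D k) = (A i).comp ((B j).comp (D k))) :
    (A.comp B).comp D = A.comp (B.comp D) := by
  ext1 n
  have h1 : ∀ i j, (A.comp B i).comp (D j) =
      ∑ q ∈ Finset.HasAntidiagonal.antidiagonal i, ((A q.1).comp (B q.2)).comp (D j) :=
    fun i j => Op.sum_comp fun q _ => hl _ _ _
  have h2 : ∀ i j, (A i).comp (B.comp D j) =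
      ∑ q ∈ Finset.HasAntidiagonal.antidiagonal j, (A i).comp ((B q.1).comp (D q.2)) :=
    fun i j => Op.comp_sum fun q _ => hr _ _ _
  calc _ = ∑ p ∈ Finset.HasAntidiagonal.antidiagonal n,
        ∑ q ∈ Finset.HasAntidiagonal.antidiagonal p.1, ((A q.1).comp (B q.2)).comp (D p.2) :=
        Finset.sum_congr rfl fun p _ => h1 p.1 p.2
    _ = ∑ p ∈ Finset.HasAntidiagonal.antidiagonal n,
        ∑ q ∈ Finset.HasAntidiagonal.antidiagonal p.2, ((A p.1).comp (B q.1)).comp (D q.2) :=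
        sum_antidiagonal_assoc n fun i j k => ((A i).comp (B j)).comp (D k)
    _ = ∑ p ∈ Finset.HasAntidiagonal.antidiagonal n,
        ∑ q ∈ Finset.HasAntidiagonal.antidiagonal p.2, (A p.1).comp ((B q.1).comp (D q.2)) :=
        Finset.sum_congr rfl fun p _ => Finset.sum_congr rfl fun q _ => h _ _ _
    _ = _ := Finset.sum_congr rfl fun p _ => (h2 p.1 p.2).symm

theorem TAdm.comp_assoc {a b a' b' a'' b'' : ℕ} {A B D : TOp m} (hA : TAdm a b A)
    (hB : TAdm a' b' B) (hD : TAdm a'' b'' D) (h : b < a') (h' : b' < a'') :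
    (A.comp B).comp D = A.comp (B.comp D) :=
  TOp.comp_assoc_of_forall (fun i j k => ((hA i).comp (hB j) h.le).composable (hD k) h')
    (fun i j k => (hA i).composable ((hB j).comp (hD k) h'.le) h)
    fun i j k => (hA i).comp_assoc (hB j) (hD k) h h'

theorem TOp.comp_add {A B D : TOp m} (h : A.Composable B) (h' : A.Composable D) :
    A.comp (B + D) = A.comp B + A.comp D := by
  ext1 n
  rw [Pi.add_apply]
  simp only [TOp.comp]
  rw [← Finset.sum_add_distrib]
  exact Finset.sum_congr rfl fun p _ => Op.comp_add (h _ _) (h' _ _)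

theorem TOp.comp_smul {A B : TOp m} (h : A.Composable B) (f : PowerSeries (Coef m)) :
    A.comp (f • B) = f • A.comp B := by
  ext1 n
  rw [TOp.smul_apply, TOp.comp]
  have h1 : ∀ i j, (A i).comp ((f • B) j) = ∑ q ∈ Finset.HasAntidiagonal.antidiagonal j,
      PowerSeries.coeff q.1 f • (A i).comp (B q.2) := fun i j => by
    have hc : ∀ q ∈ Finset.HasAntidiagonal.antidiagonal j,
        (A i).Composable (PowerSeries.coeff q.1 f • B q.2) := fun q _ => (h i q.2).smul_right _
    rw [TOp.smul_apply, Op.comp_sum hc]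
    exact Finset.sum_congr rfl fun q _ => Op.comp_smul (h i q.2) (PowerSeries.coeff q.1 f)
  have h2 : ∀ i j, PowerSeries.coeff i f • A.comp B j =
      ∑ q ∈ Finset.HasAntidiagonal.antidiagonal j,
        PowerSeries.coeff i f • (A q.1).comp (B q.2) := fun i j => by
    rw [TOp.comp, Finset.smul_sum]
  calc _ = ∑ p ∈ Finset.HasAntidiagonal.antidiagonal n,
        ∑ q ∈ Finset.HasAntidiagonal.antidiagonal p.2,
          PowerSeries.coeff q.1 f • (A p.1).comp (B q.2) :=
        Finset.sum_congr rfl fun p _ => h1 p.1 p.2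
    _ = ∑ p ∈ Finset.HasAntidiagonal.antidiagonal n,
        ∑ q ∈ Finset.HasAntidiagonal.antidiagonal p.1,
          PowerSeries.coeff q.2 f • (A q.1).comp (B p.2) :=
        (sum_antidiagonal_assoc n fun i j k => PowerSeries.coeff j f • (A i).comp (B k)).symm
    _ = ∑ p ∈ Finset.HasAntidiagonal.antidiagonal n,
        ∑ q ∈ Finset.HasAntidiagonal.antidiagonal p.1,
          PowerSeries.coeff q.1 f • (A q.2).comp (B p.2) :=
        Finset.sum_congr rfl fun p _ => Finset.Nat.sum_antidiagonal_swap
          (f := fun q : ℕ × ℕ => PowerSeries.coeff q.1 f • (A q.2).comp (B p.2))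
    _ = ∑ p ∈ Finset.HasAntidiagonal.antidiagonal n,
        ∑ q ∈ Finset.HasAntidiagonal.antidiagonal p.2,
          PowerSeries.coeff p.1 f • (A q.1).comp (B q.2) :=
        sum_antidiagonal_assoc n fun j i k => PowerSeries.coeff j f • (A i).comp (B k)
    _ = _ := Finset.sum_congr rfl fun p _ => (h2 p.1 p.2).symm

theorem TOp.smul_comp {A B : TOp m} (h : A.Composable B) (f : PowerSeries (Coef m)) :
    (f • A).comp B = f • A.comp B := by
  ext1 n
  rw [TOp.smul_apply, TOp.comp]
  have h1 : ∀ i j, ((f • A) i).comp (B j) = ∑ q ∈ Finset.HasAntidiagonal.antidiagonal i,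
      PowerSeries.coeff q.1 f • (A q.2).comp (B j) := fun i j => by
    have hc : ∀ q ∈ Finset.HasAntidiagonal.antidiagonal i,
        (PowerSeries.coeff q.1 f • A q.2).Composable (B j) := fun q _ => (h q.2 j).smul_left _
    rw [TOp.smul_apply, Op.sum_comp hc]
    exact Finset.sum_congr rfl fun q _ => Op.smul_comp (h q.2 j) (PowerSeries.coeff q.1 f)
  have h2 : ∀ i j, PowerSeries.coeff i f • A.comp B j =
      ∑ q ∈ Finset.HasAntidiagonal.antidiagonal j,
        PowerSeries.coeff i f • (A q.1).comp (B q.2) := fun i j => by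
    rw [TOp.comp, Finset.smul_sum]
  calc _ = ∑ p ∈ Finset.HasAntidiagonal.antidiagonal n,
        ∑ q ∈ Finset.HasAntidiagonal.antidiagonal p.1,
          PowerSeries.coeff q.1 f • (A q.2).comp (B p.2) :=
        Finset.sum_congr rfl fun p _ => h1 p.1 p.2
    _ = ∑ p ∈ Finset.HasAntidiagonal.antidiagonal n,
        ∑ q ∈ Finset.HasAntidiagonal.antidiagonal p.2,
          PowerSeries.coeff p.1 f • (A q.1).comp (B q.2) :=
        sum_antidiagonal_assoc n fun i j k => PowerSeries.coeff i f • (A j).comp (B k)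
    _ = _ := Finset.sum_congr rfl fun p _ => (h2 p.1 p.2).symm

theorem TOp.comp_sum {A : TOp m} {s : Finset κ} {B : κ → TOp m}
    (h : ∀ k ∈ s, A.Composable (B k)) : A.comp (∑ k ∈ s, B k) = ∑ k ∈ s, A.comp (B k) := by
  ext1 n
  rw [Finset.sum_apply]
  simp only [TOp.comp, Finset.sum_apply]
  rw [Finset.sum_comm]
  exact Finset.sum_congr rfl fun p _ => Op.comp_sum fun k hk => h k hk _ _

theorem TOp.sum_comp {A : TOp m} {s : Finset κ} {B : κ → TOp m}
    (h : ∀ k ∈ s, (B k).Composable A) : (∑ k ∈ s, B k).comp A = ∑ k ∈ s, (B k).comp A := by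
  ext1 n
  rw [Finset.sum_apply]
  simp only [TOp.comp, Finset.sum_apply]
  rw [Finset.sum_comm]
  exact Finset.sum_congr rfl fun p _ => Op.sum_comp fun k hk => h k hk _ _

theorem TOp.const_comp (X : Op m) (A : TOp m) (n : ℕ) :
    (TOp.const X).comp A n = X.comp (A n) := by
  rw [TOp.comp, sum_antidiagonal_zero_left n fun i j => (TOp.const X i).comp (A j)]
  · rfl
  · intro i j hi
    rw [TOp.const, if_neg hi, Op.zero_comp]

theorem TOp.comp_const (X : Op m) (A : TOp m) (n : ℕ) :
    A.comp (TOp.const X) n = (A n).comp X := by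
  rw [TOp.comp, sum_antidiagonal_zero_right n fun i j => (A i).comp (TOp.const X j)]
  · rfl
  · intro i j hi
    rw [TOp.const, if_neg hi, Op.comp_zero]

theorem TOp.const_comp_const (X Y : Op m) :
    (TOp.const X).comp (TOp.const Y) = TOp.const (X.comp Y) := by
  ext1 n
  rw [TOp.const_comp, TOp.const, TOp.const]
  split_ifs
  · rfl
  · exact Op.comp_zero X

theorem TOp.id_comp (A : TOp m) : (TOp.const (Op.id m)).comp A = A := by
  ext1 n
  rw [TOp.const_comp, Op.id_comp]

theorem TOp.comp_id (A : TOp m) : A.comp (TOp.const (Op.id m)) = A := by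
  ext1 n
  rw [TOp.comp_const, Op.comp_id]

/-! ### The operators `A(z)` -/

/-- `1 / (t+1)_k` with complex coefficients. -/
def invPochSeries (k : ℤ) : PowerSeries ℂ :=
  if 0 ≤ k then (∏ i ∈ Finset.range k.toNat, (PowerSeries.X + ((i + 1 : ℕ) : PowerSeries ℂ)))⁻¹
  else ∏ i ∈ Finset.range (-k).toNat, (PowerSeries.X - ((i : ℕ) : PowerSeries ℂ))

/-- The symbol depends on c and t only through ct, and the substitution t ↦ ct is a ring
homomorphism that preserves invertibility of the denominators. -/
theorem coeff_invPochhammer (c : Coef m) (k : ℤ) (l : ℕ) :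
    PowerSeries.coeff l (invPochhammer (PowerSeries.C c * PowerSeries.X) k) =
      PowerSeries.coeff l (invPochSeries k) • c ^ l := by
  set φ : PowerSeries ℂ →+* PowerSeries (Coef m) :=
    (PowerSeries.rescale c).comp (PowerSeries.map (algebraMap ℂ (Coef m))) with hφ
  have hX : φ PowerSeries.X = PowerSeries.C c * PowerSeries.X := by
    rw [hφ, RingHom.comp_apply, PowerSeries.map_X, PowerSeries.rescale_X]
  have h : invPochhammer (PowerSeries.C c * PowerSeries.X) k = φ (invPochSeries k) := by
    rw [invPochhammer, invPochSeries]
    split_ifs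
    · set g : PowerSeries ℂ :=
        ∏ i ∈ Finset.range k.toNat, (PowerSeries.X + ((i + 1 : ℕ) : PowerSeries ℂ))
      have hg : φ g = ∏ i ∈ Finset.range k.toNat,
          (PowerSeries.C c * PowerSeries.X + ((i + 1 : ℕ) : PowerSeries (Coef m))) := by
        rw [map_prod]
        exact Finset.prod_congr rfl fun i _ => by rw [map_add, hX, map_natCast]
      have h0 : PowerSeries.constantCoeff g ≠ 0 := by
        rw [map_prod]
        refine Finset.prod_ne_zero_iff.2 fun i _ => ?_
        rw [map_add, PowerSeries.constantCoeff_X, zero_add, map_natCast]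
        exact Nat.cast_ne_zero.2 (Nat.succ_ne_zero i)
      have h1 : PowerSeries.constantCoeff (φ g) ≠ 0 := by
        rw [hg, map_prod]
        refine Finset.prod_ne_zero_iff.2 fun i _ => ?_
        rw [map_add, constantCoeff_C_mul_X, zero_add, map_natCast]
        exact Nat.cast_ne_zero.2 (Nat.succ_ne_zero i)
      rw [← hg]
      refine ((PowerSeries.eq_inv_iff_mul_eq_one h1).2 ?_).symm
      rw [← map_mul, PowerSeries.inv_mul_cancel _ h0, map_one]
    · rw [map_prod]
      exact Finset.prod_congr rfl fun i _ => by rw [map_sub, hX, map_natCast]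
  rw [h, hφ, RingHom.comp_apply, PowerSeries.coeff_rescale, PowerSeries.coeff_map, mul_comm,
    Algebra.smul_def]

theorem constantCoeff_invPochSeries_natCast (k : ℕ) :
    PowerSeries.coeff 0 (invPochSeries k) = (k.factorial : ℂ)⁻¹ := by
  rw [PowerSeries.coeff_zero_eq_constantCoeff_apply, invPochSeries, if_pos (Int.natCast_nonneg k),
    PowerSeries.constantCoeff_inv, map_prod, Int.toNat_natCast, ← Finset.prod_range_add_one_eq_factorial]
  push_cast
  congr 1
  refine Finset.prod_congr rfl fun i _ => ?_
  simp

theorem constantCoeff_invPochSeries_of_neg {k : ℤ} (hk : k < 0) :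
    PowerSeries.coeff 0 (invPochSeries k) = 0 := by
  rw [PowerSeries.coeff_zero_eq_constantCoeff_apply, invPochSeries, if_neg (not_le.2 hk), map_prod]
  refine Finset.prod_eq_zero (i := 0) (Finset.mem_range.2 (by omega)) ?_
  simp

/-- The coefficients in `t` of `∑_k ς(u)^k / (tc+1)_k ℰ_k(u)`. -/
def coreA (c u : Coef m) : TOp m := fun l U V =>
  PowerSeries.coeff l (invPochhammer (PowerSeries.C c * PowerSeries.X) (energy V - energy U)) *
    (sigma u ^ (energy V - energy U) * calE (energy V - energy U) u U V)

/-- `𝒮(u)^{tc} ∑_k ς(u)^k / (tc+1)_k ℰ_k(u)`; this is `A(u)` for `c = u`. -/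
def opAGen (c u : Coef m) : TOp m := powT c (calS u - 1) • coreA c u

/-- The operator ℰ_k lowers the energy by exactly k, so in each matrix entry only k = E(V) - E(U)
survives. -/
theorem opA_eq (z : Coef m) : opA z = opAGen z z := by
  rw [opA, opAGen, calSPow_eq, TOp.scale_eq_smul]
  congr 1
  ext n U V
  rw [finsum_eq_single _ (energy V - energy U)]
  · rfl
  · intro k hk
    have : calE k z U V = 0 := by
      by_contra h
      exact hk (energy_of_calE h).symm
    rw [this, mul_zero, mul_zero]

/-- `A^0(x) = ∑_{k ≥ 0} ς(x)^k / k! ℰ_k(x)`. -/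
def opA0 (x : Coef m) : Op m := fun U V =>
  if energy U ≤ energy V then
    (((energy V - energy U).toNat.factorial : ℂ)⁻¹ • sigma x ^ (energy V - energy U).toNat) *
      calE (energy V - energy U) x U V
  else 0

/-- At t = 0 the Pochhammer factors become 1/k! for k ≥ 0. For k < 0 they vanish, since the product
contains the factor tc. Thus the result does not depend on c. -/
theorem coreA_zero (c u : Coef m) : coreA c u 0 = opA0 u := by
  ext1 U
  ext1 V
  rw [coreA, opA0, coeff_invPochhammer, pow_zero]
  split_ifs with h
  · obtain ⟨k, hk⟩ := Int.eq_ofNat_of_zero_le (sub_nonneg.2 h)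
    rw [hk, constantCoeff_invPochSeries_natCast, Int.toNat_natCast, zpow_natCast, smul_mul_assoc,
      smul_mul_assoc, one_mul]
  · rw [constantCoeff_invPochSeries_of_neg (by linarith), zero_smul, zero_mul]

theorem opAGen_zero (c u : Coef m) : opAGen c u 0 = opA0 u := by
  rw [opAGen, TOp.smul_apply, Finset.HasAntidiagonal.antidiagonal_zero, Finset.sum_singleton,
    coreA_zero, powT, expT, PowerSeries.coeff_mk]
  simp

/-- Besides u, only the product tc enters, so the linear coefficient in t is proportional to c and
is compared with the case c = u. -/
theorem opAGen_one (c : Coef m) {u : Coef m} (hu : u ≠ 0) :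
    opAGen c u 1 = (c / u) • opA u 1 := by
  have h : ∀ c : Coef m, opAGen c u 1 = c • (logOnePlus (calS u - 1) • opA0 u + coreA 1 u 1) := by
    intro c
    have h1 : coreA c u 1 = c • coreA 1 u 1 := by
      ext1 U
      ext1 V
      rw [Pi.smul_apply, Pi.smul_apply, coreA, coreA, coeff_invPochhammer, coeff_invPochhammer,
        pow_one, one_pow, smul_eq_mul, smul_mul_assoc, smul_mul_assoc, one_mul, mul_smul_comm]
    rw [opAGen, TOp.smul_apply, Finset.Nat.sum_antidiagonal_succ,
      Finset.HasAntidiagonal.antidiagonal_zero, Finset.sum_singleton]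
    simp only [zero_add]
    rw [coreA_zero, h1, powT, expT, PowerSeries.coeff_mk, PowerSeries.coeff_mk]
    simp [smul_smul, add_comm]
  rw [opA_eq, h c, h u, smul_smul, div_mul_cancel₀ _ hu]

theorem stepFun_eq (k i : Fin m) (n : ℤ) : (if k ≤ i then n else 0) = stepFun (k + 1 : ℕ) i * n := by
  rw [stepFun, ite_mul, one_mul, zero_mul]
  exact if_congr (by rw [Fin.le_def]; omega) rfl rfl

/-- The exponentials involve no negative powers; the only pole is the simple one of 1/ς(u). -/
theorem bdd_calE {k : Fin m} {u : Coef m} (hu : IsLead k u) (r : ℤ) (U V : Config) :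
    Bdd (fun _ => -1) (calE r u U V) := by
  rw [calE]
  refine Bdd.add (Bdd.finsum fun n => ?_) ?_
  · refine Bdd.mono ((isOneUnit_expC (hu.isSmall.smul _)).bdd.smul _) fun i => ?_
    simp
  · split_ifs
    · have h := hu.sigma.bdd_zpow (-1)
      rw [zpow_neg_one] at h
      refine h.mono fun i => ?_
      simp only
      split_ifs <;> simp
    · exact Bdd.zero _

theorem bdd_coreA {k : Fin m} {c u : Coef m} (hc : Bdd 0 c) (hu : IsLead k u) (l : ℕ)
    (U V : Config) :
    Bdd (fun i => -1 + stepFun (k + 1 : ℕ) i * (energy V - energy U)) (coreA c u l U V) := by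
  rw [coreA, coeff_invPochhammer]
  have h1 := (hc.pow l).smul
    (PowerSeries.coeff l (invPochSeries (energy V - energy U)))
  refine (h1.mul ((hu.sigma.bdd_zpow _).mul (bdd_calE hu _ U V))).mono fun i => ?_
  simp only [Pi.add_apply, Pi.zero_apply, stepFun_eq]
  linarith

theorem tadm_coreA {k : Fin m} {c u : Coef m} (hc : Bdd 0 c) (hu : IsLead k u) :
    TAdm (k + 1) (k + 1) (coreA c u) := fun l => adm_of_level k.1.succ_pos k.2 fun U V => bdd_coreA hc hu l U V

theorem tadm_opAGen {k : Fin m} {c u : Coef m} (hc : Bdd 0 c) (hu : IsLead k u) :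
    TAdm (k + 1) (k + 1) (opAGen c u) :=
  (tadm_coreA hc hu).smul fun n => ⟨0, bdd_coeff_powT hc (isOneUnit_calS hu.isSmall hu.ne_zero) n⟩

theorem adm_opA0 {j : Fin m} {x : Coef m} (hx : IsLead j x) {a : ℕ} (ha : j < a) :
    Adm a a (opA0 x) := by
  refine adm_of_triangular j.1.succ_pos ha (C := 1) (fun U V => ?_) fun U V h => ?_
  · rw [← coreA_zero 0]
    exact bdd_coreA (Bdd.zero 0) hx 0 U V
  · by_contra hne
    exact h (if_neg hne)

/-- `[A^0(x), ∑_k ς(u)^k / (tc+1)_k ℰ_k(u)]`. -/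
theorem coreA_commutator {j k₀ : Fin m} {x c u : Coef m} (hx : IsLead j x) (hc : Bdd 0 c)
    (hu : IsLead k₀ u) (hjk : j < k₀) :
    (TOp.const (opA0 x)).comp (coreA c u) - (coreA c u).comp (TOp.const (opA0 x)) =
      (sigmaT (c * x) * powT c (sigma (x + u) / sigma u - 1)) • coreA c (x + u) := by
  classical
  have hxu := hx.add_left hu hjk
  ext1 l
  ext1 U
  ext1 V
  rw [Pi.sub_apply, TOp.const_comp, TOp.comp_const, Pi.sub_apply, Pi.sub_apply]
  set n := energy V - energy U with hn
  set g : ℕ → Coef m := fun k => ((k.factorial : ℂ)⁻¹ • sigma x ^ k) *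
    (PowerSeries.coeff l (invPochhammer (PowerSeries.C c * PowerSeries.X) (n - k)) *
      sigma u ^ (n - k)) with hg
  have hj : IsSmall x := hx.isSmall
  obtain ⟨s1, e1⟩ := ((adm_opA0 hx (Nat.lt_succ_self _)).composable (tadm_coreA hc hu l) (Nat.succ_lt_succ hjk) U V).formalSum_fiber
    fun T => energy T - energy U
  -- In this order A^0(x) stands on the right and is taken at level k₀ + 2, above the level k₀ + 1
  -- of the other factor; on the left it was taken at level j + 1. Both sums are sorted by the
  -- amount k by which A^0(x) lowers the energy.
  obtain ⟨s2, e2⟩ := (((tadm_coreA hc hu l).composable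
    (adm_opA0 hx (show (j : ℕ) < k₀ + 2 from (Nat.lt_succ_of_lt hjk).trans (Nat.lt_succ_self _)) : Adm (k₀ + 2) _ _) (Nat.lt_succ_self _)) U V).formalSum_fiber
    fun T => energy V - energy T
  have hinj : Function.Injective (fun k : ℕ => (k : ℤ)) := Nat.cast_injective
  have f1 : ∀ k : ℕ, (formalSum fun T => if energy T - energy U = (k : ℤ) then
      opA0 x U T * coreA c u l T V else 0) = g k * (calE k x).comp (calE (n - k) u) U V := by
    intro k
    rw [Op.comp, ← formalSum_const_mul (composable_calE _ _ _ U V)]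
    congr 1
    ext1 T
    split_ifs with h
    · have h' : energy V - energy T = n - k := by rw [hn]; linarith
      rw [opA0, if_pos (by linarith [Int.natCast_nonneg k]), h, Int.toNat_natCast, coreA, h']
      ring
    · have : calE k x U T = 0 := by
        by_contra h'
        exact h (energy_of_calE h')
      rw [this, zero_mul, mul_zero]
  have f2 : ∀ k : ℕ, (formalSum fun T => if energy V - energy T = (k : ℤ) then
      coreA c u l U T * opA0 x T V else 0) = g k * (calE (n - k) u).comp (calE k x) U V := by
    intro k
    rw [Op.comp, ← formalSum_const_mul (composable_calE _ _ _ U V)]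
    congr 1
    ext1 T
    split_ifs with h
    · have h' : energy T - energy U = n - k := by rw [hn]; linarith
      rw [opA0, if_pos (by linarith [Int.natCast_nonneg k]), h, Int.toNat_natCast, coreA, h']
      ring
    · have : calE k x T V = 0 := by
        by_contra h'
        exact h (energy_of_calE h')
      rw [this, mul_zero, mul_zero]
  have z1 : ∀ a ∉ Set.range (fun k : ℕ => (k : ℤ)), (formalSum fun T =>
      if energy T - energy U = a then opA0 x U T * coreA c u l T V else 0) = 0 := by
    intro a ha
    refine Eq.trans (congrArg _ (funext fun T => ?_)) (formalSum_zero (ι := Config))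
    split_ifs with h
    · have : ¬ energy U ≤ energy T := fun h' => ha ⟨a.toNat, Int.toNat_of_nonneg (by linarith)⟩
      rw [opA0, if_neg this, zero_mul]
    · rfl
  have z2 : ∀ a ∉ Set.range (fun k : ℕ => (k : ℤ)), (formalSum fun T =>
      if energy V - energy T = a then coreA c u l U T * opA0 x T V else 0) = 0 := by
    intro a ha
    refine Eq.trans (congrArg _ (funext fun T => ?_)) (formalSum_zero (ι := Config))
    split_ifs with h
    · have : ¬ energy T ≤ energy V := fun h' => ha ⟨a.toNat, Int.toNat_of_nonneg (by linarith)⟩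
      rw [opA0, if_neg this, mul_zero]
    · rfl
  have q1 := formalSum_comp hinj z1
  have q2 := formalSum_comp hinj z2
  have t1 := s1.comp_injective hinj
  have t2 := s2.comp_injective hinj
  simp only [Function.comp_def, f1] at q1 t1
  simp only [Function.comp_def, f2] at q2 t2
  -- For each k the commutator is a scalar times the same operator ℰ_n(x+u), so that only a scalar
  -- series in k remains to be summed.
  have hcomm : ∀ k : ℕ, g k * (calE k x).comp (calE (n - k) u) U V -
      g k * (calE (n - k) u).comp (calE k x) U V =
      (g k * sigma ((k : ℂ) • u - ((n - k : ℤ) : ℂ) • x)) * calE n (x + u) U V := by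
    intro k
    have h := congrFun (congrFun (calE_commutator (b := n - k) (Int.natCast_nonneg k) hx.isSmall
      hu.isSmall hxu.ne_zero) U) V
    rw [Pi.sub_apply, Pi.sub_apply, Pi.smul_apply, Pi.smul_apply, smul_eq_mul, Int.cast_natCast,
      add_sub_cancel] at h
    rw [← mul_sub, h, mul_assoc (g k)]
  obtain ⟨h1, h2⟩ := hasFormalSum_commutator hx hu hjk c n l
  have hL : (opA0 x).comp (coreA c u l) U V - (coreA c u l).comp (opA0 x) U V =
      formalSum (fun k => g k * sigma ((k : ℂ) • u - ((n - k : ℤ) : ℂ) • x)) *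
        calE n (x + u) U V := by
    rw [Op.comp, Op.comp, ← e1, ← e2, ← q1, ← q2, ← formalSum_sub t1 t2, ← formalSum_mul_const h1]
    exact congrArg _ (funext hcomm)
  rw [hL, h2, TOp.smul_apply, PowerSeries.coeff_mul, Finset.sum_mul, Finset.sum_mul,
    Finset.sum_apply, Finset.sum_apply]
  refine Finset.sum_congr rfl fun p _ => ?_
  rw [Pi.smul_apply, Pi.smul_apply, smul_eq_mul, coreA]
  ring

/-- `[A^0(x), 𝒮(u)^{tc} ∑_k ς(u)^k / (tc+1)_k ℰ_k(u)]`. -/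
theorem opAGen_commutator {j k₀ : Fin m} {x c u : Coef m} (hx : IsLead j x) (hc : Bdd 0 c)
    (hu : IsLead k₀ u) (hjk : j < k₀) :
    (TOp.const (opA0 x)).comp (opAGen c u) - (opAGen c u).comp (TOp.const (opA0 x)) =
      (sigmaT (c * x) * powT c (x / u)) • opAGen c (x + u) := by
  have hxu := hx.add_left hu hjk
  have hA : Adm (k₀ + 2) (k₀ + 2) (opA0 x) := adm_opA0 hx (show (j : ℕ) < k₀ + 2 from (Nat.lt_succ_of_lt hjk).trans (Nat.lt_succ_self _))
  have hSu := isOneUnit_calS hu.isSmall hu.ne_zero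
  have hSxu := isOneUnit_calS hxu.isSmall hxu.ne_zero
  have h0 := sigma_ne_zero hu.isSmall hu.ne_zero
  -- This is the power tc of 𝒮(u) ς(x+u)/ς(u) = (1 + x/u) 𝒮(x+u). It restores the prefactor
  -- 𝒮(x+u)^{tc} of the new operator and leaves (1 + x/u)^{tc}.
  have hp : powT c (calS u - 1) * powT c (sigma (x + u) / sigma u - 1) =
      powT c (x / u) * powT c (calS (x + u) - 1) := by
    have h1 : x / u = (x + u) / u - 1 := by
      rw [add_div, div_self hu.ne_zero, add_sub_cancel_right]
    rw [h1, ← powT_mul c hSu (hxu.sigma.isOneUnit_div hu.sigma),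
      ← powT_mul c (hxu.isOneUnit_div hu) hSxu]
    congr 2
    rw [calS, calS]
    have := hu.ne_zero
    have := hxu.ne_zero
    field_simp
  rw [opAGen, TOp.comp_smul ((TAdm.const (adm_opA0 hx (Nat.lt_succ_self _))).composable (tadm_coreA hc hu) (Nat.succ_lt_succ hjk)),
    TOp.smul_comp ((tadm_coreA hc hu).composable (TAdm.const hA) (Nat.lt_succ_self _)), ← smul_sub,
    coreA_commutator hx hc hu hjk, opAGen, smul_smul, smul_smul]
  congr 1
  linear_combination sigmaT (c * x) * hp

/-! ### Conjugation by `e^{α_1}` -/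

theorem adm_calE {r : ℕ} {z : Coef m} {C : ℤ} (h : ∀ U V, Bdd (fun _ => -C) (calE r z U V))
    {a : ℕ} (ha : 0 < a) : Adm a a (calE r z) := by
  refine adm_of_triangular ha le_rfl (C := C + r) (fun U V => ?_) fun U V h0 => ?_
  · by_cases h0 : calE r z U V = 0
    · rw [h0]
      exact Bdd.zero _
    · refine (h U V).mono fun i => ?_
      have h1 : stepFun a i * (r : ℤ) ≤ r := by
        rw [stepFun]
        split_ifs <;> simp
      simp only [energy_of_calE h0]
      linarith
  · have := energy_of_calE h0
    linarith [Int.natCast_nonneg r]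

theorem bdd_alpha (U V : Config) : Bdd 0 (alpha m 1 U V) := by
  rw [alpha, calE, if_neg (fun h => one_ne_zero h.1), add_zero]
  exact Bdd.finsum fun n => (isOneUnit_expC (IsSmall.zero.smul _)).bdd.smul _

theorem adm_alpha {a : ℕ} (ha : 0 < a) : Adm a a (alpha m 1) :=
  adm_calE (r := 1) (C := 0) (fun U V => by
    rw [neg_zero]
    exact bdd_alpha U V) ha

/-- `α_1^n / n!`. -/
def alphaPow (m n : ℕ) : Op m :=
  algebraMap ℂ (Coef m) (n.factorial : ℂ)⁻¹ • Op.prod (List.replicate n (alpha m 1))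

theorem alphaPow_zero : alphaPow m 0 = Op.id m := by
  simp [alphaPow, Op.prod]

theorem succ_smul_alphaPow (n : ℕ) :
    ((n + 1 : ℕ) : Coef m) • alphaPow m (n + 1) =
      algebraMap ℂ (Coef m) (n.factorial : ℂ)⁻¹ •
        (alpha m 1).comp (Op.prod (List.replicate n (alpha m 1))) := by
  rw [alphaPow, smul_smul, List.replicate_succ, Op.prod]
  congr 1
  rw [← map_natCast (algebraMap ℂ (Coef m)), ← map_mul]
  congr 1
  have : ((n + 1 : ℕ) : ℂ) ≠ 0 := Nat.cast_ne_zero.2 n.succ_ne_zero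
  rw [Nat.factorial_succ, Nat.cast_mul, mul_inv, mul_inv_cancel_left₀ this]

theorem Op.comp_entry_ne_zero {X Y : Op m} {U V : Config} (h : X.comp Y U V ≠ 0) :
    ∃ T, X U T ≠ 0 ∧ Y T V ≠ 0 := by
  by_contra hne
  have h0 : (fun T => X U T * Y T V) = fun _ => 0 := funext fun T => by
    by_contra h'
    exact hne ⟨T, left_ne_zero_of_mul h', right_ne_zero_of_mul h'⟩
  rw [Op.comp, h0] at h
  exact h formalSum_zero

theorem energy_of_prod_alpha {n : ℕ} {U V : Config}
    (h : Op.prod (List.replicate n (alpha m 1)) U V ≠ 0) : energy V - energy U = n := by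
  induction n generalizing U with
  | zero =>
    rw [List.replicate_zero, Op.prod, Op.id] at h
    rw [show U = V from by_contra fun h' => h (if_neg h')]
    simp
  | succ n ih =>
    obtain ⟨T, h1, h2⟩ := Op.comp_entry_ne_zero h
    have := energy_of_calE h1
    have := ih h2
    push_cast
    linarith

theorem energy_of_alphaPow {n : ℕ} {U V : Config} (h : alphaPow m n U V ≠ 0) :
    energy V - energy U = n :=
  energy_of_prod_alpha (right_ne_zero_of_mul h)

/-- Each α_1 lowers the energy by 1, so only the power n = E(V) - E(U) contributes to an entry. -/
theorem expAlpha1_apply (U V : Config) :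
    expAlpha1 m U V = if energy U ≤ energy V then
      alphaPow m (energy V - energy U).toNat U V else 0 := by
  have hsmul : ∀ n : ℕ, alphaPow m n U V =
      (n.factorial : ℂ)⁻¹ • Op.prod (List.replicate n (alpha m 1)) U V := fun n => by
    rw [alphaPow, Pi.smul_apply, Pi.smul_apply, smul_eq_mul, Algebra.smul_def]
  rw [expAlpha1]
  split_ifs with h
  · rw [finsum_eq_single _ (energy V - energy U).toNat, hsmul]
    intro n hn
    rw [← hsmul]
    by_contra h'
    have := energy_of_alphaPow h'
    omega
  · refine finsum_eq_zero_of_forall_eq_zero fun n => ?_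
    rw [← hsmul]
    by_contra h'
    have := energy_of_alphaPow h'
    omega

theorem adm_prod_alpha (n : ℕ) {a : ℕ} (ha : 0 < a) : Adm a a (Op.prod (List.replicate n (alpha m 1))) := by
  induction n with
  | zero => exact adm_id a
  | succ n ih => exact (adm_alpha ha).comp ih le_rfl

theorem bdd_algebraMap (c : ℂ) : Bdd 0 (algebraMap ℂ (Coef m) c) := by
  rw [Algebra.algebraMap_eq_smul_one]
  exact Bdd.one.smul c

theorem adm_alphaPow (n : ℕ) {a : ℕ} (ha : 0 < a) : Adm a a (alphaPow m n) :=
  (adm_prod_alpha n ha).smul_bdd (bdd_algebraMap _)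

theorem bdd_prod_alpha (n : ℕ) (U V : Config) :
    Bdd 0 (Op.prod (List.replicate n (alpha m 1)) U V) := by
  induction n generalizing U with
  | zero =>
    rw [List.replicate_zero, Op.prod, Op.id]
    split_ifs
    · exact Bdd.one
    · exact Bdd.zero 0
  | succ n ih => exact Bdd.formalSum fun T => (bdd_alpha U T).mul₀ (ih T)

/-- The entries are bounded by 0 without any gain in the variables, so the operator fits only the
levels above those of all variables. -/
theorem adm_expAlpha1 {a : ℕ} (ha : m < a) : Adm a a (expAlpha1 m) := by
  refine adm_of_triangular m.succ_pos ha (C := 0) (fun U V => ?_) fun U V h => ?_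
  · have h1 : Bdd 0 (expAlpha1 m U V) := by
      rw [expAlpha1_apply]
      split_ifs
      · exact (bdd_algebraMap _).mul₀ (bdd_prod_alpha _ U V)
      · exact Bdd.zero 0
    refine h1.mono fun i => ?_
    rw [stepFun, if_neg (by omega)]
    simp
  · by_contra hne
    exact h (by rw [expAlpha1_apply, if_neg hne])

theorem finite_column_of_energy {X : Op m} {n : ℕ} (h : ∀ U V, X U V ≠ 0 → energy V - energy U = n)
    (V : Config) : {T | X T V ≠ 0}.Finite := by
  refine (finite_energy_le (energy V)).subset fun T hT => ?_
  have := h T V hT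
  simp only [Set.mem_ofPred_eq]
  omega

theorem composable_of_energy {X : Op m} {n : ℕ} (h : ∀ U V, X U V ≠ 0 → energy V - energy U = n)
    (Y : Op m) : Y.Composable X := fun _ V =>
  formallySummable_of_finite ((finite_column_of_energy h V).subset fun _ hT =>
    right_ne_zero_of_mul hT)

/-- `ς(z)^k / k! ℰ_k(z)`. -/
def scaledE (z : Coef m) (k : ℕ) : Op m :=
  (algebraMap ℂ (Coef m) (k.factorial : ℂ)⁻¹ * sigma z ^ k) • calE k z

theorem energy_of_scaledE {z : Coef m} {k : ℕ} {U V : Config} (h : scaledE z k U V ≠ 0) :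
    energy V - energy U = k := energy_of_calE (right_ne_zero_of_mul h)

theorem opA0_apply (z : Coef m) (U V : Config) :
    opA0 z U V = if energy U ≤ energy V then scaledE z (energy V - energy U).toNat U V else 0 := by
  rw [opA0]
  split_ifs with h
  · rw [scaledE, Pi.smul_apply, Pi.smul_apply, smul_eq_mul, Algebra.smul_def,
      Int.toNat_of_nonneg (sub_nonneg.2 h)]
  · rfl

theorem adm_scaledE {k : Fin m} {z : Coef m} (hz : IsLead k z) (n : ℕ) {a : ℕ} (ha : 0 < a) :
    Adm a a (scaledE z n) :=
  (adm_calE (fun U V => bdd_calE hz n U V) ha).smul_bdd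
    ((bdd_algebraMap _).mul₀ ((isSmall_sigma hz.isSmall).bdd.pow n))

/-- From [α_1, ℰ_j(z)] = ς(z) ℰ_{j+1}(z); the normalization ς^j/j! turns the coefficient into j + 1,
as for divided powers of the adjoint action. -/
theorem alpha_comp_scaledE {k : Fin m} {z : Coef m} (hz : IsLead k z) (j : ℕ) :
    (alpha m 1).comp (scaledE z j) = (scaledE z j).comp (alpha m 1) +
      ((j + 1 : ℕ) : Coef m) • scaledE z (j + 1) := by
  have h := calE_commutator (a := 1) (b := j) zero_le_one IsSmall.zero hz.isSmall
    (by rw [zero_add]; exact hz.ne_zero)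
  rw [smul_zero, sub_zero, Int.cast_one, one_smul, zero_add, sub_eq_iff_eq_add'] at h
  have hj : (1 : ℤ) + j = ((j + 1 : ℕ) : ℤ) := by
    push_cast
    ring
  rw [scaledE, Op.comp_smul (composable_calE _ _ _), alpha, h, hj, Op.smul_comp (composable_calE _ _ _),
    smul_add, scaledE, smul_smul, smul_smul]
  congr 2
  have h1 : (((j + 1 : ℕ)) : ℂ) ≠ 0 := Nat.cast_ne_zero.2 j.succ_ne_zero
  have h2 : algebraMap ℂ (Coef m) (j.factorial : ℂ)⁻¹ =
      ((j + 1 : ℕ) : Coef m) * algebraMap ℂ (Coef m) ((j + 1).factorial : ℂ)⁻¹ := by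
    rw [← map_natCast (algebraMap ℂ (Coef m)), ← map_mul, Nat.factorial_succ, Nat.cast_mul, mul_inv,
      mul_inv_cancel_left₀ h1]
  rw [h2, pow_succ]
  push_cast
  ring

/-- The Leibniz rule in divided powers: α_1^n/n! is moved to the right of ℰ_0, and p of its factors
are used up in commutators. The induction multiplies by α_1 once more and divides by n + 1. -/
theorem alphaPow_comp_calE {k : Fin m} {z : Coef m} (hz : IsLead k z) (n : ℕ) :
    (alphaPow m n).comp (calE 0 z) = ∑ p ∈ Finset.HasAntidiagonal.antidiagonal n,
      (scaledE z p.1).comp (alphaPow m p.2) := by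
  have hE : ∀ {a}, 0 < a → Adm a a (calE 0 z) := fun ha =>
    adm_calE (r := 0) (fun U V => bdd_calE hz 0 U V) ha
  have hA : ∀ X : Op m, X.Composable (alpha m 1) := fun X => composable_calE X 1 0
  have hP : ∀ (X : Op m) n, X.Composable (alphaPow m n) := fun X n =>
    composable_of_energy (fun _ _ => energy_of_alphaPow) X
  have hD : ∀ (X : Op m) n, X.Composable (scaledE z n) := fun X n =>
    composable_of_energy (fun _ _ => energy_of_scaledE) X
  have hsucc : ∀ n, ((n + 1 : ℕ) : Coef m) • alphaPow m (n + 1) =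
      (alpha m 1).comp (alphaPow m n) := fun n => by
    rw [succ_smul_alphaPow, alphaPow,
      Op.comp_smul ((adm_alpha one_pos).composable (adm_prod_alpha n two_pos) one_lt_two)]
  induction n with
  | zero =>
    rw [Finset.HasAntidiagonal.antidiagonal_zero, Finset.sum_singleton, alphaPow_zero, Op.comp_id,
      Op.id_comp, scaledE]
    simp
  | succ n ih =>
    have hn : ((n + 1 : ℕ) : Coef m) ≠ 0 := Nat.cast_ne_zero.2 n.succ_ne_zero
    set G : ℕ × ℕ → Op m := fun p => (scaledE z p.1).comp (alphaPow m p.2) with hG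
    have hstep : ∀ p : ℕ × ℕ, (alpha m 1).comp (G p) =
        ((p.2 + 1 : ℕ) : Coef m) • G (p.1, p.2 + 1) +
          ((p.1 + 1 : ℕ) : Coef m) • G (p.1 + 1, p.2) := by
      intro p
      -- All factors here are admissible at every positive level, so 1, 2 and 3 are chosen to
      -- increase along the product.
      rw [hG, ← (adm_alpha one_pos).comp_assoc (adm_scaledE hz p.1 two_pos) (adm_alphaPow p.2 (Nat.succ_pos 2)) one_lt_two
        (Nat.lt_succ_self 2), alpha_comp_scaledE hz, Op.add_comp (hP _ _) (hP _ _),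
        (adm_scaledE hz p.1 one_pos).comp_assoc (adm_alpha two_pos) (adm_alphaPow p.2 (Nat.succ_pos 2)) one_lt_two (Nat.lt_succ_self 2),
        ← hsucc, Op.comp_smul (hP _ _), Op.smul_comp (hP _ _)]
    have hl : ((n + 1 : ℕ) : Coef m) • (alphaPow m (n + 1)).comp (calE 0 z) =
        ∑ p ∈ Finset.HasAntidiagonal.antidiagonal n, (alpha m 1).comp (G p) := by
      rw [← Op.smul_comp (composable_calE _ _ _), hsucc,
        (adm_alpha one_pos).comp_assoc (adm_alphaPow n two_pos) (hE (Nat.succ_pos 2)) one_lt_two (Nat.lt_succ_self 2), ih]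
      exact Op.comp_sum fun p _ => (adm_alpha one_pos).composable
        ((adm_scaledE hz p.1 two_pos).comp (adm_alphaPow p.2 two_pos) le_rfl) one_lt_two
    -- On the antidiagonal n + 1 is the sum of the two indices; the two resulting sums match, after
    -- shifting an index, the two terms produced by commuting α_1.
    have hr : ((n + 1 : ℕ) : Coef m) • ∑ p ∈ Finset.HasAntidiagonal.antidiagonal (n + 1), G p =
        (∑ p ∈ Finset.HasAntidiagonal.antidiagonal (n + 1), ((p.1 : ℕ) : Coef m) • G p) +
          ∑ p ∈ Finset.HasAntidiagonal.antidiagonal (n + 1), ((p.2 : ℕ) : Coef m) • G p := by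
      rw [← Finset.sum_add_distrib, Finset.smul_sum]
      refine Finset.sum_congr rfl fun p hp => ?_
      rw [← (Finset.HasAntidiagonal.mem_antidiagonal.1 hp : p.1 + p.2 = n + 1), Nat.cast_add,
        add_smul]
    have h : ((n + 1 : ℕ) : Coef m) • (alphaPow m (n + 1)).comp (calE 0 z) =
        ((n + 1 : ℕ) : Coef m) • ∑ p ∈ Finset.HasAntidiagonal.antidiagonal (n + 1), G p := by
      rw [hl, hr, Finset.Nat.sum_antidiagonal_succ (f := fun p => ((p.1 : ℕ) : Coef m) • G p),
        Finset.Nat.sum_antidiagonal_succ' (f := fun p => ((p.2 : ℕ) : Coef m) • G p)]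
      simp only [Nat.cast_zero, zero_smul, zero_add]
      rw [add_comm, ← Finset.sum_add_distrib]
      exact Finset.sum_congr rfl fun p _ => hstep p
    have h2 := congrArg (fun X => ((n + 1 : ℕ) : Coef m)⁻¹ • X) h
    simpa only [smul_smul, inv_mul_cancel₀ hn, one_smul] using h2

/-- `e^{α_1} ℰ_0(z) = A^0(z) e^{α_1}`. -/
theorem expAlpha1_comp_calE {k : Fin m} {z : Coef m} (hz : IsLead k z) :
    (expAlpha1 m).comp (calE 0 z) = (opA0 z).comp (expAlpha1 m) := by
  ext1 U
  ext1 V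
  by_cases h : energy U ≤ energy V
  -- Since ℰ_0 preserves the energy, a single power of α_1 contributes for given U and V.
  · have h1 : (expAlpha1 m).comp (calE 0 z) U V =
        (alphaPow m (energy V - energy U).toNat).comp (calE 0 z) U V := by
      rw [Op.comp, Op.comp]
      congr 1
      ext1 T
      by_cases hT : calE 0 z T V = 0
      · rw [hT, mul_zero, mul_zero]
      · have h2 : energy T = energy V := by
          have := energy_of_calE hT
          linarith
        rw [expAlpha1_apply, h2, if_pos h]
    rw [h1, alphaPow_comp_calE hz, Finset.sum_apply, Finset.sum_apply]
    have hs := formalSum_finset_sum (Finset.HasAntidiagonal.antidiagonal (energy V - energy U).toNat)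
      (f := fun p T => scaledE z p.1 U T * alphaPow m p.2 T V) fun p _ =>
        composable_of_energy (fun _ _ => energy_of_alphaPow) _ U V
    refine hs.2.symm.trans (congrArg _ (funext fun T => ?_))
    by_cases hT : energy U ≤ energy T ∧ energy T ≤ energy V
    · rw [opA0_apply, expAlpha1_apply, if_pos hT.1, if_pos hT.2, Finset.sum_eq_single
        ((energy T - energy U).toNat, (energy V - energy T).toNat)]
      · rintro ⟨a, b⟩ - hne
        by_contra h0
        have e1 := energy_of_scaledE (left_ne_zero_of_mul h0)
        have e2 := energy_of_alphaPow (right_ne_zero_of_mul h0)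
        refine hne ?_
        simp only at e1 e2
        rw [e1, e2, Int.toNat_natCast, Int.toNat_natCast]
      · intro hp
        refine absurd (Finset.HasAntidiagonal.mem_antidiagonal.2 ?_) hp
        simp only
        omega
    · rw [Finset.sum_eq_zero]
      · by_cases hT1 : energy U ≤ energy T
        · rw [expAlpha1_apply, if_neg (fun h' => hT ⟨hT1, h'⟩), mul_zero]
        · rw [opA0_apply, if_neg hT1, zero_mul]
      · rintro ⟨a, b⟩ -
        by_contra h0
        have e1 := energy_of_scaledE (left_ne_zero_of_mul h0)
        have e2 := energy_of_alphaPow (right_ne_zero_of_mul h0)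
        exact hT ⟨by linarith [Int.natCast_nonneg a], by linarith [Int.natCast_nonneg b]⟩
  · have h1 : (expAlpha1 m).comp (calE 0 z) U V = 0 := by
      by_contra h0
      obtain ⟨T, e1, e2⟩ := Op.comp_entry_ne_zero h0
      have := energy_of_calE e2
      rw [expAlpha1_apply, if_neg (fun h' => h (by linarith))] at e1
      exact e1 rfl
    have h2 : (opA0 z).comp (expAlpha1 m) U V = 0 := by
      by_contra h0
      obtain ⟨T, e1, e2⟩ := Op.comp_entry_ne_zero h0
      rw [opA0_apply] at e1
      rw [expAlpha1_apply] at e2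
      split_ifs at e1 e2 with h3 h4
      · exact h (h3.trans h4)
      · exact e2 rfl
      · exact e1 rfl
      · exact e1 rfl
    rw [h1, h2]

/-! ### Set partitions -/

/-- The blocks of a set partition with their maximal elements, in increasing order of these. -/
def partitionCode {S : Finset (Fin m)} (π : Finpartition S) : List (Finset (Fin m) × Fin m) :=
  (blockMaxima π).map fun k => (π.part k, k)

theorem mem_blockMaxima {S : Finset (Fin m)} (π : Finpartition S) {k : Fin m} :
    k ∈ blockMaxima π ↔ k ∈ S ∧ ∀ j ∈ π.part k, j ≤ k := by
  simp [blockMaxima]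

theorem pairwise_blockMaxima {S : Finset (Fin m)} (π : Finpartition S) :
    (blockMaxima π).Pairwise (· < ·) :=
  (List.sortedLT_finRange m).pairwise.filter _

/-- Sending a maximum to its block is a bijection onto the blocks. -/
theorem length_blockMaxima {S : Finset (Fin m)} (π : Finpartition S) :
    (blockMaxima π).length = π.parts.card := by
  have hn : (blockMaxima π).Nodup := (pairwise_blockMaxima π).imp fun h => h.ne
  rw [← List.toFinset_card_of_nodup hn]
  refine Finset.card_bij (fun k _ => π.part k) ?_ ?_ ?_
  · intro k hk
    rw [List.mem_toFinset, mem_blockMaxima] at hk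
    exact π.part_mem.2 hk.1
  · intro k hk l hl h
    rw [List.mem_toFinset, mem_blockMaxima] at hk hl
    refine le_antisymm (hl.2 k ?_) (hk.2 l ?_)
    · rw [← h]
      exact π.mem_part_self.2 hk.1
    · rw [h]
      exact π.mem_part_self.2 hl.1
  · intro P hP
    have hne := π.nonempty_of_mem_parts hP
    have hmem := P.max'_mem hne
    have hpart := π.part_eq_of_mem hP hmem
    refine ⟨P.max' hne, ?_, hpart⟩
    rw [List.mem_toFinset, mem_blockMaxima, hpart]
    exact ⟨π.subset hP hmem, fun j hj => P.le_max' j hj⟩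

theorem length_partitionCode {S : Finset (Fin m)} (π : Finpartition S) :
    (partitionCode π).length = π.parts.card := by
  rw [partitionCode, List.length_map, length_blockMaxima]

theorem mem_partitionCode {S : Finset (Fin m)} {π : Finpartition S}
    {p : Finset (Fin m) × Fin m} (hp : p ∈ partitionCode π) :
    p.1 ⊆ S ∧ p.2 ∈ p.1 ∧ ∀ j ∈ p.1, j ≤ p.2 := by
  rw [partitionCode, List.mem_map] at hp
  obtain ⟨k, hk, rfl⟩ := hp
  rw [mem_blockMaxima] at hk
  exact ⟨π.part_subset k, π.mem_part_self.2 hk.1, hk.2⟩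

theorem pairwise_partitionCode {S : Finset (Fin m)} (π : Finpartition S) :
    (partitionCode π).Pairwise fun p q => p.2 < q.2 :=
  List.pairwise_map.2 (pairwise_blockMaxima π)

theorem sum_finpartition_empty {M : Type*} [AddCommMonoid M]
    (h : List (Finset (Fin m) × Fin m) → M) :
    ∑ π : Finpartition (∅ : Finset (Fin m)), h (partitionCode π) = h [] := by
  have hc : ∀ π : Finpartition (∅ : Finset (Fin m)), partitionCode π = [] := by
    intro π
    rw [← List.length_eq_zero_iff, length_partitionCode, Finset.card_eq_zero]
    exact π.parts_eq_empty_iff.2 rfl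
  rw [Finset.sum_congr rfl fun π _ => by rw [hc π]]
  have : Fintype.card (Finpartition (∅ : Finset (Fin m))) = 1 :=
    Fintype.card_eq_one_iff.2 ⟨Finpartition.empty _, fun π => by
      ext1
      rw [π.parts_eq_empty_iff.2 rfl]
      rfl⟩
  rw [Finset.sum_const, Finset.card_univ, this, one_smul]

section Extend

variable {k : Fin m} {R Q : Finset (Fin m)}

/-- Adding the block `Q ∪ {k}` to a partition of `R \ Q`. -/
def extendPartition (hk : ∀ j ∈ R, j < k) (hQ : Q ⊆ R) (π : Finpartition (R \ Q)) :
    Finpartition (insert k R) :=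
  π.extend (b := insert k Q) (Finset.insert_ne_empty k Q)
    (by
      rw [Finset.disjoint_insert_right]
      exact ⟨fun h => lt_irrefl k (hk k (Finset.sdiff_subset h)), Finset.sdiff_disjoint⟩)
    (by
      rw [Finset.sup_eq_union, Finset.union_insert, Finset.sdiff_union_of_subset hQ])

theorem parts_extendPartition (hk : ∀ j ∈ R, j < k) (hQ : Q ⊆ R) (π : Finpartition (R \ Q)) :
    (extendPartition hk hQ π).parts = insert (insert k Q) π.parts := rfl

/-- As k exceeds all other elements, its block has the largest maximum and comes last, while the
other blocks keep their order. -/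
theorem partitionCode_extendPartition (hk : ∀ j ∈ R, j < k) (hQ : Q ⊆ R)
    (π : Finpartition (R \ Q)) :
    partitionCode (extendPartition hk hQ π) = partitionCode π ++ [(insert k Q, k)] := by
  set ρ := extendPartition hk hQ π with hρ
  have hB : insert k Q ∈ ρ.parts := by
    rw [hρ, parts_extendPartition]
    exact Finset.mem_insert_self _ _
  have hpart : ∀ j ∈ R \ Q, ρ.part j = π.part j := fun j hj =>
    ρ.part_eq_of_mem (by
      rw [hρ, parts_extendPartition]
      exact Finset.mem_insert_of_mem (π.part_mem.2 hj)) (π.mem_part_self.2 hj)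
  have hpartB : ∀ j ∈ insert k Q, ρ.part j = insert k Q := fun j hj => ρ.part_eq_of_mem hB hj
  have hmax : blockMaxima ρ = blockMaxima π ++ [k] := by
    refine (pairwise_blockMaxima ρ).eq_of_mem_iff ?_ fun j => ?_
    · refine List.pairwise_append.2 ⟨pairwise_blockMaxima π, List.pairwise_singleton _ _, ?_⟩
      intro j hj l hl
      rw [List.mem_singleton.1 hl]
      exact hk j (Finset.sdiff_subset ((mem_blockMaxima π).1 hj).1)
    · rw [mem_blockMaxima, List.mem_append, mem_blockMaxima, List.mem_singleton,
        Finset.mem_insert]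
      by_cases hjk : j = k
      · subst hjk
        simp only [true_or, or_true, iff_true, true_and]
        intro i hi
        rw [hpartB j (Finset.mem_insert_self _ _), Finset.mem_insert] at hi
        rcases hi with rfl | hi
        · exact le_rfl
        · exact (hk i (hQ hi)).le
      · simp only [hjk, false_or, or_false]
        by_cases hj : j ∈ R \ Q
        · rw [hpart j hj]
          simp only [hj, Finset.sdiff_subset hj, true_and]
        · simp only [hj, false_and, iff_false, not_and]
          intro hjR h
          have hjQ : j ∈ Q := by
            by_contra hjQ
            exact hj (Finset.mem_sdiff.2 ⟨hjR, hjQ⟩)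
          rw [hpartB j (Finset.mem_insert_of_mem hjQ)] at h
          exact absurd (hk j hjR) (not_lt.2 (h k (Finset.mem_insert_self _ _)))
  rw [partitionCode, hmax, List.map_append, List.map_singleton, partitionCode,
    hpartB k (Finset.mem_insert_self _ _)]
  congr 1
  refine List.map_congr_left fun j hj => ?_
  rw [hpart j ((mem_blockMaxima π).1 hj).1]

/-- A partition of R ∪ {k} is the block Q ∪ {k} of k together with a partition of R \ Q. Summands
are functions of the code, a plain list, so that partitions of different sets can be compared. -/
theorem sum_finpartition_insert {M : Type*} [AddCommMonoid M] (hk : ∀ j ∈ R, j < k)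
    (h : List (Finset (Fin m) × Fin m) → M) :
    ∑ π : Finpartition (insert k R), h (partitionCode π) =
      ∑ Q ∈ R.powerset, ∑ π : Finpartition (R \ Q), h (partitionCode π ++ [(insert k Q, k)]) := by
  have hkR : k ∉ R := fun h => lt_irrefl k (hk k h)
  rw [Finset.sum_sigma']
  symm
  refine Finset.sum_bij (fun x hx => extendPartition hk
    (Finset.mem_powerset.1 (Finset.mem_sigma.1 hx).1) x.2) (fun _ _ => Finset.mem_univ _) ?_ ?_ ?_
  · rintro ⟨Q, π⟩ hx ⟨Q', π'⟩ hx' heq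
    have hQ : Q ⊆ R := Finset.mem_powerset.1 (Finset.mem_sigma.1 hx).1
    have hQ' : Q' ⊆ R := Finset.mem_powerset.1 (Finset.mem_sigma.1 hx').1
    have h1 : insert (insert k Q) π.parts = insert (insert k Q') π'.parts :=
      congrArg Finpartition.parts heq
    have hno : ∀ (P : Finset (Fin m)) (σ : Finpartition (R \ P)) (B : Finset (Fin m)),
        insert k B ∉ σ.parts := fun P σ B hB =>
      hkR (Finset.sdiff_subset (σ.subset hB (Finset.mem_insert_self k B)))
    have h2 : insert k Q = insert k Q' := by
      have h3 : insert k Q ∈ insert (insert k Q') π'.parts := by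
        rw [← h1]
        exact Finset.mem_insert_self _ _
      rcases Finset.mem_insert.1 h3 with h4 | h4
      · exact h4
      · exact absurd h4 (hno _ _ _)
    have h5 : Q = Q' := by
      rw [← Finset.erase_insert (fun h => hkR (hQ h)), h2,
        Finset.erase_insert (fun h => hkR (hQ' h))]
    subst h5
    congr 1
    ext1
    rw [← Finset.erase_insert (hno _ π Q), h1, Finset.erase_insert (hno _ π' Q)]
  · intro ρ _
    have hkS : k ∈ insert k R := Finset.mem_insert_self k R
    set B := ρ.part k with hB
    have hkB : k ∈ B := ρ.mem_part_self.2 hkS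
    have hBmem : B ∈ ρ.parts := ρ.part_mem.2 hkS
    have hQ : B.erase k ⊆ R := by
      intro j hj
      rw [Finset.mem_erase] at hj
      exact (Finset.mem_insert.1 (ρ.part_subset k hj.2)).resolve_left hj.1
    have hins : insert k (B.erase k) = B := Finset.insert_erase hkB
    -- Deleting the block of k leaves a partition of the remaining elements of R; this inverts the
    -- extension.
    have hsup : (ρ.parts.erase B).sup id = R \ B.erase k := by
      ext j
      rw [Finset.mem_sup, Finset.mem_sdiff, Finset.mem_erase]
      constructor
      · rintro ⟨P, hP, hj⟩
        rw [Finset.mem_erase] at hP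
        have hjB : j ∉ B := fun h => hP.1 (ρ.eq_of_mem_parts hP.2 hBmem hj h)
        refine ⟨(Finset.mem_insert.1 (ρ.subset hP.2 hj)).resolve_left ?_, fun h => hjB h.2⟩
        rintro rfl
        exact hjB hkB
      · rintro ⟨hjR, hj⟩
        have hjk : j ≠ k := fun h => hkR (h ▸ hjR)
        obtain ⟨P, hP, hjP⟩ := ρ.exists_mem (Finset.mem_insert_of_mem hjR)
        exact ⟨P, Finset.mem_erase.2 ⟨fun h => hj ⟨hjk, h ▸ hjP⟩, hP⟩, hjP⟩
    refine ⟨⟨B.erase k, ρ.ofSubset (Finset.erase_subset B _) hsup⟩,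
      Finset.mem_sigma.2 ⟨Finset.mem_powerset.2 hQ, Finset.mem_univ _⟩, ?_⟩
    ext1
    rw [parts_extendPartition, Finpartition.ofSubset_parts, hins, Finset.insert_erase hBmem]
  · rintro ⟨Q, π⟩ hx
    rw [partitionCode_extendPartition]

end Extend

/-- Induction on a finite set of indices by removal of the maximal element. -/
theorem strong_induction_on_max {p : Finset (Fin m) → Prop} (S : Finset (Fin m)) (h0 : p ∅)
    (h1 : ∀ (k : Fin m) (R : Finset (Fin m)), (∀ j ∈ R, j < k) → (∀ S ⊆ R, p S) →
      p (insert k R)) : p S := by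
  induction S using Finset.strongInduction with
  | H S ih =>
    rcases S.eq_empty_or_nonempty with rfl | hS
    · exact h0
    · have hmem := S.max'_mem hS
      rw [← Finset.insert_erase hmem]
      refine h1 _ _ (fun j hj => ?_) fun T hT => ih T ?_
      · rw [Finset.mem_erase] at hj
        exact lt_of_le_of_ne (S.le_max' j hj.2) hj.1
      · exact (hT.trans_ssubset (Finset.erase_ssubset hmem))

/-! ### Sums over subsets -/

section Subsets

variable {α : Type*} [DecidableEq α] {M : Type*} [AddCommMonoid M]

theorem sum_powerset_sdiff_comm (R : Finset α) (f : Finset α → Finset α → M) :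
    ∑ P ∈ R.powerset, ∑ Q ∈ (R \ P).powerset, f P Q =
      ∑ Q ∈ R.powerset, ∑ P ∈ (R \ Q).powerset, f P Q := by
  refine Finset.sum_comm' fun P Q => ?_
  simp only [Finset.mem_powerset, Finset.subset_sdiff]
  rw [disjoint_comm]
  tauto

/-- Ordered pairs of disjoint subsets P, Q correspond to pairs P ⊆ S with S = P ∪ Q. -/
theorem sum_powerset_sdiff (R : Finset α) (f : Finset α → Finset α → M) :
    ∑ P ∈ R.powerset, ∑ Q ∈ (R \ P).powerset, f P Q =
      ∑ S ∈ R.powerset, ∑ P ∈ S.powerset, f P (S \ P) := by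
  rw [Finset.sum_sigma', Finset.sum_sigma']
  refine Finset.sum_nbij' (fun x => ⟨x.1 ∪ x.2, x.1⟩) (fun x => ⟨x.2, x.1 \ x.2⟩) ?_ ?_ ?_ ?_ ?_
  · rintro ⟨P, Q⟩ h
    simp only [Finset.mem_sigma, Finset.mem_powerset] at h ⊢
    exact ⟨Finset.union_subset h.1 (h.2.trans Finset.sdiff_subset), Finset.subset_union_left⟩
  · rintro ⟨S, P⟩ h
    simp only [Finset.mem_sigma, Finset.mem_powerset] at h ⊢
    exact ⟨h.2.trans h.1, Finset.sdiff_subset_sdiff h.1 le_rfl⟩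
  · rintro ⟨P, Q⟩ h
    simp only [Finset.mem_sigma, Finset.mem_powerset, Finset.subset_sdiff] at h
    simp only [Finset.union_sdiff_cancel_left h.2.2.symm]
  · rintro ⟨S, P⟩ h
    simp only [Finset.mem_sigma, Finset.mem_powerset] at h
    simp only [Finset.union_sdiff_of_subset h.2]
  · rintro ⟨P, Q⟩ h
    simp only [Finset.mem_sigma, Finset.mem_powerset, Finset.subset_sdiff] at h
    simp only [Finset.union_sdiff_cancel_left h.2.2.symm]

end Subsets

/-! ### Hurwitz's generalization of Abel's binomial identity -/

section Hurwitz

variable {α : Type*} [DecidableEq α] {K : Type*} [Field K] (a : α → K)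

/-- The sum is an iterated difference with one step a_i for each element of R, applied to a
polynomial of degree less than the number of steps. Each step lowers the degree. -/
theorem sum_neg_one_pow_mul_add_sum_pow (R : Finset α) (x : K) {n : ℕ} (hn : n < R.card) :
    ∑ P ∈ R.powerset, (-1) ^ P.card * (x + ∑ i ∈ R \ P, a i) ^ n = 0 := by
  induction R using Finset.induction_on generalizing n with
  | empty => simp at hn
  | insert i R hi ih =>
    rw [Finset.card_insert_of_notMem hi] at hn
    rw [Finset.sum_powerset_insert hi, ← Finset.sum_add_distrib]
    have h : ∀ P ∈ R.powerset,
        (-1) ^ P.card * (x + ∑ j ∈ insert i R \ P, a j) ^ n +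
          (-1) ^ (insert i P).card * (x + ∑ j ∈ insert i R \ insert i P, a j) ^ n =
        ∑ l ∈ Finset.range n, (a i ^ (n - l) * (n.choose l : K)) *
          ((-1) ^ P.card * (x + ∑ j ∈ R \ P, a j) ^ l) := by
      intro P hP
      have hiP : i ∉ P := fun h => hi (Finset.mem_powerset.1 hP h)
      rw [Finset.insert_sdiff_of_notMem _ hiP, Finset.insert_sdiff_insert,
        Finset.sdiff_insert_of_notMem hi, Finset.card_insert_of_notMem hiP,
        Finset.sum_insert (fun h => hi (Finset.sdiff_subset h)), add_left_comm, add_comm (a i),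
        add_pow, Finset.sum_range_succ]
      simp only [Nat.sub_self, pow_zero, mul_one, Nat.choose_self, Nat.cast_one]
      rw [pow_succ, mul_add, Finset.mul_sum]
      ring_nf
    rw [Finset.sum_congr rfl h, Finset.sum_comm]
    refine Finset.sum_eq_zero fun l hl => ?_
    rw [← Finset.mul_sum, ih (by have := Finset.mem_range.1 hl; omega), mul_zero]

/-- `x (x + ∑_{i ∈ P} a_i)^{|P| - 1}`. -/
def abelTerm (x : K) (P : Finset α) : K :=
  if P = ∅ then 1 else x * (x + ∑ i ∈ P, a i) ^ (P.card - 1)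

/-- The difference of the two sides is a polynomial in y whose derivative vanishes by induction,
applied to R without i at the point y + a_i. Being constant in characteristic 0, it is evaluated at
y = -(x + ∑ a_i). The separate value 1 of `abelTerm` at ∅ stands for x · x⁻¹, which the truncated
exponent would miss. -/
theorem hurwitz_identity [CharZero K] (R : Finset α) (x y : K) :
    ∑ P ∈ R.powerset, abelTerm a x (R \ P) * (y + ∑ i ∈ P, a i) ^ P.card =
      (x + y + ∑ i ∈ R, a i) ^ R.card := by
  induction R using Finset.strongInduction generalizing y with
  | H R ih =>
    rcases R.eq_empty_or_nonempty with rfl | hR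
    · simp [abelTerm]
    have hcard : 0 < R.card := hR.card_pos
    set p : Polynomial K := (∑ P ∈ R.powerset, Polynomial.C (abelTerm a x (R \ P)) *
      (Polynomial.X + Polynomial.C (∑ i ∈ P, a i)) ^ P.card) -
        (Polynomial.X + Polynomial.C (x + ∑ i ∈ R, a i)) ^ R.card with hp
    have heval : ∀ z, p.eval z = (∑ P ∈ R.powerset, abelTerm a x (R \ P) *
        (z + ∑ i ∈ P, a i) ^ P.card) - (x + z + ∑ i ∈ R, a i) ^ R.card := by
      intro z
      rw [hp, Polynomial.eval_sub, Polynomial.eval_finsetSum]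
      simp only [Polynomial.eval_mul, Polynomial.eval_C, Polynomial.eval_pow, Polynomial.eval_add,
        Polynomial.eval_X]
      ring_nf
    have hderiv : Polynomial.derivative p = 0 := by
      refine Polynomial.funext fun z => ?_
      have h1 : (Polynomial.derivative p).eval z = (∑ P ∈ R.powerset, ∑ i ∈ P,
          abelTerm a x (R \ P) * (z + ∑ j ∈ P, a j) ^ (P.card - 1)) -
          R.card * (x + z + ∑ i ∈ R, a i) ^ (R.card - 1) := by
        rw [hp, Polynomial.derivative_sub, Polynomial.derivative_sum, Polynomial.eval_sub,
          Polynomial.eval_finsetSum]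
        simp only [Polynomial.derivative_mul, Polynomial.derivative_C, zero_mul, zero_add,
          Polynomial.derivative_pow, Polynomial.derivative_add, Polynomial.derivative_X, add_zero,
          mul_one, Polynomial.eval_mul, Polynomial.eval_C, Polynomial.eval_pow,
          Polynomial.eval_add, Polynomial.eval_X, Finset.sum_const, nsmul_eq_mul]
        rw [add_assoc x z, add_left_comm x z]
        congr 1
        refine Finset.sum_congr rfl fun P _ => ?_
        ring
      -- Differentiating a power indexed by P selects an element i of P; summing over i first leaves
      -- subsets of R without i.
      have h2 : (∑ P ∈ R.powerset, ∑ i ∈ P,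
          abelTerm a x (R \ P) * (z + ∑ j ∈ P, a j) ^ (P.card - 1)) =
          ∑ i ∈ R, ∑ P ∈ (R.erase i).powerset, abelTerm a x (R.erase i \ P) *
            ((z + a i) + ∑ j ∈ P, a j) ^ P.card := by
        rw [Finset.sum_sigma', Finset.sum_sigma']
        refine Finset.sum_nbij' (fun q => ⟨q.2, q.1.erase q.2⟩) (fun q => ⟨insert q.1 q.2, q.1⟩)
          ?_ ?_ ?_ ?_ ?_
        · rintro ⟨P, i⟩ h
          simp only [Finset.mem_sigma, Finset.mem_powerset] at h ⊢
          exact ⟨h.1 h.2, Finset.erase_subset_erase i h.1⟩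
        · rintro ⟨i, P⟩ h
          simp only [Finset.mem_sigma, Finset.mem_powerset] at h ⊢
          exact ⟨Finset.insert_subset h.1 (h.2.trans (Finset.erase_subset _ _)),
            Finset.mem_insert_self _ _⟩
        · rintro ⟨P, i⟩ h
          simp only [Finset.mem_sigma, Finset.mem_powerset] at h
          simp only [Finset.insert_erase h.2]
        · rintro ⟨i, P⟩ h
          simp only [Finset.mem_sigma, Finset.mem_powerset] at h
          simp only [Finset.erase_insert (fun h' => Finset.notMem_erase i R (h.2 h'))]
        · rintro ⟨P, i⟩ h
          simp only [Finset.mem_sigma, Finset.mem_powerset] at h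
          have h3 : R.erase i \ P.erase i = R \ P := by
            ext j
            simp only [Finset.mem_sdiff, Finset.mem_erase]
            by_cases hj : j = i
            · subst hj
              simp [h.2]
            · simp [hj]
          simp only [h3, Finset.card_erase_of_mem h.2]
          rw [← Finset.add_sum_erase P a h.2, add_assoc]
      rw [h1, h2, Finset.sum_congr rfl fun i hi => ih (R.erase i) (Finset.erase_ssubset hi) (z + a i),
        Polynomial.eval_zero, sub_eq_zero, ← nsmul_eq_mul, ← Finset.sum_const]
      refine Finset.sum_congr rfl fun i hi => ?_
      rw [Finset.card_erase_of_mem hi, ← Finset.add_sum_erase R a hi]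
      ring
    -- At this point the right side vanishes as R is nonempty, and y + a_P = -(x + a_{R\P}). All
    -- terms become powers of degree |R| - 1 with alternating signs, a vanishing iterated
    -- difference.
    have hzero : p.eval (-(x + ∑ i ∈ R, a i)) = 0 := by
      rw [heval]
      have h1 : x + -(x + ∑ i ∈ R, a i) + ∑ i ∈ R, a i = 0 := by ring
      rw [h1, zero_pow hcard.ne', sub_zero]
      have h2 : ∀ P ∈ R.powerset, abelTerm a x (R \ P) *
          (-(x + ∑ i ∈ R, a i) + ∑ i ∈ P, a i) ^ P.card =
          x * ((-1) ^ P.card * (x + ∑ i ∈ R \ P, a i) ^ (R.card - 1)) := by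
        intro P hP
        rw [Finset.mem_powerset] at hP
        have h3 : -(x + ∑ i ∈ R, a i) + ∑ i ∈ P, a i = -1 * (x + ∑ i ∈ R \ P, a i) := by
          rw [← Finset.sum_sdiff hP]
          ring
        rw [h3, mul_pow, abelTerm]
        split_ifs with h4
        · have h5 : P = R := Finset.Subset.antisymm hP (Finset.sdiff_eq_empty_iff_subset.1 h4)
          subst h5
          simp only [Finset.sdiff_self, Finset.sum_empty, add_zero]
          rw [← mul_pow_sub_one hcard.ne' x]
          ring
        · have h5 : R.card - 1 = ((R \ P).card - 1) + P.card := by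
            have h6 := Finset.card_sdiff_add_card_eq_card hP
            have h7 := (Finset.nonempty_iff_ne_empty.2 h4).card_pos
            omega
          rw [h5, _root_.pow_add]
          ring
      rw [Finset.sum_congr rfl h2, ← Finset.mul_sum,
        sum_neg_one_pow_mul_add_sum_pow a R x (by omega), mul_zero]
    have hconst := Polynomial.eq_C_of_natDegree_eq_zero
      (Polynomial.derivative_eq_zero.1 hderiv)
    have h0 : p.eval y = 0 := by
      rw [hconst, Polynomial.eval_C] at hzero ⊢
      exact hzero
    rw [heval] at h0
    exact sub_eq_zero.1 h0

end Hurwitz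

/-! ### Operators that do not raise the energy -/

/-- Operators that do not raise the energy. -/
def Tri (X : Op m) : Prop := ∀ U V, X U V ≠ 0 → energy U ≤ energy V

theorem Tri.zero : Tri (0 : Op m) := fun _ _ h => absurd rfl h

theorem Tri.id : Tri (Op.id m) := fun U V h => by
  unfold Op.id at h
  rw [show U = V from by_contra fun h' => h (if_neg h')]

theorem Tri.add {X Y : Op m} (hX : Tri X) (hY : Tri Y) : Tri (X + Y) := fun U V h => by
  by_cases h0 : X U V = 0
  · refine hY U V fun h1 => h ?_
    rw [Pi.add_apply, Pi.add_apply, h0, h1, add_zero]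
  · exact hX U V h0

theorem Tri.smul {X : Op m} (hX : Tri X) (c : Coef m) : Tri (c • X) := fun U V h =>
  hX U V (right_ne_zero_of_mul h)

theorem Tri.comp {X Y : Op m} (hX : Tri X) (hY : Tri Y) : Tri (X.comp Y) := fun U V h => by
  obtain ⟨T, h1, h2⟩ := Op.comp_entry_ne_zero h
  exact (hX U T h1).trans (hY T V h2)

theorem Tri.sum {s : Finset κ} {X : κ → Op m} (h : ∀ k ∈ s, Tri (X k)) : Tri (∑ k ∈ s, X k) :=
  Finset.sum_induction X Tri (fun _ _ => Tri.add) Tri.zero h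

/-- The columns of Y have finite support, so no condition on the left factor is required. -/
theorem Tri.composable {Y : Op m} (hY : Tri Y) (X : Op m) : X.Composable Y := fun _ V =>
  formallySummable_of_finite ((finite_energy_le (energy V)).subset fun T hT =>
    hY T V (right_ne_zero_of_mul hT))

theorem Tri.comp_assoc {Y Z : Op m} (hY : Tri Y) (hZ : Tri Z) (X : Op m) :
    (X.comp Y).comp Z = X.comp (Y.comp Z) := by
  refine Op.comp_assoc_of_summable (hY.composable X) (hZ.composable Y) fun U V => ?_
  refine formallySummable_of_finite (((finite_energy_le (energy V)).prod
    (finite_energy_le (energy V))).subset fun p hp => ?_)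
  have h1 := hZ p.2 V (right_ne_zero_of_mul hp)
  have h2 := hY p.1 p.2 (right_ne_zero_of_mul (left_ne_zero_of_mul hp))
  exact ⟨h2.trans h1, h1⟩

/-- The strict increase of levels at the second junction bounds the second intermediate energy, and
the middle factor then bounds the first. So equality of levels is allowed at the first junction. -/
theorem Adm.formallySummable_of_tri {a b a' b' a'' b'' : ℕ} {X Y Z : Op m} (hX : Adm a b X)
    (hY : Adm a' b' Y) (hZ : Adm a'' b'' Z) (h : b ≤ a') (h' : b' < a'') (ht : Tri Y)
    (U V : Config) :
    FormallySummable fun p : Config × Config => X U p.1 * Y p.1 p.2 * Z p.2 V := by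
  obtain ⟨C, hC⟩ := hX
  obtain ⟨D, hD⟩ := hY
  obtain ⟨E, hE⟩ := hZ
  refine formallySummable_of_bdd
    (fun p => (((hC U p.1).mul (hD p.1 p.2) h).mul (hE p.2 V) h'.le).1) fun γ => ?_
  obtain ⟨M, hM⟩ := EntryBdd.exists_energy_le (a := a) (b' := b'') h' (C + D) E U V γ
  refine ((finite_energy_le M).prod (finite_energy_le M)).subset fun p hp => ?_
  have h1 := hM p.2 _ _ ((hC U p.1).mul (hD p.1 p.2) h) (hE p.2 V) hp
  refine ⟨(ht p.1 p.2 fun h0 => hp ?_).trans h1, h1⟩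
  simp only [h0, mul_zero, zero_mul, HahnSeries.coeff_zero]

/-- Associativity when the middle factor does not raise the energy. -/
theorem Adm.comp_assoc_of_tri {a b a' b' a'' b'' : ℕ} {X Y Z : Op m} (hX : Adm a b X)
    (hY : Adm a' b' Y) (hZ : Adm a'' b'' Z) (h : b ≤ a') (h' : b' < a'') (ht : Tri Y) :
    (X.comp Y).comp Z = X.comp (Y.comp Z) :=
  Op.comp_assoc_of_summable (ht.composable X) (hY.composable hZ h')
    (hX.formallySummable_of_tri hY hZ h h' ht)

theorem Adm.composable_comp_of_tri {a b a' b' a'' b'' : ℕ} {X Y Z : Op m} (hX : Adm a b X)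
    (hY : Adm a' b' Y) (hZ : Adm a'' b'' Z) (h : b ≤ a') (h' : b' < a'') (ht : Tri Y) :
    X.Composable (Y.comp Z) := fun U V => by
  have h1 := (hX.formallySummable_of_tri hY hZ h h' ht U V).formalSum_prod.1
  simp only [mul_assoc, formalSum_const_mul (hY.composable hZ h' _ V)] at h1
  exact h1

theorem tri_opA0 (z : Coef m) : Tri (opA0 z) := fun U V h => by
  by_contra hne
  exact h (if_neg hne)

theorem tri_expAlpha1 : Tri (expAlpha1 m) := fun U V h => by
  by_contra hne
  exact h (by rw [expAlpha1_apply, if_neg hne])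

theorem tri_calE0 (z : Coef m) : Tri (calE 0 z) := fun U V h => by
  have := energy_of_calE h
  linarith

/-- Power series of operators that do not raise the energy. -/
def TTri (A : TOp m) : Prop := ∀ n, Tri (A n)

theorem TTri.const {X : Op m} (h : Tri X) : TTri (TOp.const X) := fun n => by
  rw [TOp.const]
  split_ifs
  · exact h
  · exact Tri.zero

theorem TTri.smul {A : TOp m} (h : TTri A) (f : PowerSeries (Coef m)) : TTri (f • A) := fun n => by
  rw [TOp.smul_apply]
  exact Tri.sum fun p _ => (h p.2).smul _

theorem TTri.sum {s : Finset κ} {A : κ → TOp m} (h : ∀ k ∈ s, TTri (A k)) :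
    TTri (∑ k ∈ s, A k) := fun n => by
  rw [Finset.sum_apply]
  exact Tri.sum fun k hk => h k hk n

theorem TTri.comp {A B : TOp m} (hA : TTri A) (hB : TTri B) : TTri (A.comp B) := fun _ =>
  Tri.sum fun p _ => (hA p.1).comp (hB p.2)

theorem TTri.composable {B : TOp m} (hB : TTri B) (A : TOp m) : A.Composable B := fun i j =>
  (hB j).composable (A i)

theorem TTri.comp_assoc {B D : TOp m} (hB : TTri B) (hD : TTri D) (A : TOp m) :
    (A.comp B).comp D = A.comp (B.comp D) :=
  TOp.comp_assoc_of_forall (fun _ _ k => (hD k).composable _) (fun _ j k => ((hB j).comp (hD k)).composable _)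
    fun i j k => (hB j).comp_assoc (hD k) (A i)

theorem TAdm.composable_comp_of_tri {a b a' b' a'' b'' : ℕ} {A B D : TOp m} (hA : TAdm a b A)
    (hB : TAdm a' b' B) (hD : TAdm a'' b'' D) (h : b ≤ a') (h' : b' < a'') (ht : TTri B) :
    A.Composable (B.comp D) := fun i j U V => by
  have h1 := formalSum_finset_sum (Finset.HasAntidiagonal.antidiagonal j)
    (f := fun p T => A i U T * ((B p.1).comp (D p.2)) T V) fun p _ =>
      (hA i).composable_comp_of_tri (hB p.1) (hD p.2) h h' (ht p.1) U V
  have h2 := h1.1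
  simp only [← Finset.mul_sum] at h2
  convert h2 using 3
  rw [TOp.comp, Finset.sum_apply, Finset.sum_apply]

theorem TAdm.comp_assoc_of_tri {a b a' b' a'' b'' : ℕ} {A B D : TOp m} (hA : TAdm a b A)
    (hB : TAdm a' b' B) (hD : TAdm a'' b'' D) (h : b ≤ a') (h' : b' < a'') (ht : TTri B) :
    (A.comp B).comp D = A.comp (B.comp D) :=
  TOp.comp_assoc_of_forall
    (fun i j k => ((hA i).comp (hB j) h).composable (hD k) h')
    (fun i j k => (hA i).composable_comp_of_tri (hB j) (hD k) h h' (ht j))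
    fun i j k => (hA i).comp_assoc_of_tri (hB j) (hD k) h h' (ht j)

/-! ### The operators `E(w_S, s)` -/

/-- Families of operators indexed by blocks, of the kind that occurs in `E(w_S, s)`. -/
structure IsBlockOp (B : Finset (Fin m) → Op m) : Prop where
  tri : ∀ P, Tri (B P)
  adm : ∀ {P : Finset (Fin m)} {k : Fin m}, k ∈ P → (∀ j ∈ P, j ≤ k) → ∀ {a : ℕ}, (k : ℕ) < a →
    Adm a a (B P)

/-- `∑_π s^{|S| - ℓ(π)} ∏_p B_{π_p}`. -/
def blockE (B : Finset (Fin m) → Op m) (S : Finset (Fin m)) (s : PowerSeries (Coef m)) : TOp m :=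
  ∑ π : Finpartition S, s ^ (S.card - π.parts.card) •
    TOp.const (Op.prod ((blockMaxima π).map fun k => B (π.part k)))

theorem opE_eq (S : Finset (Fin m)) (s : PowerSeries (Coef m)) : opE S s = blockE calE0 S s := rfl

theorem bdd_treeT {k : Fin m} {P : Finset (Fin m)} (hk : k ∈ P) (hP : ∀ j ∈ P, j ≤ k) :
    ∃ c, Bdd c (treeT P : Coef m) :=
  ⟨_, Bdd.mul (Finset.prod_induction _ (Bdd 0) (fun _ _ => Bdd.mul₀) Bdd.one fun i _ =>
    (isSmall_var i).bdd) ((isLead_blockSum hk hP).bdd_zpow _)⟩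

theorem isBlockOp_calE0 : IsBlockOp (calE0 (m := m)) where
  tri _ := (tri_calE0 _).smul _
  adm hk hP _ ha := (adm_calE (r := 0) (fun U V => bdd_calE (isLead_blockSum hk hP) 0 U V)
    (Nat.zero_lt_of_lt ha)).smul_bdd (bdd_treeT hk hP).choose_spec

theorem isBlockOp_opA0 : IsBlockOp fun P : Finset (Fin m) => treeT P • opA0 (blockSum P) where
  tri _ := (tri_opA0 _).smul _
  adm hk hP _ ha := (adm_opA0 (isLead_blockSum hk hP) ha).smul_bdd (bdd_treeT hk hP).choose_spec

theorem Tri.prod {L : List (Op m)} (h : ∀ X ∈ L, Tri X) : Tri (Op.prod L) := by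
  induction L with
  | nil => exact Tri.id
  | cons X L ih =>
    exact (h X List.mem_cons_self).comp (ih fun Y hY => h Y (List.mem_cons_of_mem _ hY))

theorem Op.prod_append_of_tri {L : List (Op m)} (h : ∀ X ∈ L, Tri X) {Y : Op m} (hY : Tri Y) :
    Op.prod (L ++ [Y]) = (Op.prod L).comp Y := by
  induction L with
  | nil =>
    change Y.comp (Op.id m) = (Op.id m).comp Y
    rw [Op.comp_id, Op.id_comp]
  | cons X L ih =>
    have hL : ∀ X ∈ L, Tri X := fun Z hZ => h Z (List.mem_cons_of_mem _ hZ)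
    rw [List.cons_append, Op.prod, ih hL, Op.prod, (Tri.prod hL).comp_assoc hY]

theorem blockE_empty (B : Finset (Fin m) → Op m) (s : PowerSeries (Coef m)) :
    blockE B ∅ s = TOp.const (Op.id m) := by
  have h := sum_finpartition_empty (m := m) fun L =>
    s ^ ((∅ : Finset (Fin m)).card - L.length) • TOp.const (Op.prod (L.map fun p => B p.1))
  simp only [length_partitionCode] at h
  rw [blockE]
  simp only [partitionCode, List.map_map, Function.comp_def] at h
  rw [h]
  simp [Op.prod]

/-- The block of the largest element is split off as the last factor of each product. -/
theorem blockE_insert {B : Finset (Fin m) → Op m} (hB : IsBlockOp B) (s : PowerSeries (Coef m))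
    {k : Fin m} {R : Finset (Fin m)} (hk : ∀ j ∈ R, j < k) :
    blockE B (insert k R) s = ∑ Q ∈ R.powerset,
      (blockE B (R \ Q) s).comp (s ^ Q.card • TOp.const (B (insert k Q))) := by
  have hkR : k ∉ R := fun h => lt_irrefl k (hk k h)
  have h := sum_finpartition_insert hk fun L =>
    s ^ ((insert k R).card - L.length) • TOp.const (Op.prod (L.map fun p => B p.1))
  simp only [length_partitionCode] at h
  rw [blockE]
  have e1 : ∀ π : Finpartition (insert k R),
      (partitionCode π).map (fun p => B p.1) = (blockMaxima π).map fun k => B (π.part k) :=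
    fun π => by rw [partitionCode, List.map_map]; rfl
  simp only [e1] at h
  rw [h]
  refine Finset.sum_congr rfl fun Q hQ => ?_
  rw [Finset.mem_powerset] at hQ
  have hT : TTri (s ^ Q.card • TOp.const (B (insert k Q))) := (TTri.const (hB.tri _)).smul _
  rw [blockE, TOp.sum_comp fun π _ => hT.composable _]
  refine Finset.sum_congr rfl fun π _ => ?_
  have e2 : (partitionCode π).map (fun p => B p.1) =
      (blockMaxima π).map fun k => B (π.part k) := by
    rw [partitionCode, List.map_map]
    rfl
  -- The new block has |Q| + 1 elements and so contributes s^{|Q|}. The subtraction of natural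
  -- numbers is not truncated, because a partition has at most as many blocks as elements.
  have hc : (insert k R).card - (π.parts.card + 1) = ((R \ Q).card - π.parts.card) + Q.card := by
    have h1 := Finset.card_sdiff_add_card_eq_card hQ
    have h2 := π.card_parts_le_card
    rw [Finset.card_insert_of_notMem hkR]
    omega
  rw [List.map_append, List.map_singleton, List.length_append, List.length_singleton,
    length_partitionCode, hc, e2, Op.prod_append_of_tri (fun X hX => ?_) (hB.tri _),
    TOp.comp_smul ((TTri.const (hB.tri _)).composable _),
    TOp.smul_comp ((TTri.const (hB.tri _)).composable _), smul_smul, TOp.const_comp_const,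
    _root_.pow_add, mul_comm]
  obtain ⟨j, -, rfl⟩ := List.mem_map.1 hX
  exact hB.tri _

theorem ttri_blockE {B : Finset (Fin m) → Op m} (hB : IsBlockOp B) (s : PowerSeries (Coef m))
    (S : Finset (Fin m)) : TTri (blockE B S s) := by
  refine TTri.sum fun π _ => (TTri.const (Tri.prod fun X hX => ?_)).smul _
  obtain ⟨j, -, rfl⟩ := List.mem_map.1 hX
  exact hB.tri _

theorem tadm_blockE {B : Finset (Fin m) → Op m} (hB : IsBlockOp B) {s : PowerSeries (Coef m)}
    (hs : s ∈ bddPowerSeries m) {S : Finset (Fin m)} {a : ℕ} (ha : ∀ i ∈ S, (i : ℕ) < a) :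
    TAdm a a (blockE B S s) := by
  refine TAdm.sum fun π _ => (TAdm.const ?_).smul (pow_mem hs _)
  have hL : ∀ L : List (Op m), (∀ X ∈ L, Adm a a X) → Adm a a (Op.prod L) := by
    intro L
    induction L with
    | nil => exact fun _ => adm_id a
    | cons X L ih =>
      exact fun h => (h X List.mem_cons_self).comp
        (ih fun Y hY => h Y (List.mem_cons_of_mem _ hY)) le_rfl
  refine hL _ fun X hX => ?_
  obtain ⟨j, hj, rfl⟩ := List.mem_map.1 hX
  rw [mem_blockMaxima] at hj
  exact hB.adm (π.mem_part_self.2 hj.1) hj.2 (ha j hj.1)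

/-- The operators `E(w_S, -t)` with `ℰ_0` replaced by `A^0`. -/
def opE' (S : Finset (Fin m)) : TOp m :=
  blockE (fun P => treeT P • opA0 (blockSum P)) S (-PowerSeries.X)

theorem lead_insert {k : Fin m} {Q : Finset (Fin m)} (hk : ∀ j ∈ Q, j < k) :
    IsLead k (blockSum (insert k Q) : Coef m) :=
  isLead_blockSum (Finset.mem_insert_self k Q) fun j hj => by
    rcases Finset.mem_insert.1 hj with rfl | hj
    · exact le_rfl
    · exact (hk j hj).le

theorem neg_X_mem : (-PowerSeries.X : PowerSeries (Coef m)) ∈ bddPowerSeries m :=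
  neg_mem X_mem_bddPowerSeries

/-- `e^{α_1} E(w_S, -t) = E'(w_S) e^{α_1}`. -/
theorem expAlpha1_comp_opE (S : Finset (Fin m)) :
    (TOp.const (expAlpha1 m)).comp (opE S (-PowerSeries.X)) =
      (opE' S).comp (TOp.const (expAlpha1 m)) := by
  have hα : TTri (TOp.const (expAlpha1 m)) := TTri.const tri_expAlpha1
  rw [opE_eq, opE']
  induction S using strong_induction_on_max with
  | h0 => rw [blockE_empty, blockE_empty, TOp.comp_id, TOp.id_comp]
  | h1 k R hk ih =>
    rw [blockE_insert isBlockOp_calE0 _ hk, blockE_insert isBlockOp_opA0 _ hk,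
      TOp.comp_sum fun Q _ => ?_, TOp.sum_comp fun Q _ => hα.composable _]
    · refine Finset.sum_congr rfl fun Q hQ => ?_
      rw [Finset.mem_powerset] at hQ
      have hE : TTri (blockE calE0 (R \ Q) (-PowerSeries.X : PowerSeries (Coef m))) :=
        ttri_blockE isBlockOp_calE0 _ _
      have h1 : TTri ((-PowerSeries.X : PowerSeries (Coef m)) ^ Q.card •
          TOp.const (calE0 (insert k Q))) := (TTri.const (isBlockOp_calE0.tri _)).smul _
      have h2 : TTri ((-PowerSeries.X : PowerSeries (Coef m)) ^ Q.card •
          TOp.const (treeT (insert k Q) • opA0 (blockSum (insert k Q)))) :=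
        (TTri.const (isBlockOp_opA0.tri _)).smul _
      have h3 : (expAlpha1 m).comp (calE0 (insert k Q)) =
          (treeT (insert k Q) • opA0 (blockSum (insert k Q))).comp (expAlpha1 m) := by
        rw [calE0, Op.comp_smul ((tri_calE0 _).composable _),
          expAlpha1_comp_calE (lead_insert fun j hj => hk j (hQ hj)),
          Op.smul_comp (tri_expAlpha1.composable _)]
      rw [← hE.comp_assoc h1, ih _ Finset.sdiff_subset, hα.comp_assoc h1, h2.comp_assoc hα,
        TOp.comp_smul ((TTri.const (isBlockOp_calE0.tri _)).composable _),
        TOp.smul_comp (hα.composable _), TOp.const_comp_const, TOp.const_comp_const, h3]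
    · exact ((ttri_blockE isBlockOp_calE0 _ _).comp
        ((TTri.const (isBlockOp_calE0.tri _)).smul _)).composable _

/-! ### Moving `A(w_k)` past `E'(w_S)` -/

theorem TOp.const_smul (c : Coef m) (X : Op m) :
    TOp.const (c • X) = PowerSeries.C c • TOp.const X := by
  ext1 n
  rw [TOp.C_smul, TOp.const, TOp.const]
  split_ifs
  · rfl
  · rw [smul_zero]

theorem TOp.Composable.smul_right {A B : TOp m} (h : A.Composable B) (f : PowerSeries (Coef m)) :
    A.Composable (f • B) := fun i j U V => by
  have h1 := (formalSum_finset_sum (Finset.HasAntidiagonal.antidiagonal j)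
    (f := fun p T => A i U T * (PowerSeries.coeff p.1 f • B p.2) T V) fun p _ =>
      (h i p.2).smul_right _ U V).1
  simp only [← Finset.mul_sum] at h1
  convert h1 using 3
  rw [TOp.smul_apply, Finset.sum_apply, Finset.sum_apply]

theorem blockSum_insert {k : Fin m} {Q : Finset (Fin m)} (hk : k ∉ Q) :
    (blockSum (insert k Q) : Coef m) = var k + blockSum Q := Finset.sum_insert hk

theorem isOneUnit_insert {k : Fin m} {Q : Finset (Fin m)} (hk : ∀ j ∈ Q, j < k) :
    IsOneUnit (blockSum (insert k Q) / var k : Coef m) := lead_insert hk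

theorem blockSum_div {k : Fin m} {Q : Finset (Fin m)} (hk : ∀ j ∈ Q, j < k) :
    (blockSum Q / var k : Coef m) = blockSum (insert k Q) / var k - 1 := by
  rw [blockSum_insert fun h => lt_irrefl k (hk k h), add_div, div_self (var_ne_zero k),
    add_sub_cancel_left]

/-- `(1 + w_Q / w_k)^{t w_k} 𝒮(u)^{t w_k} ∑_l ς(u)^l / (t w_k + 1)_l ℰ_l(u)` for
`u = w_k + w_Q`. -/
def opB (k : Fin m) (Q : Finset (Fin m)) : TOp m :=
  powT (var k) (blockSum Q / var k) • opAGen (var k) (blockSum (insert k Q))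

theorem opB_empty (k : Fin m) : opB k ∅ = opA (var k : Coef m) := by
  have h : (blockSum ∅ : Coef m) = 0 := Finset.sum_empty
  rw [opB, h, zero_div, powT_zero, one_smul, opA_eq, blockSum_insert (Finset.notMem_empty k), h,
    add_zero]

theorem tadm_opB {k : Fin m} {Q : Finset (Fin m)} (hk : ∀ j ∈ Q, j < k) :
    TAdm (k + 1) (k + 1) (opB k Q) := by
  refine (tadm_opAGen (isSmall_var k).bdd (lead_insert hk)).smul fun n =>
    ⟨0, bdd_coeff_powT (isSmall_var k).bdd ?_ n⟩
  rw [blockSum_div hk]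
  exact isOneUnit_insert hk

/-- The commutator replaces u by u + w_P and keeps c = w_k, so the family of operators B_k(Q) is
closed under absorbing blocks. The prefactor in `opB` is chosen such that exactly one factor ς(t w_k
w_P) is left over. -/
theorem opB_comp_opA0 {j k : Fin m} {P Q : Finset (Fin m)} (hj : j ∈ P) (hP : ∀ i ∈ P, i ≤ j)
    (hjk : j < k) (hQ : ∀ i ∈ Q, i < k) (hPQ : Disjoint P Q) :
    (opB k Q).comp (TOp.const (opA0 (blockSum P))) =
      (TOp.const (opA0 (blockSum P))).comp (opB k Q) -
        sigmaT (var k * blockSum P) • opB k (Q ∪ P) := by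
  have hx : IsLead j (blockSum P : Coef m) := isLead_blockSum hj hP
  have hu : IsLead k (blockSum (insert k Q) : Coef m) := lead_insert hQ
  have hc : Bdd 0 (var k : Coef m) := (isSmall_var k).bdd
  have hQP : ∀ i ∈ Q ∪ P, i < k := fun i hi => by
    rcases Finset.mem_union.1 hi with h | h
    · exact hQ i h
    · exact (hP i h).trans_lt hjk
  have hsum : (blockSum (insert k (Q ∪ P)) : Coef m) = blockSum P + blockSum (insert k Q) := by
    rw [blockSum_insert fun h => lt_irrefl k (hQP k h),
      blockSum_insert fun h => lt_irrefl k (hQ k h)]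
    rw [show (blockSum (Q ∪ P) : Coef m) = blockSum Q + blockSum P from
      Finset.sum_union hPQ.symm]
    ring
  -- The powers combine by (1 + w_Q/w_k)(1 + w_P/(w_k + w_Q)) = 1 + w_{Q∪P}/w_k.
  have hpow : powT (var k) (blockSum Q / var k) *
      powT (var k) (blockSum P / blockSum (insert k Q)) =
      powT (var k : Coef m) (blockSum (Q ∪ P) / var k) := by
    have h1 : (blockSum P / blockSum (insert k Q) : Coef m) =
        blockSum (insert k (Q ∪ P)) / blockSum (insert k Q) - 1 := by
      rw [hsum, add_div, div_self hu.ne_zero, add_sub_cancel_right]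
    rw [blockSum_div hQ, blockSum_div hQP, h1,
      ← powT_mul _ (isOneUnit_insert hQ) ((lead_insert hQP).isOneUnit_div hu)]
    congr 2
    have := hu.ne_zero
    have := var_ne_zero k (m := m)
    field_simp
  have hT : TTri (TOp.const (opA0 (blockSum P : Coef m))) := TTri.const (tri_opA0 _)
  have hcomm := opAGen_commutator hx hc hu hjk
  rw [opB, TOp.smul_comp (hT.composable _), TOp.comp_smul ((TAdm.const
    (adm_opA0 hx (Nat.lt_succ_self _))).composable (tadm_opAGen hc hu) (Nat.succ_lt_succ hjk)),
    opB, hsum, smul_smul, ← hpow, ← sub_eq_iff_eq_add'.2 (sub_eq_iff_eq_add.1 hcomm), smul_sub,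
    smul_smul]
  congr 2
  ring

/-- The factor of a block in `treeF`. -/
def blockF (k : Fin m) (P : Finset (Fin m)) : PowerSeries (Coef m) :=
  -((-PowerSeries.X) ^ (P.card - 1) * PowerSeries.C (treeT P) * sigmaT (var k * blockSum P))

/-- The sum over the set partitions of `S` of the products of the factors of the blocks. -/
def treeF (k : Fin m) (S : Finset (Fin m)) : PowerSeries (Coef m) :=
  ∑ π : Finpartition S, ((partitionCode π).map fun p => blockF k p.1).prod

theorem treeF_empty (k : Fin m) : treeF k ∅ = 1 := by
  have h := sum_finpartition_empty (m := m) fun L => (L.map fun p => blockF k p.1).prod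
  rw [treeF, h, List.map_nil, List.prod_nil]

theorem treeF_insert (k : Fin m) {j : Fin m} {R : Finset (Fin m)} (hj : ∀ i ∈ R, i < j) :
    treeF k (insert j R) = ∑ P ∈ R.powerset, treeF k (R \ P) * blockF k (insert j P) := by
  have h := sum_finpartition_insert hj fun L => (L.map fun p => blockF k p.1).prod
  rw [treeF, h]
  refine Finset.sum_congr rfl fun P _ => ?_
  rw [treeF, Finset.sum_mul]
  refine Finset.sum_congr rfl fun π _ => ?_
  rw [List.map_append, List.prod_append, List.map_singleton, List.prod_singleton]

theorem ttri_opE' (S : Finset (Fin m)) : TTri (opE' S) := ttri_blockE isBlockOp_opA0 _ _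

theorem tadm_opE' {S : Finset (Fin m)} {a : ℕ} (ha : ∀ i ∈ S, (i : ℕ) < a) : TAdm a a (opE' S) :=
  tadm_blockE isBlockOp_opA0 neg_X_mem ha

/-- The factor `(-t)^{|Q|} T(w_P) A^0(w_P)` for `P = Q ∪ {j}`. -/
def lastBlock (j : Fin m) (Q : Finset (Fin m)) : TOp m :=
  (-PowerSeries.X : PowerSeries (Coef m)) ^ Q.card •
    TOp.const (treeT (insert j Q) • opA0 (blockSum (insert j Q)))

theorem opE'_insert {j : Fin m} {R : Finset (Fin m)} (hj : ∀ i ∈ R, i < j) :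
    opE' (insert j R) = ∑ Q ∈ R.powerset, (opE' (R \ Q)).comp (lastBlock j Q) :=
  blockE_insert isBlockOp_opA0 _ hj

theorem ttri_lastBlock (j : Fin m) (Q : Finset (Fin m)) : TTri (lastBlock j Q) :=
  (TTri.const (isBlockOp_opA0.tri _)).smul _

theorem tadm_lastBlock {j : Fin m} {Q : Finset (Fin m)} (hQ : ∀ i ∈ Q, i < j) {a : ℕ}
    (ha : (j : ℕ) < a) : TAdm a a (lastBlock j Q) := by
  refine (TAdm.const (isBlockOp_opA0.adm (Finset.mem_insert_self j Q) (fun i hi => ?_) ha)).smul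
    (pow_mem neg_X_mem _)
  rcases Finset.mem_insert.1 hi with rfl | hi
  · exact le_rfl
  · exact (hQ i hi).le

theorem opB_comp_lastBlock {j k : Fin m} {P Q : Finset (Fin m)} (hP : ∀ i ∈ P, i < j)
    (hjk : j < k) (hQ : ∀ i ∈ Q, i < k) (hPQ : Disjoint (insert j P) Q) :
    (opB k Q).comp (lastBlock j P) =
      (lastBlock j P).comp (opB k Q) + blockF k (insert j P) • opB k (Q ∪ insert j P) := by
  have hjP : j ∉ P := fun h => lt_irrefl j (hP j h)
  have hle : ∀ i ∈ insert j P, i ≤ j := fun i hi => by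
    rcases Finset.mem_insert.1 hi with rfl | hi
    · exact le_rfl
    · exact (hP i hi).le
  have hT : TTri (TOp.const (opA0 (blockSum (insert j P) : Coef m))) := TTri.const (tri_opA0 _)
  have hA : TAdm k k (TOp.const (opA0 (blockSum (insert j P) : Coef m))) :=
    TAdm.const (adm_opA0 (lead_insert hP) hjk)
  rw [lastBlock, TOp.const_smul, smul_smul, TOp.comp_smul (hT.composable _),
    TOp.smul_comp (hA.composable (tadm_opB hQ) (Nat.lt_succ_self _)),
    opB_comp_opA0 (Finset.mem_insert_self j P) hle hjk hQ hPQ, smul_sub, smul_smul, blockF,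
    Finset.card_insert_of_notMem hjP, Nat.add_sub_cancel, neg_smul, ← sub_eq_add_neg]

/-- By induction on the largest element j of S: B_k is moved past the other blocks first and then
either passes or absorbs the block of j. The already absorbed set Q₀ is arbitrary so that the
statement fits B_k after earlier absorptions. -/
theorem opB_comp_opE' {k : Fin m} {S : Finset (Fin m)} (hS : ∀ i ∈ S, i < k)
    {Q₀ : Finset (Fin m)} (hQ₀ : ∀ i ∈ Q₀, i < k) (hd : Disjoint Q₀ S) :
    (opB k Q₀).comp (opE' S) =
      ∑ Q ∈ S.powerset, treeF k Q • (opE' (S \ Q)).comp (opB k (Q₀ ∪ Q)) := by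
  induction S using strong_induction_on_max with
  | h0 =>
    rw [Finset.powerset_empty, Finset.sum_singleton, treeF_empty, one_smul, opE', opE',
      Finset.sdiff_empty, blockE_empty, TOp.comp_id, TOp.id_comp, Finset.union_empty]
  | h1 j R hj ih =>
    have hjR : j ∉ R := fun h => lt_irrefl j (hj j h)
    have hjk : j < k := hS j (Finset.mem_insert_self j R)
    have hRk : ∀ i ∈ R, i < k := fun i hi => (hj i hi).trans hjk
    have hdR : Disjoint Q₀ R := hd.mono_right (Finset.subset_insert j R)
    have hjQ : j ∉ Q₀ := fun h => Finset.disjoint_left.1 hd h (Finset.mem_insert_self j R)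
    have hEk : ∀ S ⊆ R, TAdm k k (opE' S) := fun S hS => tadm_opE' fun i hi => hRk i (hS hi)
    -- The remaining blocks use only indices below j, so they fit the level j, strictly below the
    -- level j + 1 of the split-off block; this permits regrouping the three factors.
    have hEj : ∀ S ⊆ R, TAdm 0 j (opE' S) := fun S hS =>
      (tadm_opE' (a := j) fun i hi => hj i (hS hi)).mono (Nat.zero_le _) le_rfl
    have hB : ∀ Q ⊆ R, TAdm (k + 1) (k + 1) (opB k (Q₀ ∪ Q)) := fun Q hQ => tadm_opB fun i hi => by
      rcases Finset.mem_union.1 hi with h | h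
      · exact hQ₀ i h
      · exact hRk i (hQ h)
    have hB' : ∀ P ⊆ R, ∀ Q ⊆ R, TAdm (k + 1) (k + 1) (opB k ((Q₀ ∪ Q) ∪ insert j P)) :=
      fun P hP Q hQ => tadm_opB fun i hi => by
        rcases Finset.mem_union.1 hi with h | h
        · rcases Finset.mem_union.1 h with h | h
          · exact hQ₀ i h
          · exact hRk i (hQ h)
        · exact hS i (Finset.insert_subset_insert j hP h)
    -- In `T₁` the block P ∪ {j} is passed by B_k, in `T₂` it is absorbed.
    set T₁ : Finset (Fin m) → Finset (Fin m) → TOp m := fun P Q =>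
      treeF k Q • ((opE' ((R \ P) \ Q)).comp (lastBlock j P)).comp (opB k (Q₀ ∪ Q))
    set T₂ : Finset (Fin m) → Finset (Fin m) → TOp m := fun P Q =>
      (treeF k Q * blockF k (insert j P)) •
        (opE' ((R \ P) \ Q)).comp (opB k ((Q₀ ∪ Q) ∪ insert j P))
    have hleft : (opB k Q₀).comp (opE' (insert j R)) =
        ∑ P ∈ R.powerset, ∑ Q ∈ (R \ P).powerset, (T₁ P Q + T₂ P Q) := by
      rw [opE'_insert hj, TOp.comp_sum fun P _ =>
        ((ttri_opE' _).comp (ttri_lastBlock _ _)).composable _]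
      refine Finset.sum_congr rfl fun P hP => ?_
      rw [Finset.mem_powerset] at hP
      have hsub : R \ P ⊆ R := Finset.sdiff_subset
      rw [← (ttri_opE' _).comp_assoc (ttri_lastBlock _ _), ih (R \ P) hsub
        (fun i hi => hRk i (hsub hi)) (hdR.mono_right hsub),
        TOp.sum_comp fun Q _ => (ttri_lastBlock _ _).composable _]
      refine Finset.sum_congr rfl fun Q hQ => ?_
      rw [Finset.mem_powerset] at hQ
      have hQR : Q ⊆ R := hQ.trans hsub
      have hs : (R \ P) \ Q ⊆ R := Finset.sdiff_subset.trans hsub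
      have hg := tadm_lastBlock (fun i hi => hj i (hP hi)) (a := j + 1) (Nat.lt_succ_self _)
      have hdisj : Disjoint (insert j P) (Q₀ ∪ Q) := by
        rw [Finset.disjoint_insert_left, Finset.disjoint_union_right]
        refine ⟨fun h => ?_, (hdR.mono_right hP).symm, ?_⟩
        · rcases Finset.mem_union.1 h with h | h
          · exact hjQ h
          · exact hjR (hQR h)
        · exact (Finset.subset_sdiff.1 hQ).2.symm
      rw [TOp.smul_comp ((ttri_lastBlock _ _).composable _),
        (hEk _ hs).comp_assoc (hB Q hQR) (tadm_lastBlock (fun i hi => hj i (hP hi))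
          (a := k + 2) (by omega)) (Nat.lt_succ_self _) (Nat.lt_succ_self _),
        opB_comp_lastBlock (fun i hi => hj i (hP hi)) hjk (fun i hi => ?_) hdisj,
        TOp.comp_add, TOp.comp_smul ((hEk _ hs).composable (hB' P hP Q hQR) (Nat.lt_succ_self _)),
        smul_add, smul_smul, ← (hEj _ hs).comp_assoc (hg.mono le_rfl (show j + 1 ≤ (k : ℕ) from hjk))
          (hB Q hQR) (Nat.lt_succ_self _) (Nat.lt_succ_self _)]
      · exact (hEj _ hs).composable ((hg.mono le_rfl (show j + 1 ≤ (k : ℕ) from hjk)).comp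
          (hB Q hQR) (Nat.le_succ _)) (Nat.lt_succ_self _)
      · exact TOp.Composable.smul_right ((hEk _ hs).composable (hB' P hP Q hQR)
          (Nat.lt_succ_self _)) _
      · rcases Finset.mem_union.1 hi with h | h
        · exact hQ₀ i h
        · exact hRk i (hQR h)
    rw [hleft, Finset.sum_powerset_insert hjR]
    simp only [Finset.sum_add_distrib]
    congr 1
    -- These are the terms in which the absorbed set does not contain j: the passed block is put
    -- back into E'.
    · rw [sum_powerset_sdiff_comm R T₁]
      refine Finset.sum_congr rfl fun Q hQ => ?_
      rw [Finset.mem_powerset] at hQ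
      have hsub : R \ Q ⊆ R := Finset.sdiff_subset
      rw [Finset.insert_sdiff_of_notMem _ (fun h => hjR (hQ h)),
        opE'_insert fun i hi => hj i (hsub hi), TOp.sum_comp fun P hP => ?_, Finset.smul_sum]
      · refine Finset.sum_congr rfl fun P hP => ?_
        rw [sdiff_right_comm]
      · rw [Finset.mem_powerset] at hP
        have hg := tadm_lastBlock (fun i hi => hj i (hsub (hP hi))) (a := j + 1)
          (Nat.lt_succ_self _)
        exact ((hEj _ (Finset.sdiff_subset.trans hsub)).comp
          (hg.mono le_rfl (show j + 1 ≤ (k : ℕ) from hjk)) (Nat.le_succ _)).composable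
          (hB Q hQ) (Nat.lt_succ_self _)
    -- Here the absorbed set is S ∪ {j}, and summing over the block of j within it is the recursion
    -- for `treeF`.
    · rw [sum_powerset_sdiff R T₂]
      refine Finset.sum_congr rfl fun S hS => ?_
      rw [Finset.mem_powerset] at hS
      rw [treeF_insert k fun i hi => hj i (hS hi), Finset.sum_smul,
        Finset.insert_sdiff_insert, Finset.sdiff_insert_of_notMem hjR]
      refine Finset.sum_congr rfl fun P hP => ?_
      rw [Finset.mem_powerset] at hP
      have h1 : (R \ P) \ (S \ P) = R \ S := by
        rw [sdiff_sdiff_left, Finset.sup_eq_union, Finset.union_sdiff_of_subset hP]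
      have h2 : (Q₀ ∪ S \ P) ∪ insert j P = Q₀ ∪ insert j S := by
        rw [Finset.union_assoc, Finset.union_insert, Finset.sdiff_union_of_subset hP]
      simp only [T₂, h1, h2]

/-! ### The lowest coefficients of `treeF` -/

/-- The function is odd in t, so the error relative to the leading term ta has order t^2, not just
t. This precision is needed for the coefficient of t^{|Q|+1} later on. -/
theorem exists_sigmaT_eq (a : Coef m) :
    ∃ s : PowerSeries (Coef m), sigmaT a = PowerSeries.X * (PowerSeries.C a + PowerSeries.X ^ 2 * s) := by
  have h : (PowerSeries.X : PowerSeries (Coef m)) ^ 3 ∣ sigmaT a - PowerSeries.X * PowerSeries.C a := by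
    rw [PowerSeries.X_pow_dvd_iff]
    intro n hn
    rw [sigmaT, map_sub, map_sub, expT, expT, PowerSeries.coeff_mk, PowerSeries.coeff_mk,
      mul_comm, PowerSeries.coeff_C_mul, PowerSeries.coeff_X]
    interval_cases n
    · simp
    · simp only [pow_one, sub_neg_eq_add, ← add_smul, Nat.factorial_one, Nat.cast_one, inv_one,
        one_smul, if_true, mul_one]
      norm_num
    · simp
  obtain ⟨s, hs⟩ := h
  exact ⟨s, by linear_combination hs⟩

theorem treeT_insert {k : Fin m} {Q : Finset (Fin m)} (hk : ∀ j ∈ Q, j < k) :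
    (treeT (insert k Q) : Coef m) = (∏ i ∈ Q, var i) * abelTerm var (var k) Q := by
  have hkQ : k ∉ Q := fun h => lt_irrefl k (hk k h)
  have h0 : (blockSum (insert k Q) : Coef m) ≠ 0 := (lead_insert hk).ne_zero
  rw [treeT, Finset.prod_insert hkQ, Finset.card_insert_of_notMem hkQ, abelTerm]
  split_ifs with hQ
  · rw [hQ, blockSum_insert (Finset.notMem_empty k), blockSum]
    simp [var_ne_zero]
  · have h1 : 0 < Q.card := Finset.card_pos.2 (Finset.nonempty_iff_ne_empty.2 hQ)
    rw [show (((Q.card + 1 : ℕ) : ℤ) - 2) = ((Q.card - 1 : ℕ) : ℤ) by omega, zpow_natCast,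
      blockSum_insert hkQ, blockSum]
    ring

theorem treeT_mul_blockSum {j : Fin m} {P : Finset (Fin m)} (hj : ∀ i ∈ P, i < j) :
    (treeT (insert j P) * blockSum (insert j P) : Coef m) =
      (∏ i ∈ P, var i) * var j * (var j + ∑ i ∈ P, var i) ^ P.card := by
  have hjP : j ∉ P := fun h => lt_irrefl j (hj j h)
  have h0 : (blockSum (insert j P) : Coef m) ≠ 0 := (lead_insert hj).ne_zero
  rw [treeT, mul_assoc, ← zpow_add_one₀ h0, Finset.prod_insert hjP,
    Finset.card_insert_of_notMem hjP,
    show (((P.card + 1 : ℕ) : ℤ) - 2 + 1) = (P.card : ℤ) by push_cast; ring, zpow_natCast,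
    blockSum_insert hjP, blockSum]
  ring

/-- The factor of a block P is (-t)^{|P|} (w_k T(w_P) ∑_{i∈P} w_i + O(t^2)). Summing the leading
products over the block of the largest element of Q is exactly Hurwitz's identity, and gives the
tree polynomial of Q ∪ {k}. -/
theorem exists_treeF_eq {k : Fin m} {Q : Finset (Fin m)} (hk : ∀ i ∈ Q, i < k) :
    ∃ r : PowerSeries (Coef m), treeF k Q = (-PowerSeries.X) ^ Q.card *
      (PowerSeries.C (treeT (insert k Q)) + PowerSeries.X ^ 2 * r) := by
  induction Q using strong_induction_on_max with
  | h0 =>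
    refine ⟨0, ?_⟩
    rw [treeF_empty, treeT_insert hk]
    simp [abelTerm]
  | h1 j R hj ih =>
    have hjR : j ∉ R := fun h => lt_irrefl j (hj j h)
    have hkj : k ≠ j := (hk j (Finset.mem_insert_self j R)).ne'
    have hkR : k ∉ R := fun h => lt_irrefl k (hk k (Finset.mem_insert_of_mem h))
    have key : ∀ P ∈ R.powerset, ∃ r : PowerSeries (Coef m),
        treeF k (R \ P) * blockF k (insert j P) = (-PowerSeries.X) ^ (R.card + 1) *
          (PowerSeries.C ((∏ i ∈ R, var i) * var j * var k *
            (abelTerm var (var k) (R \ P) * (var j + ∑ i ∈ P, var i) ^ P.card)) +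
            PowerSeries.X ^ 2 * r) := by
      intro P hP
      rw [Finset.mem_powerset] at hP
      have hsk : ∀ i ∈ R \ P, i < k := fun i hi =>
        hk i (Finset.mem_insert_of_mem (Finset.sdiff_subset hi))
      obtain ⟨r, hr⟩ := ih (R \ P) Finset.sdiff_subset hsk
      obtain ⟨s, hs⟩ := exists_sigmaT_eq (var k * blockSum (insert j P) : Coef m)
      have hT := treeT_mul_blockSum (m := m) fun i hi => hj i (hP hi)
      have hc : R.card = (R \ P).card + P.card := (Finset.card_sdiff_add_card_eq_card hP).symm
      have hC : (PowerSeries.C (treeT (insert k (R \ P))) : PowerSeries (Coef m)) *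
          (PowerSeries.C (treeT (insert j P)) * PowerSeries.C (var k * blockSum (insert j P))) =
          PowerSeries.C ((∏ i ∈ R, var i) * var j * var k *
            (abelTerm var (var k) (R \ P) * (var j + ∑ i ∈ P, var i) ^ P.card)) := by
        rw [← map_mul, ← map_mul, treeT_insert hsk, ← Finset.prod_sdiff hP]
        congr 1
        linear_combination (∏ i ∈ R \ P, var i) * abelTerm var (var k) (R \ P) * var k * hT
      refine ⟨PowerSeries.C (treeT (insert k (R \ P))) * PowerSeries.C (treeT (insert j P)) * s +
        r * PowerSeries.C (treeT (insert j P)) *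
          (PowerSeries.C (var k * blockSum (insert j P)) + PowerSeries.X ^ 2 * s), ?_⟩
      rw [← hC, hr, blockF, hs, Finset.card_insert_of_notMem fun h => hjR (hP h),
        Nat.add_sub_cancel, hc]
      ring
    choose! r hr using key
    refine ⟨∑ P ∈ R.powerset, r P, ?_⟩
    -- Hurwitz's identity with x = w_k, the sum inside the blocks not containing j, and y = w_j.
    have hT : (treeT (insert k (insert j R)) : Coef m) = ∑ P ∈ R.powerset,
        (∏ i ∈ R, var i) * var j * var k *
            (abelTerm var (var k) (R \ P) * (var j + ∑ i ∈ P, var i) ^ P.card) := by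
      rw [treeT_insert hk, ← Finset.mul_sum, hurwitz_identity, Finset.prod_insert hjR, abelTerm,
        if_neg (Finset.insert_ne_empty j R), Finset.card_insert_of_notMem hjR, Nat.add_sub_cancel,
        Finset.sum_insert hjR]
      ring
    rw [treeF_insert k hj, Finset.sum_congr rfl hr, ← Finset.mul_sum, Finset.sum_add_distrib,
      ← Finset.mul_sum, hT, map_sum, Finset.card_insert_of_notMem hjR]

/-! ### The factor of a block in `M` -/

/-- The coefficient of a block with maximal element `k` in the recursion for `M`. -/
def opX (k : Fin m) (Q : Finset (Fin m)) : TOp m :=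
  ((-1 : PowerSeries (Coef m)) ^ Q.card) • (treeF k Q • opB k Q) -
    (PowerSeries.X : PowerSeries (Coef m)) ^ Q.card •
      TOp.const (treeT (insert k Q) • opA0 (blockSum (insert k Q)))

theorem opB_zero (k : Fin m) (Q : Finset (Fin m)) : opB k Q 0 = opA0 (blockSum (insert k Q)) := by
  rw [opB, TOp.smul_apply, Finset.HasAntidiagonal.antidiagonal_zero, Finset.sum_singleton,
    opAGen_zero, powT, expT, PowerSeries.coeff_mk]
  simp

theorem opB_one {k : Fin m} {Q : Finset (Fin m)} (hk : ∀ i ∈ Q, i < k) :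
    opB k Q 1 = (var k * logOnePlus (blockSum Q / var k)) • opA (blockSum (insert k Q)) 0 +
      (var k / blockSum (insert k Q)) • opA (blockSum (insert k Q)) 1 := by
  rw [opB, TOp.smul_apply, Finset.Nat.sum_antidiagonal_succ, Finset.HasAntidiagonal.antidiagonal_zero,
    Finset.sum_singleton, opAGen_one _ (lead_insert hk).ne_zero, opAGen_zero, powT, expT,
    PowerSeries.coeff_mk, PowerSeries.coeff_mk, opA_eq, opAGen_zero, add_comm]
  simp

/-- The sign (-1)^{|Q|} turns the leading term of `treeF` into t^{|Q|} T, the same factor as in the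
subtracted term. What remains is T(B_k(Q) - A^0) up to an error of relative order t^2. -/
theorem exists_opX_eq {k : Fin m} {Q : Finset (Fin m)} (hk : ∀ i ∈ Q, i < k) :
    ∃ r : PowerSeries (Coef m), opX k Q = (PowerSeries.X : PowerSeries (Coef m)) ^ Q.card •
      (PowerSeries.C (treeT (insert k Q)) • (opB k Q - TOp.const (opA0 (blockSum (insert k Q)))) +
        (PowerSeries.X : PowerSeries (Coef m)) ^ 2 • (r • opB k Q)) := by
  obtain ⟨r, hr⟩ := exists_treeF_eq hk
  refine ⟨r, ?_⟩
  have h1 : (-1 : PowerSeries (Coef m)) ^ Q.card * treeF k Q =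
      PowerSeries.X ^ Q.card * (PowerSeries.C (treeT (insert k Q)) + PowerSeries.X ^ 2 * r) := by
    rw [hr, ← mul_assoc, ← mul_pow]
    simp
  rw [opX, smul_smul, h1, TOp.const_smul, mul_smul, ← smul_sub, add_smul, mul_smul,
    add_sub_right_comm, ← smul_sub]

theorem opX_of_le {k : Fin m} {Q : Finset (Fin m)} (hk : ∀ i ∈ Q, i < k) {n : ℕ}
    (hn : n ≤ Q.card) : opX k Q n = 0 := by
  obtain ⟨r, hr⟩ := exists_opX_eq hk
  rw [hr, TOp.X_pow_smul]
  split_ifs with h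
  · obtain rfl : n = Q.card := le_antisymm hn h
    rw [Nat.sub_self, Pi.add_apply, TOp.C_smul, TOp.X_pow_smul, if_neg (by norm_num), add_zero,
      Pi.sub_apply, opB_zero, TOp.const, if_pos rfl, sub_self, smul_zero]
  · rfl

theorem opX_succ {k : Fin m} {Q : Finset (Fin m)} (hk : ∀ i ∈ Q, i < k) :
    opX k Q (Q.card + 1) = opAvee (insert k Q) k := by
  obtain ⟨r, hr⟩ := exists_opX_eq hk
  have hkQ : k ∉ Q := fun h => lt_irrefl k (hk k h)
  rw [hr, TOp.X_pow_smul, if_pos (Nat.le_succ _), Nat.add_sub_cancel_left, Pi.add_apply,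
    TOp.C_smul, TOp.X_pow_smul, if_neg (by norm_num), add_zero, Pi.sub_apply, TOp.const,
    if_neg one_ne_zero, sub_zero, opB_one hk, opAvee, Finset.erase_insert hkQ]

/-! ### Products of operators of increasing levels -/

section Leveled

variable {f : ι → TOp m} {l : ι → ℕ} {a' b' : ℕ} {T : List (TOp m)} {L : List ι}

theorem TAdm.prod_append (h : ∀ i ∈ L, TAdm (l i) (l i) (f i))
    (hL : L.Pairwise fun i j => l i < l j) (hT : TAdm a' b' (TOp.prod T)) (ha' : ∀ i ∈ L, l i ≤ a')
    {a : ℕ} (ha : ∀ i ∈ L, a ≤ l i) (haa : a ≤ a') : TAdm a b' (TOp.prod (L.map f ++ T)) := by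
  induction L generalizing a with
  | nil => exact hT.mono haa le_rfl
  | cons i L ih =>
    rw [List.forall_mem_cons] at h ha ha'
    rw [List.pairwise_cons] at hL
    exact (h.1.comp (ih h.2 hL.2 ha'.2 (fun j hj => (hL.1 j hj).le) ha'.1) le_rfl).mono ha.1 le_rfl

theorem TAdm.prodDefined_append (h : ∀ i ∈ L, TAdm (l i) (l i) (f i))
    (hL : L.Pairwise fun i j => l i < l j) (hT : TAdm a' b' (TOp.prod T)) (ha' : ∀ i ∈ L, l i < a')
    (hTd : TOp.ProdDefined T) : TOp.ProdDefined (L.map f ++ T) := by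
  induction L with
  | nil => exact hTd
  | cons i L ih =>
    rw [List.forall_mem_cons] at h ha'
    rw [List.pairwise_cons] at hL
    exact ⟨h.1.composable (TAdm.prod_append h.2 hL.2 hT (fun j hj => (ha'.2 j hj).le)
      (fun j hj => hL.1 j hj) ha'.1) (Nat.lt_succ_self _), ih h.2 hL.2 ha'.2⟩

/-- Strictly increasing levels permit reassociation at each junction. The empty product ends at
level a' - 1, the largest level strictly below that of the tail. -/
theorem TAdm.prod_append_eq (h : ∀ i ∈ L, TAdm (l i) (l i) (f i))
    (hL : L.Pairwise fun i j => l i < l j) (hT : TAdm a' b' (TOp.prod T)) (ha' : ∀ i ∈ L, l i < a') :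
    TOp.prod (L.map f ++ T) = (TOp.prod (L.map f)).comp (TOp.prod T) := by
  induction L with
  | nil => exact (TOp.id_comp _).symm
  | cons i L ih =>
    rw [List.forall_mem_cons] at h ha'
    rw [List.pairwise_cons] at hL
    cases L with
    | nil =>
      change (f i).comp (TOp.prod T) = ((f i).comp (TOp.const (Op.id m))).comp (TOp.prod T)
      rw [TOp.comp_id]
    | cons j L =>
      have hid : TAdm (a' - 1) (a' - 1) (TOp.prod ([] : List (TOp m))) := TAdm.const (adm_id _)
      have hij := hL.1 j List.mem_cons_self
      have hj := ha'.2 j List.mem_cons_self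
      have h1 := TAdm.prod_append (a := l i + 1) h.2 hL.2 hid
        (fun j hj => Nat.le_sub_one_of_lt (ha'.2 j hj)) (fun j hj => hL.1 j hj) (by omega)
      rw [List.append_nil] at h1
      rw [List.map_cons, List.cons_append, TOp.prod, ih h.2 hL.2 ha'.2, TOp.prod,
        h.1.comp_assoc h1 hT (Nat.lt_succ_self _) (by omega)]

theorem TAdm.prod (h : ∀ i ∈ L, TAdm (l i) (l i) (f i)) (hL : L.Pairwise fun i j => l i < l j)
    {a b : ℕ} (ha : ∀ i ∈ L, a ≤ l i) (hb : ∀ i ∈ L, l i ≤ b) (hab : a ≤ b) :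
    TAdm a b (TOp.prod (L.map f)) := by
  have hid : TAdm b b (TOp.prod ([] : List (TOp m))) := TAdm.const (adm_id _)
  have h1 := TAdm.prod_append h hL hid hb ha hab
  rwa [List.append_nil] at h1

end Leveled

theorem TOp.const_zero (X : Op m) : TOp.const X 0 = X := if_pos rfl

theorem TOp.prod_map_const (L : List (Op m)) :
    TOp.prod (L.map TOp.const) = TOp.const (Op.prod L) := by
  induction L with
  | nil => rfl
  | cons X L ih => rw [List.map_cons, TOp.prod, ih, TOp.const_comp_const, Op.prod]

theorem Op.prodDefined_of_const {L : List (Op m)} (h : TOp.ProdDefined (L.map TOp.const)) :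
    Op.ProdDefined L := by
  induction L with
  | nil => trivial
  | cons X L ih =>
    obtain ⟨h1, h2⟩ := h
    rw [TOp.prod_map_const] at h1
    have h3 := h1 0 0
    rw [TOp.const_zero, TOp.const_zero] at h3
    exact ⟨h3, ih h2⟩

/-! ### The recursion for `M` -/

/-- `∏_{i ∈ R} A(w_i)`, ordered by increasing index. -/
def prodA (R : Finset (Fin m)) : TOp m :=
  TOp.prod (((List.finRange m).filter fun i => i ∈ R).map fun i => opA (var i))

theorem tadm_opA (i : Fin m) : TAdm (i + 1) (i + 1) (opA (var i : Coef m)) := by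
  rw [← opB_empty]
  exact tadm_opB fun j hj => absurd hj (Finset.notMem_empty j)

theorem pairwise_filter_finRange (p : Fin m → Bool) :
    ((List.finRange m).filter p).Pairwise fun i j : Fin m => (i : ℕ) + 1 < (j : ℕ) + 1 :=
  ((List.sortedLT_finRange m).pairwise.filter _).imp fun h => Nat.succ_lt_succ h

theorem tadm_prodA {R : Finset (Fin m)} {k : ℕ} (hk : ∀ i ∈ R, (i : ℕ) < k) :
    TAdm 0 k (prodA R) :=
  TAdm.prod (l := fun i : Fin m => (i : ℕ) + 1) (fun i _ => tadm_opA i)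
    (pairwise_filter_finRange _) (fun _ _ => Nat.zero_le _)
    (fun i hi => hk i (of_decide_eq_true (List.mem_filter.1 hi).2)) (Nat.zero_le _)

theorem prodA_insert {k : Fin m} {R : Finset (Fin m)} (hk : ∀ i ∈ R, i < k) :
    prodA (insert k R) = (prodA R).comp (opA (var k)) := by
  have h : ((List.finRange m).filter fun i => i ∈ insert k R) =
      ((List.finRange m).filter fun i => i ∈ R) ++ [k] := by
    refine List.Pairwise.eq_of_mem_iff (r := (· < ·))
      ((List.sortedLT_finRange m).pairwise.filter _)
      (List.pairwise_append.2 ⟨(List.sortedLT_finRange m).pairwise.filter _,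
        List.pairwise_singleton _ _, fun i hi j hj => ?_⟩) fun i => ?_
    · rw [List.mem_singleton.1 hj]
      exact hk i (of_decide_eq_true (List.mem_filter.1 hi).2)
    · simp [or_comm]
  have hT : TOp.prod [opA (var k : Coef m)] = opA (var k) := TOp.comp_id _
  have h1 := TAdm.prod_append_eq (f := fun i : Fin m => opA (var i : Coef m))
    (l := fun i : Fin m => (i : ℕ) + 1) (L := (List.finRange m).filter fun i => i ∈ R)
    (T := [opA (var k)]) (fun i _ => tadm_opA i) (pairwise_filter_finRange _)
    (hT.symm ▸ tadm_opA k) fun i hi =>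
      Nat.succ_lt_succ (hk i (of_decide_eq_true (List.mem_filter.1 hi).2))
  rw [prodA, h, List.map_append, List.map_singleton, h1, hT, prodA]

/-- `∑_{S ⊂ R} (-1)^{|S|} ∏_{i ∈ R \ S} A(w_i) E'(w_S)`. -/
def opN (R : Finset (Fin m)) : TOp m :=
  ∑ S ∈ R.powerset, ((-1 : PowerSeries (Coef m)) ^ S.card) • (prodA (R \ S)).comp (opE' S)

theorem opX_eq (k : Fin m) (Q : Finset (Fin m)) :
    opX k Q = ((-1 : PowerSeries (Coef m)) ^ Q.card) •
      (treeF k Q • opB k Q + (-1 : PowerSeries (Coef m)) • lastBlock k Q) := by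
  have h : (-1 : PowerSeries (Coef m)) ^ Q.card * (-1 * (-PowerSeries.X) ^ Q.card) =
      -PowerSeries.X ^ Q.card := by
    rw [mul_left_comm, ← mul_pow, neg_one_mul, neg_one_mul, neg_neg]
  rw [opX, lastBlock, smul_add, smul_smul (-1 : PowerSeries (Coef m)),
    smul_smul _ (-1 * (-PowerSeries.X : PowerSeries (Coef m)) ^ Q.card), h, neg_smul,
    sub_eq_add_neg]

/-- The two parts are composable for different reasons: B_k(Q) has the higher level k + 1, while the
term with A^0 does not raise the energy. -/
theorem composable_opX {k : Fin m} {Q : Finset (Fin m)} (hk : ∀ i ∈ Q, i < k) {W : TOp m}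
    (hW : TAdm 0 k W) : W.Composable (opX k Q) := by
  have h3 : W.Composable (treeF k Q • opB k Q) :=
    (hW.composable (tadm_opB hk) (Nat.lt_succ_self _)).smul_right _
  have h4 : W.Composable ((-1 : PowerSeries (Coef m)) • lastBlock k Q) :=
    ((ttri_lastBlock k Q).composable W).smul_right _
  have h5 : W.Composable (treeF k Q • opB k Q + (-1 : PowerSeries (Coef m)) • lastBlock k Q) :=
    fun i j => (h3 i j).add_right (h4 i j)
  rw [opX_eq]
  exact h5.smul_right _

theorem comp_opX {k : Fin m} {Q : Finset (Fin m)} (hk : ∀ i ∈ Q, i < k) {W : TOp m}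
    (hW : TAdm 0 k W) :
    W.comp (opX k Q) = ((-1 : PowerSeries (Coef m)) ^ Q.card) •
      (treeF k Q • W.comp (opB k Q) + (-1 : PowerSeries (Coef m)) • W.comp (lastBlock k Q)) := by
  have h1 : W.Composable (opB k Q) := hW.composable (tadm_opB hk) (Nat.lt_succ_self _)
  have h2 : W.Composable (lastBlock k Q) := (ttri_lastBlock k Q).composable W
  have h3 : W.Composable (treeF k Q • opB k Q) := h1.smul_right _
  have h4 : W.Composable ((-1 : PowerSeries (Coef m)) • lastBlock k Q) := h2.smul_right _
  have h5 : W.Composable (treeF k Q • opB k Q + (-1 : PowerSeries (Coef m)) • lastBlock k Q) :=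
    fun i j => (h3 i j).add_right (h4 i j)
  rw [opX_eq, TOp.comp_smul h5, TOp.comp_add h3 h4, TOp.comp_smul h1, TOp.comp_smul h2]

theorem prodA_comp_opE'_insert {k : Fin m} {R S : Finset (Fin m)} (hk : ∀ i ∈ R, i < k)
    (hS : S ⊆ R) :
    (prodA (insert k R \ S)).comp (opE' S) = ∑ Q ∈ S.powerset,
      treeF k Q • ((prodA (R \ S)).comp (opE' (S \ Q))).comp (opB k Q) := by
  have hkS : k ∉ S := fun h => lt_irrefl k (hk k (hS h))
  have hP : TAdm 0 k (prodA (R \ S)) := tadm_prodA fun i hi => hk i (Finset.sdiff_subset hi)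
  have hE : ∀ Q ⊆ S, TAdm k k (opE' (S \ Q)) := fun Q _ =>
    tadm_opE' fun i hi => hk i (hS (Finset.sdiff_subset hi))
  have hB : ∀ Q ⊆ S, TAdm (k + 1) (k + 1) (opB k Q) := fun Q hQ => tadm_opB fun i hi =>
    hk i (hS (hQ hi))
  have hc : ∀ Q ∈ S.powerset, (prodA (R \ S)).Composable ((opE' (S \ Q)).comp (opB k Q)) :=
    fun Q hQ => hP.composable_comp_of_tri (hE Q (Finset.mem_powerset.1 hQ))
      (hB Q (Finset.mem_powerset.1 hQ)) le_rfl (Nat.lt_succ_self _) (ttri_opE' _)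
  have hc' : ∀ Q ∈ S.powerset, (prodA (R \ S)).Composable
      (treeF k Q • (opE' (S \ Q)).comp (opB k Q)) := fun Q hQ => (hc Q hQ).smul_right _
  have hM := opB_comp_opE' (fun i hi => hk i (hS hi)) (Q₀ := ∅)
    (fun i hi => absurd hi (Finset.notMem_empty i)) (Finset.disjoint_empty_left S)
  simp only [Finset.empty_union] at hM
  -- As k is the largest index, A(w_k) is the last of the factors A, directly to the left of E', and
  -- can be moved past it.
  rw [Finset.insert_sdiff_of_notMem _ hkS, prodA_insert fun i hi => hk i (Finset.sdiff_subset hi),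
    hP.comp_assoc (tadm_opA k) (tadm_opE' (a := k + 2) fun i hi =>
      (show (i : ℕ) < k from hk i (hS hi)).trans (by omega)) (Nat.lt_succ_self _)
      (Nat.lt_succ_self _), ← opB_empty, hM, TOp.comp_sum hc']
  refine Finset.sum_congr rfl fun Q hQ => ?_
  rw [TOp.comp_smul (hc Q hQ), hP.comp_assoc_of_tri (hE Q (Finset.mem_powerset.1 hQ))
      (hB Q (Finset.mem_powerset.1 hQ)) le_rfl (Nat.lt_succ_self _) (ttri_opE' _)]

theorem prodA_comp_opE'_insert_insert {k : Fin m} {R S : Finset (Fin m)} (hk : ∀ i ∈ R, i < k)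
    (hS : S ⊆ R) :
    (prodA (insert k R \ insert k S)).comp (opE' (insert k S)) = ∑ Q ∈ S.powerset,
      ((prodA (R \ S)).comp (opE' (S \ Q))).comp (lastBlock k Q) := by
  have hkR : k ∉ R := fun h => lt_irrefl k (hk k h)
  have hc : ∀ Q ∈ S.powerset, (prodA (R \ S)).Composable ((opE' (S \ Q)).comp (lastBlock k Q)) :=
    fun Q _ => ((ttri_opE' _).comp (ttri_lastBlock _ _)).composable _
  rw [Finset.insert_sdiff_insert, Finset.sdiff_insert_of_notMem hkR,
    opE'_insert fun i hi => hk i (hS hi), TOp.comp_sum hc]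
  exact Finset.sum_congr rfl fun Q _ => ((ttri_opE' _).comp_assoc (ttri_lastBlock _ _) _).symm

/-- Both the terms without k in S and those with k in S become sums over Q ⊆ S of a product for S \
Q followed by a factor depending on k and Q only. The extra sign for k ∈ S gives the difference in
`opX`, and (-1)^{|S|} splits as (-1)^{|S\Q|} (-1)^{|Q|}. -/
theorem opN_insert {k : Fin m} {R : Finset (Fin m)} (hk : ∀ i ∈ R, i < k) :
    opN (insert k R) = ∑ Q ∈ R.powerset, (opN (R \ Q)).comp (opX k Q) := by
  have hkR : k ∉ R := fun h => lt_irrefl k (hk k h)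
  set g : Finset (Fin m) → Finset (Fin m) → TOp m := fun Q S =>
    ((-1 : PowerSeries (Coef m)) ^ S.card) •
      ((prodA ((R \ Q) \ S)).comp (opE' S)).comp (opX k Q)
  have hX : ∀ Q ⊆ R, ∀ S ⊆ R \ Q, TAdm 0 k ((prodA ((R \ Q) \ S)).comp (opE' S)) :=
    fun Q _ S hS => (tadm_prodA fun i hi =>
      hk i (Finset.sdiff_subset (Finset.sdiff_subset hi))).comp
      (tadm_opE' fun i hi => hk i (Finset.sdiff_subset (hS hi))) le_rfl
  have hright : ∑ Q ∈ R.powerset, (opN (R \ Q)).comp (opX k Q) =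
      ∑ Q ∈ R.powerset, ∑ S ∈ (R \ Q).powerset, g Q S := by
    refine Finset.sum_congr rfl fun Q hQ => ?_
    rw [Finset.mem_powerset] at hQ
    have hQk : ∀ i ∈ Q, i < k := fun i hi => hk i (hQ hi)
    have hW : ∀ S ∈ (R \ Q).powerset,
        TAdm 0 k ((prodA ((R \ Q) \ S)).comp (opE' S)) := fun S hS =>
      hX Q hQ S (Finset.mem_powerset.1 hS)
    have hc : ∀ S ∈ (R \ Q).powerset, (((-1 : PowerSeries (Coef m)) ^ S.card) •
        (prodA ((R \ Q) \ S)).comp (opE' S)).Composable (opX k Q) := fun S hS =>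
      composable_opX hQk ((hW S hS).smul (pow_mem (neg_mem (one_mem _)) _))
    rw [opN, TOp.sum_comp hc]
    exact Finset.sum_congr rfl fun S hS => TOp.smul_comp (composable_opX hQk (hW S hS)) _
  rw [hright, sum_powerset_sdiff, opN, Finset.sum_powerset_insert hkR, ← Finset.sum_add_distrib]
  refine Finset.sum_congr rfl fun S hS => ?_
  rw [Finset.mem_powerset] at hS
  have hkS : k ∉ S := fun h => hkR (hS h)
  rw [prodA_comp_opE'_insert hk hS, prodA_comp_opE'_insert_insert hk hS,
    Finset.card_insert_of_notMem hkS, pow_succ, mul_smul, ← smul_add, Finset.smul_sum,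
    ← Finset.sum_add_distrib, Finset.smul_sum]
  refine Finset.sum_congr rfl fun Q hQ => ?_
  rw [Finset.mem_powerset] at hQ
  have h1 : (R \ Q) \ (S \ Q) = R \ S := by
    rw [sdiff_sdiff_left, Finset.sup_eq_union, Finset.union_sdiff_of_subset hQ]
  have h2 := hX Q (hQ.trans hS) (S \ Q) (Finset.sdiff_subset_sdiff hS le_rfl)
  rw [h1] at h2
  simp only [g, h1]
  rw [comp_opX (fun i hi => hk i (hS (hQ hi))) h2, smul_smul, ← _root_.pow_add,
    Finset.card_sdiff_add_card_eq_card hQ]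

/-! ### The lowest coefficients of `M` -/

/-- In the recursion N(R \ Q) starts at order |R \ Q| by induction and X(k,Q) at order |Q| + 1, so
each product starts at order |R| + 1. -/
theorem opN_of_lt {R : Finset (Fin m)} {n : ℕ} (hn : n < R.card) : opN R n = 0 := by
  induction R using strong_induction_on_max generalizing n with
  | h0 => exact absurd hn (Nat.not_lt_zero n)
  | h1 k R hk ih =>
    have hkR : k ∉ R := fun h => lt_irrefl k (hk k h)
    rw [Finset.card_insert_of_notMem hkR] at hn
    rw [opN_insert hk, Finset.sum_apply]
    refine Finset.sum_eq_zero fun Q hQ => Finset.sum_eq_zero fun p hp => ?_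
    rw [Finset.mem_powerset] at hQ
    rw [Finset.HasAntidiagonal.mem_antidiagonal] at hp
    have hc := Finset.card_sdiff_add_card_eq_card hQ
    rcases Nat.lt_or_ge p.1 (R \ Q).card with h | h
    · rw [ih _ Finset.sdiff_subset h, Op.zero_comp]
    · rw [opX_of_le (fun i hi => hk i (hQ hi)) (by omega), Op.comp_zero]

theorem adm_opAvee {P : Finset (Fin m)} {k : Fin m} (hk : k ∈ P) (hP : ∀ j ∈ P, j ≤ k) :
    Adm (k + 1) (k + 1) (opAvee P k) := by
  have hQ : ∀ j ∈ P.erase k, j < k := fun j hj =>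
    (hP j (Finset.mem_of_mem_erase hj)).lt_of_ne (Finset.ne_of_mem_erase hj)
  -- Up to the scalar T, A^∨ is the linear coefficient of B_k, and so it has the same level.
  have h : opAvee P k = treeT P • opB k (P.erase k) 1 := by
    rw [opB_one hQ, Finset.insert_erase hk, opAvee]
  rw [h]
  exact (tadm_opB hQ 1).smul_bdd (bdd_treeT hk hP).choose_spec

section PartitionCode

variable {S : Finset (Fin m)} (π : Finpartition S)

theorem tadm_opAvee : ∀ p ∈ partitionCode π,
    TAdm ((p.2 : ℕ) + 1) ((p.2 : ℕ) + 1) (TOp.const (opAvee p.1 p.2)) := fun _ hp =>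
  TAdm.const (adm_opAvee (mem_partitionCode hp).2.1 (mem_partitionCode hp).2.2)

theorem pairwise_level_partitionCode :
    (partitionCode π).Pairwise fun p q => (p.2 : ℕ) + 1 < (q.2 : ℕ) + 1 :=
  (pairwise_partitionCode π).imp fun h => Nat.succ_lt_succ h

theorem prod_opAvee_append {a' b' : ℕ} {Y : Op m} (hY : Adm a' b' Y)
    (ha' : ∀ p ∈ partitionCode π, (p.2 : ℕ) + 1 < a') :
    Op.prod ((partitionCode π).map (fun p => opAvee p.1 p.2) ++ [Y]) =
      (Op.prod ((partitionCode π).map fun p => opAvee p.1 p.2)).comp Y := by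
  have hT : TOp.prod [TOp.const Y] = TOp.const Y := TOp.comp_id _
  have h1 := TAdm.prod_append_eq (tadm_opAvee π) (pairwise_level_partitionCode π)
    (T := [TOp.const Y]) (hT.symm ▸ TAdm.const hY) ha'
  have h2 := TOp.prod_map_const ((partitionCode π).map (fun p => opAvee p.1 p.2) ++ [Y])
  have h3 := TOp.prod_map_const ((partitionCode π).map fun p => opAvee p.1 p.2)
  rw [List.map_append, List.map_map, List.map_singleton] at h2
  rw [List.map_map] at h3
  have h4 := h2.symm.trans h1
  rw [hT] at h4
  have h5 := h4.trans (congrArg (fun Z => TOp.comp Z (TOp.const Y)) h3)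
  rw [TOp.const_comp_const] at h5
  have h6 := congrFun h5 0
  rwa [TOp.const_zero, TOp.const_zero] at h6

end PartitionCode

/-- In the lowest order only the product of the two leading coefficients survives, and it appends
the factor A^∨ of the block of k on the right. This matches the recursion for set partitions and
their order by maxima. -/
theorem opN_card (R : Finset (Fin m)) : opN R R.card =
    ∑ π : Finpartition R, Op.prod ((partitionCode π).map fun p => opAvee p.1 p.2) := by
  induction R using strong_induction_on_max with
  | h0 =>
    rw [sum_finpartition_empty fun L => Op.prod (L.map fun p => opAvee p.1 p.2), opN,
      Finset.powerset_empty, Finset.sum_singleton, Finset.card_empty, pow_zero, one_smul,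
      Finset.sdiff_empty, opE', blockE_empty, TOp.comp_id, prodA, List.map_nil, Op.prod]
    simp [TOp.prod, TOp.const_zero]
  | h1 k R hk ih =>
    have hkR : k ∉ R := fun h => lt_irrefl k (hk k h)
    rw [sum_finpartition_insert hk fun L => Op.prod (L.map fun p => opAvee p.1 p.2),
      opN_insert hk, Finset.sum_apply, Finset.card_insert_of_notMem hkR]
    refine Finset.sum_congr rfl fun Q hQ => ?_
    rw [Finset.mem_powerset] at hQ
    have hQk : ∀ i ∈ Q, i < k := fun i hi => hk i (hQ hi)
    have hc := Finset.card_sdiff_add_card_eq_card hQ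
    have hA : Adm (k + 1) (k + 1) (opAvee (insert k Q) k) :=
      adm_opAvee (Finset.mem_insert_self k Q) fun j hj => by
        rcases Finset.mem_insert.1 hj with rfl | hj
        · exact le_rfl
        · exact (hQk j hj).le
    have hlt : ∀ (π : Finpartition (R \ Q)), ∀ p ∈ partitionCode π, (p.2 : ℕ) + 1 < (k : ℕ) + 1 :=
      fun π p hp => Nat.succ_lt_succ (hk p.2 (Finset.sdiff_subset
        ((mem_partitionCode hp).1 (mem_partitionCode hp).2.1)))
    have happ : ∀ π : Finpartition (R \ Q),
        Op.prod ((partitionCode π ++ [(insert k Q, k)]).map fun p => opAvee p.1 p.2) =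
        (Op.prod ((partitionCode π).map fun p => opAvee p.1 p.2)).comp (opAvee (insert k Q) k) :=
      fun π => by rw [List.map_append, List.map_singleton, prod_opAvee_append π hA (hlt π)]
    have hprod : ∀ π : Finpartition (R \ Q),
        (Op.prod ((partitionCode π).map fun p => opAvee p.1 p.2)).Composable
          (opAvee (insert k Q) k) := fun π => by
      have h1 := TAdm.prod (a := 0) (b := k) (tadm_opAvee π) (pairwise_level_partitionCode π)
        (fun _ _ => Nat.zero_le _) (fun p hp => Nat.le_of_lt_succ (hlt π p hp)) (Nat.zero_le _)
      have h3 := TOp.prod_map_const ((partitionCode π).map fun p => opAvee p.1 p.2)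
      rw [List.map_map] at h3
      have h4 : TAdm 0 k (TOp.const (Op.prod ((partitionCode π).map fun p => opAvee p.1 p.2))) :=
        h3 ▸ h1
      have h5 := h4 0
      rw [TOp.const_zero] at h5
      exact h5.composable hA (Nat.lt_succ_self _)
    simp only [happ]
    rw [← Op.sum_comp fun π _ => hprod π, ← ih _ Finset.sdiff_subset, ← opX_succ hQk, TOp.comp]
    -- For any other splitting of |R| + 1, one of the two coefficients lies below its lowest order
    -- and vanishes.
    refine Finset.sum_eq_single (((R \ Q).card, Q.card + 1) : ℕ × ℕ) (fun p hp hne => ?_)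
      fun h => absurd ?_ h
    · rw [Finset.HasAntidiagonal.mem_antidiagonal] at hp
      rcases Nat.lt_or_ge p.1 (R \ Q).card with h | h
      · rw [opN_of_lt h, Op.zero_comp]
      · have h2 : p.2 ≤ Q.card := by
          by_contra hgt
          exact hne (Prod.ext (by omega) (by omega))
        rw [opX_of_le hQk h2, Op.comp_zero]
    · rw [Finset.HasAntidiagonal.mem_antidiagonal]
      omega

/-! ### The operator `M` -/

section Factors

variable (S : Finset (Fin m))

theorem tadm_prod_tail : TAdm (m + 1) (m + 1)
    (TOp.prod [TOp.const (expAlpha1 m), opE S (-PowerSeries.X)]) := by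
  have h : TAdm (m + 1) (m + 1) (opE S (-PowerSeries.X)) :=
    tadm_blockE isBlockOp_calE0 neg_X_mem fun i _ => i.2.trans (Nat.lt_succ_self m)
  rw [TOp.prod, TOp.prod, TOp.prod, TOp.comp_id]
  exact (TAdm.const (adm_expAlpha1 (Nat.lt_succ_self m))).comp h le_rfl

theorem prodDefined_factorsM : TOp.ProdDefined (factorsM S) := by
  refine TAdm.prodDefined_append (l := fun i : Fin m => (i : ℕ) + 1) (fun i _ => tadm_opA i)
    (pairwise_filter_finRange _) (tadm_prod_tail S) (fun i _ => Nat.succ_lt_succ i.2)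
    ⟨?_, ?_, trivial⟩
  · rw [TOp.prod, TOp.prod, TOp.comp_id]
    exact (ttri_blockE isBlockOp_calE0 _ _).composable _
  · exact (TTri.const Tri.id).composable _

theorem prod_factorsM : TOp.prod (factorsM S) =
    ((prodA (Finset.univ \ S)).comp (opE' S)).comp (TOp.const (expAlpha1 m)) := by
  have h1 := TAdm.prod_append_eq (l := fun i : Fin m => (i : ℕ) + 1)
    (L := (List.finRange m).filter fun i => i ∉ S) (fun i _ => tadm_opA i)
    (pairwise_filter_finRange _) (tadm_prod_tail S) fun i _ => Nat.succ_lt_succ i.2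
  have h2 : prodA (Finset.univ \ S) =
      TOp.prod (((List.finRange m).filter fun i => i ∉ S).map fun i => opA (var i)) := by
    rw [prodA]
    simp
  rw [factorsM, h1, ← h2, TOp.prod, TOp.prod, TOp.prod, TOp.comp_id, expAlpha1_comp_opE,
    (ttri_opE' S).comp_assoc (TTri.const tri_expAlpha1)]

end Factors

/-- In every term e^{α_1} is moved to the far right, turning E into E', and can then be factored out
of the sum over S. -/
theorem opM_eq (m : ℕ) : opM m = (opN Finset.univ).comp (TOp.const (expAlpha1 m)) := by
  have hα : ∀ A : TOp m, A.Composable (TOp.const (expAlpha1 m)) := fun A =>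
    (TTri.const tri_expAlpha1).composable A
  rw [opN, TOp.sum_comp fun S _ => hα _, opM, Finset.powerset_univ]
  refine Finset.sum_congr rfl fun S _ => ?_
  rw [TOp.smul_comp (hα _), ← prod_factorsM]
  rcases Nat.even_or_odd S.card with h | h
  · rw [h.neg_one_pow, h.neg_one_pow, one_smul, one_smul]
  · rw [h.neg_one_pow, h.neg_one_pow, neg_one_smul, neg_smul, one_smul]

theorem factorsAvee_eq (π : Finpartition (Finset.univ : Finset (Fin m))) :
    factorsAvee π = (partitionCode π).map (fun p => opAvee p.1 p.2) ++ [expAlpha1 m] := by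
  simp only [factorsAvee, partitionCode, List.map_map, Function.comp_def]

theorem prodDefined_factorsAvee (π : Finpartition (Finset.univ : Finset (Fin m))) :
    Op.ProdDefined (factorsAvee π) := by
  have hT : TOp.prod [TOp.const (expAlpha1 m)] = TOp.const (expAlpha1 m) := TOp.comp_id _
  have h1 := TAdm.prodDefined_append (tadm_opAvee π) (pairwise_level_partitionCode π)
    (T := [TOp.const (expAlpha1 m)])
    (hT.symm ▸ TAdm.const (adm_expAlpha1 (Nat.lt_succ_self m)))
    (fun p _ => Nat.succ_lt_succ p.2.2) ⟨(TTri.const Tri.id).composable _, trivial⟩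
  refine Op.prodDefined_of_const ?_
  rw [factorsAvee_eq, List.map_append, List.map_map, List.map_singleton]
  exact h1

end InfWedge

end

theorem mainTheorem6 (m : ℕ) :
    (∀ S : Finset (Fin m), InfWedge.TOp.ProdDefined (InfWedge.factorsM S)) ∧
    (∀ π : Finpartition (Finset.univ : Finset (Fin m)),
      InfWedge.Op.ProdDefined (InfWedge.factorsAvee π)) ∧
    (∀ k < m, InfWedge.opM m k = 0) ∧
    InfWedge.opM m m =
      ∑ π : Finpartition (Finset.univ : Finset (Fin m)),
        InfWedge.Op.prod (InfWedge.factorsAvee π) := by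
  have hc : (Finset.univ : Finset (Fin m)).card = m := by rw [Finset.card_univ, Fintype.card_fin]
  refine ⟨InfWedge.prodDefined_factorsM, InfWedge.prodDefined_factorsAvee, fun k hk => ?_, ?_⟩
  · rw [InfWedge.opM_eq, InfWedge.TOp.comp_const, InfWedge.opN_of_lt (hc.symm ▸ hk),
      InfWedge.Op.zero_comp]
  · have h := InfWedge.opN_card (Finset.univ : Finset (Fin m))
    rw [hc] at h
    rw [InfWedge.opM_eq, InfWedge.TOp.comp_const, h,
      InfWedge.Op.sum_comp fun π _ => InfWedge.tri_expAlpha1.composable _]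
    refine Finset.sum_congr rfl fun π _ => ?_
    rw [InfWedge.factorsAvee_eq, InfWedge.prod_opAvee_append π
      (InfWedge.adm_expAlpha1 (Nat.lt_succ_self m)) fun p _ => Nat.succ_lt_succ p.2.2]
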